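/- **Conventions.** Machines are probabilistic multi-tape Turing machines; "runs in time $O(t)$" means that, whatever the coin tosses, the machine halts within $C\cdot t+C$ steps for some constant $C$. $\mathsf{BPTIME}[t(n)]$ is the class of languages $L\subseteq\{0,1\}^*$ decided in probabilistic time $O(t(n))$ on inputs of length $n$ with two-sided error at most $1/3$. A function $T\colon\mathbb N\to\mathbb N$ is time-constructible if a deterministic machine, on input $1^n$, outputs $T(n)$ in binary in time $O(T(n))$. An ensemble $\{\mathcal D_n\}$ of distributions on $\{0,1\}^*$ is polynomial-time samplable if there are a deterministic polynomial-time computable function $f$ and a polynomial $p$ such that, for every $n$, $\mathcal D_n$ is the distribution of $f(1^n,z)$ for uniformly random $z\in\{0,1\}^{p(n)}$. An instance of $\mathsf{CAPP}_{n,n^{e}}$ is a pair $(1^n,C)$ with $C\in\{0,1\}^{n^{e}}$, where $C$ is interpreted (under a fixed encoding in which every string describes a circuit and shorter descriptions can be padded with zeros) as a Boolean circuit with at most $n^{e}$ input variables and at most $n^{e}$ gates. A correct answer is a number $\mu\in[0,1]$ (written in binary) with $$\Bigl|\Pr_{y\in\{0,1\}^{n^{e}}}[C(y)=1]-\mu\Bigr|\le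 \tfrac1{10}.$$ A pseudodeterministic algorithm for $\mathsf{CAPP}_{n,n^{e}}$ running in time $T(n)$ is a probabilistic machine $A$ that, on every instance $(1^n,C)$, runs in time $O(T(n))$ and outputs some fixed value $\mu_{n,C}$, its canonical output, with probability at least $2/3$. The canonical output need not be a correct answer. For a distribution $\mathcal D_n$ on $\{0,1\}^{n^{e}}$, $A$ succeeds with probability $p$ over $\mathcal D_n$ if for $C\sim\mathcal D_n$ the probability that $\mu_{n,C}$ is a correct answer to $(1^n,C)$ is at least $p$. **Theorem.** Let $c\ge 1$ be a real number, let $d\ge1$ be an integer, and let $T\colon\mathbb N\to\mathbb N$ be monotone (nondecreasing) and time-constructible. Suppose that there is a pseudodeterministic algorithm $A$ for $\mathsf{CAPP}_{n,n^{d+1}}$ that runs in time $T(n)$ and that, for every polynomial-time samplable ensemble $\{\mathcal D_n\}$ with $\mathcal D_n$ supported on $\{0,1\}^{n^{d+1}}$, succeeds with probability $1-1/n^c$ over $\mathcal D_n$ for infinitely many $n$. Then there is a language $L\in\mathsf{BPTIME}[T(n)]$ such that for every language $L_0\in\mathsf{BPTIME}[n^d]$ there is a deterministic polynomial-time computable function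 $R\colon\{0,1\}^*\to\{0,1\}^*$ such that, for every polynomial-time samplable ensemble $\{I_n\}$ with $I_n$ supported on $\{0,1\}^n$, for infinitely many $n$, $$\Pr_{x\sim I_n}\bigl[L_0(x)=L(R(x))\bigr]\ \ge\ 1-\frac1{n^c}.$$ -/

import Mathlib

/-! ### Uniform random strings and probabilities of events -/

/-- The uniform distribution on `{0,1}^m`. -/
noncomputable def unifBits (m : ℕ) : PMF (List Bool) :=
  (PMF.uniformOfFintype (List.Vector Bool m)).map List.Vector.toList

/-- The probability of an event, as a real number. -/
noncomputable def prob {α : Type} (μ : PMF α) (S : Set α) : ℝ :=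
  (μ.toOuterMeasure S).toReal

/-! ### Probabilistic multi-tape Turing machines -/

/-- A probabilistic multi-tape Turing machine. There are finitely many two-way infinite tapes,
indexed by `K`, whose cells hold `0`, `1` or blank (`none`). In every step the machine tosses one
fair coin and, depending on the coin, the state and the scanned symbols, it changes its state,
rewrites every scanned cell and moves every head by at most one cell (`none`: the head stays). -/
structure ProbTM where
  /-- the tapes -/
  K : Type
  [finK : Finite K]
  [decK : DecidableEq K]
  /-- the input tape and the output tape -/
  inp : K
  out : K
  /-- the states -/
  Q : Type
  [finQ : Finite Q]
  start : Q
  /-- the halting states -/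
  halts : Q → Bool
  /-- the transition functions, one for each outcome of the coin -/
  δ : Bool → Q → (K → Option Bool) → Q × (K → Option Bool × Option Turing.Dir)

namespace ProbTM

instance (M : ProbTM) : DecidableEq M.K := M.decK

instance (M : ProbTM) : Finite M.K := M.finK

instance (M : ProbTM) : Finite M.Q := M.finQ

/-- A configuration: the state, and the tapes together with their heads. -/
structure Cfg (M : ProbTM) where
  state : M.Q
  tape : M.K → Turing.Tape (Option Bool)

/-- The initial configuration: `x` is on the input tape with the head on its first symbol, and
all other tapes are blank. -/
def init (M : ProbTM) (x : List Bool) : M.Cfg where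
  state := M.start
  tape i := if i = M.inp then Turing.Tape.mk₁ (x.map some) else Turing.Tape.mk₁ []

/-- Overwrite the scanned cell, then move the head. -/
def act (a : Option Bool × Option Turing.Dir) (t : Turing.Tape (Option Bool)) :
    Turing.Tape (Option Bool) :=
  match a.2 with
  | none => t.write a.1
  | some dir => (t.write a.1).move dir

/-- One step, where `b` is the outcome of the coin. Halting configurations do not change. -/
def step (M : ProbTM) (c : M.Cfg) (b : Bool) : M.Cfg :=
  if M.halts c.state then c
  else
    let a := M.δ b c.state fun i => (c.tape i).head
    ⟨a.1, fun i => act (a.2 i) (c.tape i)⟩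

/-- The configuration reached on input `x` after `r.length` steps, if the successive coin tosses
give `r`. -/
def run (M : ProbTM) (x r : List Bool) : M.Cfg :=
  r.foldl M.step (M.init x)

/-- The output in configuration `c` is `y`: on the output tape, `y` is written from the scanned cell
to the right, up to the first blank. -/
def Outputs (M : ProbTM) (c : M.Cfg) (y : List Bool) : Prop :=
  ∀ i : ℕ, i ≤ y.length → (c.tape M.out).nth i = y[i]?

/-- On input `x` the machine halts within `t` steps, whatever the coin tosses. -/
def HaltsWithin (M : ProbTM) (x : List Bool) (t : ℕ) : Prop :=
  ∀ r : List Bool, r.length = t → M.halts (M.run x r).state = true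

/-- The probability that the configuration after `t` steps on input `x` satisfies `E`. -/
noncomputable def probAfter (M : ProbTM) (x : List Bool) (t : ℕ) (E : M.Cfg → Prop) : ℝ :=
  prob (unifBits t) {r | E (M.run x r)}

/-- A deterministic machine ignores its coins. -/
def Deterministic (M : ProbTM) : Prop :=
  M.δ false = M.δ true

/-- `M` outputs `y` on input `x` within `t` steps, whatever the coin tosses. -/
def ComputesWithin (M : ProbTM) (x y : List Bool) (t : ℕ) : Prop :=
  M.HaltsWithin x t ∧ ∀ r : List Bool, r.length = t → M.Outputs (M.run x r) y

end ProbTM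

/-! ### Complexity notions -/

/-- `f` is computable in deterministic polynomial time. -/
def PolyTime (f : List Bool → List Bool) : Prop :=
  ∃ M : ProbTM, M.Deterministic ∧ ∃ p : Polynomial ℕ,
    ∀ x : List Bool, M.ComputesWithin x (f x) (p.eval x.length)

/-- `T` is time-constructible: a deterministic machine maps `1^n` to `T n` in binary within
`O(T n)` steps. -/
def TimeConstructible (T : ℕ → ℕ) : Prop :=
  ∃ M : ProbTM, M.Deterministic ∧ ∃ C : ℕ,
    ∀ n : ℕ, M.ComputesWithin (List.replicate n true) (T n).bits (C * T n + C)

/-- The languages decided with two-sided error `1/3` in probabilistic time `O(T n)`; a machine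
accepts if its output is the string `1`. -/
def BPTIME (T : ℕ → ℕ) : Set (Language Bool) :=
  {L | ∃ M : ProbTM, ∃ C : ℕ, ∀ x : List Bool,
    M.HaltsWithin x (C * T x.length + C) ∧
    (x ∈ L → 2 / 3 ≤ M.probAfter x (C * T x.length + C) fun c => M.Outputs c [true]) ∧
    (x ∉ L → M.probAfter x (C * T x.length + C) (fun c => M.Outputs c [true]) ≤ 1 / 3)}

/-- The string `1^n 0 z`, which encodes the pair `(1^n, z)`. -/
def unaryPair (n : ℕ) (z : List Bool) : List Bool :=
  List.replicate n true ++ false :: z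

/-- Polynomial-time samplable ensembles: `D n` is the distribution of `f (1^n, z)` for uniformly
random `z ∈ {0,1}^{p(n)}`, where `f` is computable in deterministic polynomial time and `p` is a
polynomial. -/
def PolySamplable (D : ℕ → PMF (List Bool)) : Prop :=
  ∃ f : List Bool → List Bool, PolyTime f ∧ ∃ p : Polynomial ℕ,
    ∀ n : ℕ, D n = (unifBits (p.eval n)).map fun z => f (unaryPair n z)

/-! ### Boolean circuits and their descriptions -/

/-- The gates of a Boolean circuit. The numbers `j`, `k` refer to earlier gates of the circuit,
which are numbered from `0`; the number `i` refers to an input variable. -/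
inductive Gate
  | input (i : ℕ)
  | not (j : ℕ)
  | and (j k : ℕ)
  | or (j k : ℕ)

/-- The value of a gate, given the input `y` and the list `v` of the values of all earlier gates.
A reference to an input variable or to a gate that is not there has the value `0`. -/
def Gate.eval (y v : List Bool) : Gate → Bool
  | .input i => y.getD i false
  | .not j => !(v.getD j false)
  | .and j k => v.getD j false && v.getD k false
  | .or j k => v.getD j false || v.getD k false

/-- The value of a circuit (a list of gates in topological order) on input `y`: the value of its
last gate, or `0` if there is no gate. -/
def evalCircuit (G : List Gate) (y : List Bool) : Bool :=
  (G.foldl (fun v g => v ++ [g.eval y v]) []).getLastD false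

/-- Read a natural number from the front of a string: the number with binary digits
`b₀ b₁ … bₘ`, least significant first, is described by `1 b₀ 1 b₁ … 1 bₘ 0`. -/
def decodeNat : List Bool → Option (ℕ × List Bool)
  | false :: l => some (0, l)
  | true :: b :: l => (decodeNat l).map fun a => (Nat.bit b a.1, a.2)
  | _ => none

/-- Read two natural numbers from the front of a string. -/
def decodeNat₂ (l : List Bool) : Option ((ℕ × ℕ) × List Bool) :=
  (decodeNat l).bind fun a => (decodeNat a.2).map fun b => ((a.1, b.1), b.2)

/-- Read a gate from the front of a string: the type of the gate is given by `100` (input),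
`101` (not), `110` (and) or `111` (or), and the references follow. -/
def decodeGate : List Bool → Option (Gate × List Bool)
  | true :: false :: false :: l => (decodeNat l).map fun a => (.input a.1, a.2)
  | true :: false :: true :: l => (decodeNat l).map fun a => (.not a.1, a.2)
  | true :: true :: false :: l => (decodeNat₂ l).map fun a => (.and a.1.1 a.1.2, a.2)
  | true :: true :: true :: l => (decodeNat₂ l).map fun a => (.or a.1.1 a.1.2, a.2)
  | _ => none

/-- Read at most `s` gates, as long as the string goes on with the description of a gate. -/
def decodeGates : ℕ → List Bool → List Gate
  | 0, _ => []
  | s + 1, l =>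
    match decodeGate l with
    | none => []
    | some a => a.1 :: decodeGates s a.2

/-- The circuit described by a string. Every string describes a circuit, with at most as many
gates as the string has bits, and a description may be padded at the end with zeros. -/
def decodeCircuit (C : List Bool) : List Gate :=
  decodeGates C.length C

/-- The acceptance probability of the circuit described by `C` on a uniformly random input from
`{0,1}^m`. -/
noncomputable def acceptProb (C : List Bool) (m : ℕ) : ℝ :=
  prob (unifBits m) {y | evalCircuit (decodeCircuit C) y = true}

/-! ### The circuit acceptance probability problem -/

/-- The number with binary expansion `b₀.b₁b₂…`. -/
noncomputable def binaryValue : List Bool → ℝ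
  | [] => 0
  | b :: l => (if b then 1 else 0) + binaryValue l / 2

/-- `μ` is a correct answer to the instance `(1^n, C)` of the circuit acceptance probability problem
with parameter `e`, in which `C` is a string of length `n^e`. -/
def IsCAPPSolution (e n : ℕ) (C : List Bool) (μ : ℝ) : Prop :=
  0 ≤ μ ∧ μ ≤ 1 ∧ |acceptProb C (n ^ e) - μ| ≤ 1 / 10

/-- Within `t` steps, `A` outputs the number `μ` on the instance `(1^n, C)` with probability at
least `2/3`. -/
def IsCanonicalOutput (A : ProbTM) (t n : ℕ) (C : List Bool) (μ : ℝ) : Prop :=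
  2 / 3 ≤ A.probAfter (unaryPair n C) t fun c => ∃ y, A.Outputs c y ∧ binaryValue y = μ

/-- `A` runs in time `a * T n + a` and has a canonical output on every instance `(1^n, C)` with
`|C| = n^e`. The canonical output need not be a correct answer. -/
def IsPseudodeterministic (A : ProbTM) (e : ℕ) (T : ℕ → ℕ) (a : ℕ) : Prop :=
  ∀ (n : ℕ) (C : List Bool), C.length = n ^ e →
    A.HaltsWithin (unaryPair n C) (a * T n + a) ∧
    ∃ μ : ℝ, IsCanonicalOutput A (a * T n + a) n C μ

/-- The instances `C`, for a given `n`, on which the canonical output of `A` is correct. -/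
def cappSuccess (A : ProbTM) (e : ℕ) (T : ℕ → ℕ) (a n : ℕ) : Set (List Bool) :=
  {C | ∃ μ : ℝ, IsCanonicalOutput A (a * T n + a) n C μ ∧ IsCAPPSolution e n C μ}

/-! Let `L` consist of the well-formed instances `(1^n, C)`, `n ≥ 1`, whose canonical output under
`A` is at least `1/2`. For a machine `M` that decides `L₀` in time `O(n^d)`, the reduction maps `x`
to `(1^n, C_x)`, where the circuit `C_x` receives coin tosses as its input and simulates `M` on `x`.
Its acceptance probability is that of `M`, hence at least `2/3` or at most `1/3`, and an answer that
is correct up to `1/10` lies on the right side of `1/2`. If `x` is drawn from a samplable ensemble,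
then the circuits `C_x` form a samplable ensemble as well, so `A` is correct on most of them for
infinitely many `n`. Three points need work.

The size of `C_x`. The description has to fit into `n^(d+1)` bits, so the quadratic tableau of the
computation is too large. The simulation is recursive instead: for `2w` steps it keeps a window of
six blocks of length `w` on each tape. Twice it copies the three blocks around the head to a window
of the next lower level, simulates `w` steps there and copies the result back (`Simulates.window`,
`Simulates.double`). Copying costs `O(w)`, so `t` steps take `O(t log t)` gates and `O(t (log t)^2)`
bits, which is enough for large `n` (`eventually_gates_le`). The outcome is
`eventually_acceptProb_circuitOf`.

The running time for `L`. A machine tests the format of its input in linear time, runs `A` and looks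
at the first two digits of the output (`halfLanguage_mem_BPTIME`). This presupposes that `T` is at
least linear, which is not assumed but follows. Otherwise `T` is eventually constant, because the
machine that computes it does not reach the end of `1^n`
(`TimeConstructible.linear_or_eventually_const`). For large `n` the algorithm `A` would then not
reach `C`; it could not tell the constant circuits `0` and `1` apart and would fail with probability
at least `1/2` on a random one of them (`exists_linear_le`).

Polynomial time. The map from `x` to `C_x` has to be computed by a Turing machine. Machine fragments
that use their tapes as stacks prove closure properties of a class `PT` of functions between
described types, and `polyTime_circuitOf` is assembled from these. -/

section

/-! ### Machine fragments and their composition -/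

open Turing (Tape ListBlank Dir)

/-- A fragment of a machine with tapes `K`. Every transition either goes to another state or leaves
the fragment. -/
structure Frag (K : Type) where
  Q : Type
  [finQ : Finite Q]
  start : Q
  δ : Bool → Q → (K → Option Bool) → Option Q × (K → Option Bool × Option Dir)

namespace Frag

instance {K : Type} (F : Frag K) : Finite F.Q := F.finQ

variable {K : Type}

abbrev heads (T : K → Tape (Option Bool)) : K → Option Bool := fun i => (T i).head

abbrev acts (a : K → Option Bool × Option Dir) (T : K → Tape (Option Bool)) :
    K → Tape (Option Bool) :=
  fun i => ProbTM.act (a i) (T i)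

/-- Started in state `q` on the tapes `T`, the fragment is left after exactly `r.length` steps with
coin tosses `r`, and the tapes are then `T'`. -/
inductive Path (F : Frag K) :
    F.Q → (K → Tape (Option Bool)) → List Bool → (K → Tape (Option Bool)) → Prop
  | exit {b q T T'} : (F.δ b q (heads T)).1 = none → T' = acts (F.δ b q (heads T)).2 T →
      Path F q T [b] T'
  | step {b q q' T T₁ r T'} : (F.δ b q (heads T)).1 = some q' →
      T₁ = acts (F.δ b q (heads T)).2 T → Path F q' T₁ r T' → Path F q T (b :: r) T'

/-- The fragment ignores the coins. -/
def Det (F : Frag K) : Prop := F.δ false = F.δ true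

/-- The transition that does nothing. -/
abbrev idle (h : K → Option Bool) : K → Option Bool × Option Dir := fun i => (h i, none)

theorem acts_idle (T : K → Tape (Option Bool)) : acts (idle (heads T)) T = T := by
  funext i
  exact Tape.write_self _

/-- A single step. -/
def act (f : (K → Option Bool) → (K → Option Bool × Option Dir)) : Frag K where
  Q := Unit
  start := ()
  δ _ _ h := (none, f h)

/-- Run `P`, then `R`. -/
def seq (P R : Frag K) : Frag K where
  Q := P.Q ⊕ R.Q
  start := .inl P.start
  δ b q h :=
    match q with
    | .inl q => (some (((P.δ b q h).1.map Sum.inl).getD (.inr R.start)), (P.δ b q h).2)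
    | .inr q => ((R.δ b q h).1.map Sum.inr, (R.δ b q h).2)

/-- Branch on the scanned symbols. -/
def ite (c : (K → Option Bool) → Bool) (P R : Frag K) : Frag K where
  Q := Option (P.Q ⊕ R.Q)
  start := none
  δ b q h :=
    match q with
    | none => (some (some (if c h then .inl P.start else .inr R.start)), idle h)
    | some (.inl q) => ((P.δ b q h).1.map (some ∘ Sum.inl), (P.δ b q h).2)
    | some (.inr q) => ((R.δ b q h).1.map (some ∘ Sum.inr), (R.δ b q h).2)

/-- Repeat `P` as long as a condition on the scanned symbols holds. -/
def loop (c : (K → Option Bool) → Bool) (P : Frag K) : Frag K where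
  Q := Option P.Q
  start := none
  δ b q h :=
    match q with
    | none => (if c h then some (some P.start) else none, idle h)
    | some q => (some (P.δ b q h).1, (P.δ b q h).2)

open Classical in
/-- The fragment that works on the tapes in the range of `e`. -/
noncomputable def lift {K' : Type} (e : K → K') (P : Frag K) : Frag K' where
  Q := P.Q
  start := P.start
  δ b q h :=
    ((P.δ b q (h ∘ e)).1,
      fun k' => if hk : ∃ k, e k = k' then (P.δ b q (h ∘ e)).2 hk.choose else (h k', none))

/-- A machine as a fragment, which is left one step after it has halted. -/
def ofTM (M : ProbTM) : Frag M.K where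
  Q := M.Q
  start := M.start
  δ b q h := if M.halts q then (none, idle h) else (some (M.δ b q h).1, (M.δ b q h).2)

/-- A fragment as a machine. -/
def toTM [Finite K] [DecidableEq K] (F : Frag K) (inp out : K) : ProbTM where
  K := K
  inp := inp
  out := out
  Q := Option F.Q
  start := some F.start
  halts q := q.isNone
  δ b q h :=
    match q with
    | none => (none, idle h)
    | some q => F.δ b q h

theorem Det.eq {F : Frag K} (h : F.Det) (b : Bool) : F.δ b = F.δ true := by
  cases b
  · exact h
  · rfl

theorem Det.seq {P R : Frag K} (hP : P.Det) (hR : R.Det) : (seq P R).Det := by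
  funext q h
  rcases q with q | q
  · simp only [Frag.seq, hP.eq false]
  · simp only [Frag.seq, hR.eq false]

theorem Det.ite {c : (K → Option Bool) → Bool} {P R : Frag K} (hP : P.Det) (hR : R.Det) :
    (ite c P R).Det := by
  funext q h
  rcases q with _ | q | q
  · rfl
  · simp only [Frag.ite, hP.eq false]
  · simp only [Frag.ite, hR.eq false]

theorem Det.loop {c : (K → Option Bool) → Bool} {P : Frag K} (hP : P.Det) : (loop c P).Det := by
  funext q h
  rcases q with _ | q
  · rfl
  · simp only [Frag.loop, hP.eq false]

theorem Det.lift {K' : Type} {e : K → K'} {P : Frag K} (hP : P.Det) : (lift e P).Det := by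
  funext q h
  simp only [Frag.lift, hP.eq false]

theorem det_ofTM {M : ProbTM} (hM : M.Deterministic) : (ofTM M).Det := by
  funext q h
  simp only [ofTM, show M.δ false = M.δ true from hM]

theorem Det.toTM [Finite K] [DecidableEq K] {F : Frag K} (hF : F.Det) (inp out : K) :
    (toTM F inp out).Deterministic := by
  funext q h
  rcases q with _ | q
  · rfl
  · simp only [Frag.toTM, hF.eq false]

/-- The step that leaves `P` already enters the start state of `R`, so the coin sequences are
concatenated without an extra toss. -/
theorem Path.seq {P R : Frag K} {q T r T₁ r' T'} (h : P.Path q T r T₁)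
    (h' : R.Path R.start T₁ r' T') : (seq P R).Path (.inl q) T (r ++ r') T' := by
  have hR : ∀ {q T r T'}, R.Path q T r T' → (Frag.seq P R).Path (.inr q) T r T' := by
    intro q T r T' h
    induction h with
    | exit h1 h2 => exact .exit (by simp [Frag.seq, h1]) h2
    | step h1 h2 _ ih => exact .step (by simp [Frag.seq, h1]) h2 ih
  induction h with
  | exit h1 h2 => exact .step (by simp [Frag.seq, h1]) h2 (hR h')
  | step h1 h2 _ ih => exact .step (by simp [Frag.seq, h1]) h2 (ih h')

theorem Path.ite_true {c : (K → Option Bool) → Bool} {P R : Frag K} {T r T'} (b : Bool)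
    (hc : c (heads T) = true) (h : P.Path P.start T r T') :
    (ite c P R).Path none T (b :: r) T' := by
  have hP : ∀ {q T r T'}, P.Path q T r T' → (ite c P R).Path (some (.inl q)) T r T' := by
    intro q T r T' h
    induction h with
    | exit h1 h2 => exact .exit (by simp [ite, h1]) h2
    | step h1 h2 _ ih => exact .step (by simp [ite, h1]) h2 ih
  exact .step (by simp [ite, hc]) rfl ((acts_idle T).symm ▸ hP h)

theorem Path.ite_false {c : (K → Option Bool) → Bool} {P R : Frag K} {T r T'} (b : Bool)
    (hc : c (heads T) = false) (h : R.Path R.start T r T') :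
    (ite c P R).Path none T (b :: r) T' := by
  have hP : ∀ {q T r T'}, R.Path q T r T' → (ite c P R).Path (some (.inr q)) T r T' := by
    intro q T r T' h
    induction h with
    | exit h1 h2 => exact .exit (by simp [ite, h1]) h2
    | step h1 h2 _ ih => exact .step (by simp [ite, h1]) h2 ih
  exact .step (by simp [ite, hc]) rfl ((acts_idle T).symm ▸ hP h)

theorem path_loop_exit {c : (K → Option Bool) → Bool} {P : Frag K} {T} (b : Bool)
    (hc : c (heads T) = false) : (loop c P).Path none T [b] T :=
  .exit (by simp [loop, hc]) (acts_idle T).symm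

/-- The test takes a step of its own, with toss `b`; leaving `P` leads back to the test. -/
theorem Path.loop {c : (K → Option Bool) → Bool} {P : Frag K} {T r T₁ r' T'} (b : Bool)
    (hc : c (heads T) = true) (h : P.Path P.start T r T₁) (h' : (loop c P).Path none T₁ r' T') :
    (loop c P).Path none T (b :: (r ++ r')) T' := by
  have hP : ∀ {q T r T₁}, P.Path q T r T₁ → (Frag.loop c P).Path none T₁ r' T' →
      (Frag.loop c P).Path (some q) T (r ++ r') T' := by
    intro q T r T₁ h h'
    induction h with
    | exit h1 h2 => exact .step (by simp [Frag.loop, h1]) h2 h'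
    | step h1 h2 _ ih => exact .step (by simp [Frag.loop, h1]) h2 (ih h')
  exact .step (by simp [Frag.loop, hc]) rfl ((acts_idle T).symm ▸ hP h h')

/-- Tapes outside the range of `e` are rewritten with the scanned symbol and not moved, so they stay
as they are. The tapes `U` are quantified last so that the induction hypothesis applies to the tapes
after the first step. -/
theorem Path.lift {K' : Type} {e : K → K'} (he : Function.Injective e) {P : Frag K} {q r}
    {T T₁ : K → Tape _} (h : P.Path q T r T₁) :
    ∀ {U U' : K' → Tape _}, U ∘ e = T → U' ∘ e = T₁ → (∀ k', (∀ k, e k ≠ k') → U' k' = U k') →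
      (lift e P).Path q U r U' := by
  have key : ∀ (b : Bool) (q : P.Q) (U : K' → Tape (Option Bool)),
      (acts ((Frag.lift e P).δ b q (heads U)).2 U) ∘ e = acts (P.δ b q (heads (U ∘ e))).2 (U ∘ e) ∧
      ∀ k', (∀ k, e k ≠ k') → acts ((Frag.lift e P).δ b q (heads U)).2 U k' = U k' := by
    intro b q U
    refine ⟨funext fun k => ?_, fun k' hk' => ?_⟩
    · have hk : ∃ k₁, e k₁ = e k := ⟨k, rfl⟩
      have : hk.choose = k := he hk.choose_spec
      simp only [Function.comp, acts, Frag.lift, dif_pos hk, this]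
      rfl
    · have hk : ¬ ∃ k, e k = k' := fun ⟨k, hk⟩ => hk' k hk
      simp only [acts, Frag.lift, dif_neg hk]
      exact Tape.write_self _
  induction h with
  | @exit b q T T' h1 h2 =>
    intro U U' hU hU' hf
    obtain ⟨k1, k2⟩ := key b q U
    subst hU
    refine .exit h1 (funext fun k' => ?_)
    by_cases hk : ∃ k, e k = k'
    · obtain ⟨k, rfl⟩ := hk
      rw [← Function.comp_apply (f := U'), hU', h2, ← k1, Function.comp_apply]
    · have hk' : ∀ k, e k ≠ k' := fun k h => hk ⟨k, h⟩
      rw [hf k' hk', k2 k' hk']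
  | @step b q q' T T₁ r T' h1 h2 _ ih =>
    intro U U' hU hU' hf
    obtain ⟨k1, k2⟩ := key b q U
    subst hU
    exact .step h1 rfl (ih (by rw [h2, k1]) hU' fun k' hk' => by rw [hf k' hk', k2 k' hk'])

/-- The time at which `M` halts depends on the coins, so only some prefix of the tosses is consumed.
The additional step is the one in which the fragment notices that `M` has halted. -/
theorem path_ofTM (M : ProbTM) : ∀ (t : ℕ) (c : M.Cfg) (r : List Bool), r.length = t + 1 →
    M.halts ((r.take t).foldl M.step c).state = true →
    ∃ s ≤ t + 1, (ofTM M).Path c.state c.tape (r.take s) ((r.take t).foldl M.step c).tape := by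
  intro t
  induction t with
  | zero =>
    intro c r hr hh
    obtain ⟨b, rfl⟩ := List.length_eq_one_iff.1 hr
    refine ⟨1, le_rfl, .exit ?_ ?_⟩
    · simp at hh; simp [ofTM, hh]
    · simp at hh; simp only [ofTM, hh]; exact (acts_idle _).symm
  | succ t ih =>
    intro c r hr hh
    obtain ⟨b, r, rfl⟩ : ∃ b r', r = b :: r' := by
      cases r with
      | nil => simp at hr
      | cons b r => exact ⟨b, r, rfl⟩
    simp only [List.take_succ_cons, List.foldl_cons] at hh ⊢
    by_cases hc : M.halts c.state = true
    · have hst : ∀ r : List Bool, r.foldl M.step c = c := by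
        intro r
        induction r with
        | nil => rfl
        | cons b r ih => rw [List.foldl_cons, ProbTM.step, if_pos hc, ih]
      have : M.step c b = c := by rw [ProbTM.step, if_pos hc]
      rw [this, hst]
      refine ⟨1, by omega, ?_⟩
      simp only [List.take_succ_cons, List.take_zero]
      refine .exit (by simp [ofTM, hc]) ?_
      simp only [ofTM, hc]; exact (acts_idle _).symm
    · obtain ⟨s, hs, hp⟩ := ih (M.step c b) r (by simpa using hr) hh
      refine ⟨s + 1, by omega, ?_⟩
      rw [List.take_succ_cons]
      have h1 : M.step c b = ⟨(M.δ b c.state (heads c.tape)).1,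
          acts (M.δ b c.state (heads c.tape)).2 c.tape⟩ := by
        rw [ProbTM.step, if_neg hc]
      rw [h1] at hp ⊢
      refine .step ?_ ?_ hp
      · simp [ofTM, hc]
      · simp [ofTM, hc]

theorem foldl_halted (M : ProbTM) {c : M.Cfg} (h : M.halts c.state = true) (r : List Bool) :
    r.foldl M.step c = c := by
  induction r with
  | nil => rfl
  | cons b r ih => rw [List.foldl_cons, ProbTM.step, if_pos h, ih]

/-- Leaving the fragment means entering the halting state `none`, so the tosses in `r'` have no
effect. -/
theorem Path.toTM [Finite K] [DecidableEq K] {F : Frag K} (inp out : K) {q T r T'}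
    (h : F.Path q T r T') (r' : List Bool) :
    (r ++ r').foldl (toTM F inp out).step ⟨some q, T⟩ = ⟨none, T'⟩ := by
  induction h with
  | @exit b q T T' h1 h2 =>
    have : (Frag.toTM F inp out).step ⟨some q, T⟩ b = ⟨none, T'⟩ := by
      rw [ProbTM.step, if_neg (by simp [Frag.toTM])]
      simp only [Frag.toTM]
      rw [h1, h2]
    rw [List.singleton_append, List.foldl_cons, this]
    exact foldl_halted _ rfl _
  | @step b q q' T T₁ r T' h1 h2 _ ih =>
    have : (Frag.toTM F inp out).step ⟨some q, T⟩ b = ⟨some q', T₁⟩ := by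
      rw [ProbTM.step, if_neg (by simp [Frag.toTM])]
      simp only [Frag.toTM]
      rw [h1, h2]
    rw [List.cons_append, List.foldl_cons, this, ih]

/-! Fragments that use their tapes as stacks -/

/-- The tape that holds the stack `l`. -/
def stackTape (l : List Bool) : Tape (Option Bool) := Tape.mk₁ (l.map some)

abbrev stk (S : K → List Bool) : K → Tape (Option Bool) := fun i => stackTape (S i)

@[simp] theorem stackTape_head (l : List Bool) : (stackTape l).head = l.head? := by
  cases l <;> rfl

theorem heads_stk (S : K → List Bool) : heads (stk S) = fun i => (S i).head? :=
  funext fun _ => stackTape_head _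

/-- The popped cell is erased before the head moves on. Half-tapes that differ by blanks at the far
end are identified, so the result is exactly the tape of the shorter stack. -/
theorem stackTape_pop (l : List Bool) :
    ProbTM.act (none, some Dir.right) (stackTape l) = stackTape l.tail := by
  have : (ListBlank.mk ([] : List (Option Bool))).cons none = ListBlank.mk [] :=
    ListBlank.cons_head_tail (ListBlank.mk ([] : List (Option Bool)))
  simp only [ProbTM.act, stackTape, Tape.mk₁, Tape.mk₂, Tape.write_mk', Tape.move_right_mk',
    ListBlank.head_cons, ListBlank.tail_cons, this, ListBlank.tail_mk, List.map_tail]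

/-- The tape that holds the stack `l`, with the head on the blank cell in front of it. -/
def beforeTape (l : List Bool) : Tape (Option Bool) := Tape.mk₁ (none :: l.map some)

theorem stackTape_left (l : List Bool) :
    ProbTM.act (l.head?, some Dir.left) (stackTape l) = beforeTape l := by
  have h1 : (stackTape l).write l.head? = stackTape l := by
    rw [← stackTape_head]; exact Tape.write_self _
  have h2 : (ListBlank.mk ([] : List (Option Bool))).head = none := rfl
  simp only [ProbTM.act, h1]
  simp only [stackTape, beforeTape, Tape.mk₁, Tape.mk₂, Tape.move_left_mk', ListBlank.tail_mk,
    h2, ListBlank.cons_mk, List.tail_nil]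

theorem beforeTape_write (b : Bool) (l : List Bool) :
    ProbTM.act (some b, none) (beforeTape l) = stackTape (b :: l) := by
  simp only [ProbTM.act, stackTape, beforeTape, Tape.mk₁, Tape.mk₂, Tape.write_mk',
    ListBlank.tail_mk, ListBlank.cons_mk, List.tail_cons, List.map_cons]

theorem stackTape_idle (l : List Bool) : ProbTM.act (l.head?, none) (stackTape l) = stackTape l := by
  rw [← stackTape_head]; exact Tape.write_self _

@[simp] theorem beforeTape_head (l : List Bool) : (beforeTape l).head = none := rfl

/-- With stacks `S`, the fragment is left after exactly `t` steps with stacks `S'`. -/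
def Run (F : Frag K) (S S' : K → List Bool) (t : ℕ) : Prop :=
  ∀ r : List Bool, r.length = t → F.Path F.start (stk S) r (stk S')

theorem Run.congr {F : Frag K} {S S' S'' : K → List Bool} {t t' : ℕ} (h : F.Run S S' t)
    (hS : S' = S'') (ht : t = t') : F.Run S S'' t' := hS ▸ ht ▸ h

theorem Run.seq {P R : Frag K} {S S₁ S' : K → List Bool} {t t' : ℕ} (h : P.Run S S₁ t)
    (h' : R.Run S₁ S' t') : (seq P R).Run S S' (t + t') := by
  intro r hr
  rw [← List.take_append_drop t r]
  exact Path.seq (h _ (by simp; omega)) (h' _ (by simp; omega))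

theorem Run.ite_true {c : (K → Option Bool) → Bool} {P R : Frag K} {S S' : K → List Bool} {t : ℕ}
    (hc : c (fun i => (S i).head?) = true) (h : P.Run S S' t) : (ite c P R).Run S S' (t + 1) := by
  intro r hr
  cases r with
  | nil => simp at hr
  | cons b r => exact Path.ite_true b (by rw [heads_stk]; exact hc) (h _ (by simpa using hr))

theorem Run.ite_false {c : (K → Option Bool) → Bool} {P R : Frag K} {S S' : K → List Bool} {t : ℕ}
    (hc : c (fun i => (S i).head?) = false) (h : R.Run S S' t) : (ite c P R).Run S S' (t + 1) := by
  intro r hr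
  cases r with
  | nil => simp at hr
  | cons b r => exact Path.ite_false b (by rw [heads_stk]; exact hc) (h _ (by simpa using hr))

theorem run_loop_exit {c : (K → Option Bool) → Bool} {P : Frag K} {S : K → List Bool}
    (hc : c (fun i => (S i).head?) = false) : (loop c P).Run S S 1 := by
  intro r hr
  obtain ⟨b, rfl⟩ := List.length_eq_one_iff.1 hr
  exact path_loop_exit b (by rw [heads_stk]; exact hc)

theorem Run.loop {c : (K → Option Bool) → Bool} {P : Frag K} {S S₁ S' : K → List Bool} {t t' : ℕ}
    (hc : c (fun i => (S i).head?) = true) (h : P.Run S S₁ t) (h' : (loop c P).Run S₁ S' t') :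
    (loop c P).Run S S' (1 + t + t') := by
  intro r hr
  cases r with
  | nil => simp at hr; omega
  | cons b r =>
    rw [← List.take_append_drop t r]
    simp only [List.length_cons] at hr
    exact Path.loop b (by rw [heads_stk]; exact hc) (h _ (by simp; omega)) (h' _ (by simp; omega))

theorem Run.lift {K' : Type} {e : K → K'} (he : Function.Injective e) {P : Frag K}
    {S S' : K' → List Bool} {t : ℕ} (h : P.Run (S ∘ e) (S' ∘ e) t)
    (hf : ∀ k', (∀ k, e k ≠ k') → S' k' = S k') : (lift e P).Run S S' t :=
  fun r hr => Path.lift he (h r hr) rfl rfl fun k' hk' => by rw [stk, hf k' hk']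

/-- A step that pops some stacks. -/
def pop (J : K → Bool) : Frag K :=
  act fun h k => if J k then (none, some Dir.right) else (h k, none)

theorem det_pop (J : K → Bool) : (pop J).Det := rfl

theorem run_pop (J : K → Bool) (S : K → List Bool) :
    (pop J).Run S (fun k => if J k then (S k).tail else S k) 1 := by
  intro r hr
  obtain ⟨b, rfl⟩ := List.length_eq_one_iff.1 hr
  refine .exit rfl (funext fun k => ?_)
  simp only [pop, act, acts, heads, stackTape_head]
  cases hk : J k
  · simp only [stk, hk, Bool.false_eq_true, if_false, stackTape_idle]
  · simp only [stk, hk, if_true, stackTape_pop]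

/-- Push onto some stacks a bit that depends on the tops of the stacks, and pop others. -/
def pushPop (g : (K → Option Bool) → K → Option Bool) (J P : K → Bool) : Frag K :=
  seq (act fun h k => (h k, if J k then some Dir.left else none))
    (act fun h k => if J k then (g h k, none) else if P k then (none, some Dir.right)
      else (h k, none))

theorem det_pushPop (g : (K → Option Bool) → K → Option Bool) (J P : K → Bool) :
    (pushPop g J P).Det := Det.seq rfl rfl

/-- A push needs one step to move to the blank cell in front and one to write there. In the second
step the heads in `J` scan a blank, which is why `hg` evaluates `g` with `none` on `J`; the tops of
the other stacks are still visible. -/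
theorem run_pushPop (g : (K → Option Bool) → K → Option Bool) (J P : K → Bool)
    (S : K → List Bool) (v : K → Bool)
    (hg : ∀ k, J k = true → g (fun i => if J i then none else (S i).head?) k = some (v k)) :
    (pushPop g J P).Run S
      (fun k => if J k then v k :: S k else if P k then (S k).tail else S k) 2 := by
  intro r hr
  obtain ⟨b, b', rfl⟩ := List.length_eq_two.1 hr
  have h0 : ∀ k, acts ((fun (h : K → Option Bool) k => (h k, if J k then some Dir.left else none))
      (heads (stk S))) (stk S) k = if J k then beforeTape (S k) else stackTape (S k) := by
    intro k
    simp only [acts, heads, stackTape_head]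
    cases J k
    · exact stackTape_idle _
    · exact stackTape_left _
  refine Path.seq (r := [b]) (.exit rfl rfl) (.exit rfl (funext fun k => ?_))
  have hh : heads (acts ((fun (h : K → Option Bool) k =>
      (h k, if J k then some Dir.left else none)) (heads (stk S))) (stk S)) =
      fun i => if J i then none else (S i).head? := by
    funext i
    simp only [heads]
    rw [show _ = _ from h0 i]
    cases J i <;> simp
  simp only [act]
  rw [hh]
  have h0k := h0 k
  simp only [acts] at h0k ⊢
  rw [h0k]
  cases hJ : J k
  · cases hP : P k
    · simp [stackTape_idle, stk, hJ, hP]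
    · simp [stackTape_pop, stk, hJ, hP]
  · simp only [if_true, hg k hJ, beforeTape_write, stk, hJ]

open Classical in
/-- Move the contents of the stack `i`, reversed, onto each of the stacks in `J`. -/
noncomputable def pour (i : K) (J : K → Bool) : Frag K :=
  loop (fun h => (h i).isSome) (pushPop (fun h _ => h i) J (fun k => k = i))

theorem det_pour (i : K) (J : K → Bool) : (pour i J).Det :=
  (det_pushPop _ _ _).loop

-- Each symbol costs one loop test and the two steps of `pushPop`. If `i` were in `J`, the stack `i`
-- would be pushed instead of popped, hence `hJ`.
open Classical in
theorem run_pour (i : K) (J : K → Bool) (hJ : J i = false) (S : K → List Bool) :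
    (pour i J).Run S
      (fun k => if k = i then [] else if J k then (S i).reverse ++ S k else S k)
      (3 * (S i).length + 1) := by
  obtain ⟨l, hl⟩ : ∃ l, l = S i := ⟨_, rfl⟩
  rw [← hl]
  induction l generalizing S with
  | nil =>
    refine (run_loop_exit (S := S) (by simp [← hl])).congr (funext fun k => ?_) rfl
    by_cases hk : k = i
    · subst hk; simp [hl]
    · simp [hk]
  | cons b l ih =>
    have h1 := run_pushPop (fun h _ => h i) J (fun k => k = i) S (fun _ => b)
      (by intro k _; simp [hJ, ← hl])
    have h2 := ih (fun k => if J k then b :: S k else if (decide (k = i)) then (S k).tail else S k)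
      (by simp [hJ, ← hl])
    refine (Run.loop (by simp [← hl]) h1 h2).congr (funext fun k => ?_) ?_
    · by_cases hk : k = i
      · subst hk; simp
      · by_cases hk' : J k = true <;> simp [hk, hk']
    · simp only [List.length_cons]; ring

end Frag

end

/-! ### Polynomial-time transformations of strings -/

section

open Turing (Tape ListBlank Dir)

theorem Polynomial.eval_mono_nat (p : Polynomial ℕ) {m n : ℕ} (h : m ≤ n) :
    p.eval m ≤ p.eval n := by
  rw [Polynomial.eval_eq_sum_range, Polynomial.eval_eq_sum_range]
  gcongr

/-- The self-delimiting description of a string. -/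
def dbl : List Bool → List Bool
  | [] => [false]
  | b :: l => true :: b :: dbl l

@[simp] theorem length_dbl (l : List Bool) : (dbl l).length = 2 * l.length + 1 := by
  induction l with
  | nil => rfl
  | cons b l ih => simp [dbl, ih]; ring

namespace Frag

variable {W : Type}

/-- The stacks with contents `x` on the main stack and nothing elsewhere. -/
def mainS (x : List Bool) : Option W → List Bool := fun k => k.elim x fun _ => []

@[simp] theorem mainS_none (x : List Bool) : (mainS x : Option W → List Bool) none = x := rfl

@[simp] theorem mainS_some (x : List Bool) (w : W) : mainS x (some w) = [] := rfl

theorem Run.lift_main {W' : Type} {e : W → W'} (he : Function.Injective e) {F : Frag (Option W)}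
    {x y : List Bool} {t : ℕ} (h : F.Run (mainS x) (mainS y) t) :
    (Frag.lift (Option.map e) F).Run (mainS x) (mainS y) t := by
  have hm : ∀ x : List Bool, (mainS x : Option W' → List Bool) ∘ Option.map e = mainS x := by
    intro x; funext k; cases k <;> rfl
  refine Run.lift (Option.map_injective he) (t := t) (by rw [hm, hm]; exact h) ?_
  intro k' hk'
  cases k' with
  | none => exact absurd rfl (hk' none)
  | some w => rfl

/-- Push a fixed bit. -/
def pushBit (b : Bool) : Frag (Option W) := pushPop (fun _ _ => some b) Option.isNone fun _ => false

theorem run_pushBit (b : Bool) (x : List Bool) :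
    (pushBit b : Frag (Option W)).Run (mainS x) (mainS (b :: x)) 2 := by
  refine (run_pushPop _ _ _ _ (fun _ => b) (by simp)).congr (funext fun k => ?_) rfl
  cases k <;> simp

theorem run_popMain (x : List Bool) :
    (pop Option.isNone : Frag (Option W)).Run (mainS x) (mainS x.tail) 1 := by
  refine (run_pop _ _).congr (funext fun k => ?_) rfl
  cases k <;> simp

/-- A main stack, two auxiliary stacks, and further stacks that are empty. -/
def auxS (x y z : List Bool) : Option (Bool ⊕ W) → List Bool
  | none => x
  | some (.inl false) => y
  | some (.inl true) => z
  | some (.inr _) => []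

theorem auxS_nil (x : List Bool) : (auxS x [] [] : Option (Bool ⊕ W) → List Bool) = mainS x := by
  funext k
  rcases k with _ | ⟨_ | _⟩ | _ <;> rfl

abbrev yS : Option (Bool ⊕ W) := some (.inl false)

abbrev zS : Option (Bool ⊕ W) := some (.inl true)

open Classical in
/-- `pour`, with a list of targets. -/
noncomputable def pourTo (i : Option (Bool ⊕ W)) (J : List (Option (Bool ⊕ W))) :
    Frag (Option (Bool ⊕ W)) :=
  pour i fun k => decide (k ∈ J)

theorem det_pourTo (i : Option (Bool ⊕ W)) (J : List (Option (Bool ⊕ W))) : (pourTo i J).Det :=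
  det_pour _ _

theorem run_pour_xz (x y z : List Bool) :
    (pourTo none [zS] : Frag (Option (Bool ⊕ W))).Run (auxS x y z) (auxS [] y (x.reverse ++ z))
      (3 * x.length + 1) := by
  refine (run_pour _ _ (by simp) _).congr (funext fun k => ?_) rfl
  rcases k with _ | ⟨_ | _⟩ | _ <;> simp [auxS]

theorem run_pour_x (x y z : List Bool) :
    (pourTo none [] : Frag (Option (Bool ⊕ W))).Run (auxS x y z) (auxS [] y z)
      (3 * x.length + 1) := by
  refine (run_pour _ _ (by simp) _).congr (funext fun k => ?_) rfl
  rcases k with _ | ⟨_ | _⟩ | _ <;> simp [auxS]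

theorem run_pour_z (x y z : List Bool) :
    (pourTo zS [] : Frag (Option (Bool ⊕ W))).Run (auxS x y z) (auxS x y [])
      (3 * z.length + 1) := by
  refine (run_pour _ _ (by simp) _).congr (funext fun k => ?_) rfl
  rcases k with _ | ⟨_ | _⟩ | _ <;> simp [auxS]

theorem run_pour_zx (x y z : List Bool) :
    (pourTo zS [none] : Frag (Option (Bool ⊕ W))).Run (auxS x y z) (auxS (z.reverse ++ x) y [])
      (3 * z.length + 1) := by
  refine (run_pour _ _ (by simp) _).congr (funext fun k => ?_) rfl
  rcases k with _ | ⟨_ | _⟩ | _ <;> simp [auxS]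

theorem run_pour_zy (x y z : List Bool) :
    (pourTo zS [yS] : Frag (Option (Bool ⊕ W))).Run (auxS x y z) (auxS x (z.reverse ++ y) [])
      (3 * z.length + 1) := by
  refine (run_pour _ _ (by simp) _).congr (funext fun k => ?_) rfl
  rcases k with _ | ⟨_ | _⟩ | _ <;> simp [auxS]

theorem run_pour_zxy (x y z : List Bool) :
    (pourTo zS [none, yS] : Frag (Option (Bool ⊕ W))).Run (auxS x y z)
      (auxS (z.reverse ++ x) (z.reverse ++ y) []) (3 * z.length + 1) := by
  refine (run_pour _ _ (by simp) _).congr (funext fun k => ?_) rfl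
  rcases k with _ | ⟨_ | _⟩ | _ <;> simp [auxS]

theorem run_pour_yz (x y z : List Bool) :
    (pourTo yS [zS] : Frag (Option (Bool ⊕ W))).Run (auxS x y z) (auxS x [] (y.reverse ++ z))
      (3 * y.length + 1) := by
  refine (run_pour _ _ (by simp) _).congr (funext fun k => ?_) rfl
  rcases k with _ | ⟨_ | _⟩ | _ <;> simp [auxS]

theorem run_pushBit_aux (b : Bool) (x y z : List Bool) :
    (pushBit b : Frag (Option (Bool ⊕ W))).Run (auxS x y z) (auxS (b :: x) y z) 2 := by
  refine (run_pushPop _ _ _ _ (fun _ => b) (by simp)).congr (funext fun k => ?_) rfl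
  rcases k with _ | ⟨_ | _⟩ | _ <;> simp [auxS]

theorem run_popMain_aux (x y z : List Bool) :
    (pop Option.isNone : Frag (Option (Bool ⊕ W))).Run (auxS x y z) (auxS x.tail y z) 1 := by
  refine (run_pop _ _).congr (funext fun k => ?_) rfl
  rcases k with _ | ⟨_ | _⟩ | _ <;> simp [auxS]

/-- Pop the second auxiliary stack until it is empty and push the self-delimiting description of
the reversed contents onto the main stack. -/
def dblLoop : Frag (Option (Bool ⊕ W)) :=
  seq (pushBit false)
    (loop (fun h => (h zS).isSome)
      (seq (pushPop (fun h _ => h zS) Option.isNone fun k => k.elim false (Sum.elim id fun _ => false))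
        (pushBit true)))

theorem det_dblLoop : (dblLoop : Frag (Option (Bool ⊕ W))).Det :=
  .seq (det_pushPop _ _ _) (.loop (.seq (det_pushPop _ _ _) (det_pushPop _ _ _)))

theorem run_dblLoop (x y z : List Bool) :
    (dblLoop : Frag (Option (Bool ⊕ W))).Run (auxS x y z) (auxS (dbl z.reverse ++ x) y [])
      (5 * z.length + 3) := by
  have key : ∀ (z x : List Bool) (w : List Bool),
      (loop (fun h => (h zS).isSome)
      (seq (pushPop (fun h _ => h zS) Option.isNone fun k => k.elim false (Sum.elim id fun _ => false))
        (pushBit true)) : Frag (Option (Bool ⊕ W))).Run (auxS (dbl w ++ x) y z)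
          (auxS (dbl (z.reverse ++ w) ++ x) y []) (5 * z.length + 1) := by
    intro z
    induction z with
    | nil => intro x w; exact run_loop_exit (by simp [auxS])
    | cons b z ih =>
      intro x w
      refine (Run.loop (S₁ := auxS (dbl (b :: w) ++ x) y z) (t := 2 + 2) (by simp [auxS]) ?_
        (ih x (b :: w))).congr ?_ ?_
      · refine Run.seq (S₁ := auxS (b :: (dbl w ++ x)) y z) ?_ (run_pushBit_aux _ _ _ _)
        refine (run_pushPop _ _ _ _ (fun _ => b) ?_).congr (funext fun k => ?_) rfl
        · simp [auxS]
        · rcases k with _ | ⟨_ | _⟩ | _ <;> simp [auxS]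
      · simp
      · simp only [List.length_cons]; ring
  exact (Run.seq (run_pushBit_aux _ _ _ _) (key z x [])).congr (by simp) (by ring)

/-- Split the contents of the main stack after the first self-delimiting description. -/
noncomputable def unpair : Frag (Option (Bool ⊕ W)) :=
  seq (loop (fun h => h none = some true)
      (seq (pop Option.isNone) (pushPop (fun h _ => h none) (fun k => k.elim false
        (Sum.elim id fun _ => false)) Option.isNone)))
    (seq (pop Option.isNone) (pourTo zS [yS]))

theorem det_unpair : (unpair : Frag (Option (Bool ⊕ W))).Det :=
  .seq (.loop (.seq (det_pop _) (det_pushPop _ _ _))) (.seq (det_pop _) (det_pourTo _ _))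

/-- Four steps per symbol move the first component, reversed, to the second auxiliary stack; three
more pour it to the first one in the right order. -/
theorem run_unpair (x y : List Bool) :
    (unpair : Frag (Option (Bool ⊕ W))).Run (mainS (dbl y ++ x)) (auxS x y []) (7 * y.length + 3) := by
  have key : ∀ (y x z : List Bool),
      (loop (fun h => h none = some true)
      (seq (pop Option.isNone) (pushPop (fun h _ => h none) (fun k => k.elim false
        (Sum.elim id fun _ => false)) Option.isNone)) : Frag (Option (Bool ⊕ W))).Run
          (auxS (dbl y ++ x) [] z) (auxS (false :: x) [] (y.reverse ++ z)) (4 * y.length + 1) := by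
    intro y
    induction y with
    | nil => intro x z; exact run_loop_exit (by simp [auxS, dbl])
    | cons b y ih =>
      intro x z
      refine (Run.loop (S₁ := auxS (dbl y ++ x) [] (b :: z)) (t := 1 + 2) (by simp [auxS, dbl]) ?_
        (ih x (b :: z))).congr ?_ ?_
      · refine Run.seq (S₁ := auxS (b :: (dbl y ++ x)) [] z) (run_popMain_aux _ _ _) ?_
        refine (run_pushPop _ _ _ _ (fun _ => b) ?_).congr (funext fun k => ?_) rfl
        · simp [auxS]
        · rcases k with _ | ⟨_ | _⟩ | _ <;> simp [auxS]
      · simp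
      · simp only [List.length_cons]; ring
  rw [← auxS_nil]
  refine (Run.seq (key y x []) (Run.seq (run_popMain_aux _ _ _) (run_pour_zy _ _ _))).congr ?_ ?_
  · simp
  · simp; ring

end Frag

open Frag

/-- Deterministic polynomial time computability on a promised set of inputs: a deterministic
fragment transforms `u a` into `v a` on its main stack and leaves its other stacks empty. -/
def PolyRun {α : Type} (u v : α → List Bool) : Prop :=
  ∃ (W : Type) (_ : Finite W) (F : Frag (Option W)), F.Det ∧ ∃ p : Polynomial ℕ, ∀ a,
    (v a).length ≤ p.eval (u a).length ∧
    ∃ t ≤ p.eval (u a).length, F.Run (mainS (u a)) (mainS (v a)) t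

namespace PolyRun

variable {α : Type} {u v w : α → List Bool}

theorem comp {β : Type} {u' v' : β → List Bool} (h' : PolyRun u' v') {g : α → β}
    (hu : ∀ a, u' (g a) = u a) (hv : ∀ a, v' (g a) = v a) : PolyRun u v := by
  obtain ⟨W, hW, F, hF, p, h⟩ := h'
  refine ⟨W, hW, F, hF, p, fun a => ?_⟩
  rw [← hu, ← hv]
  exact h (g a)

/-- Both fragments expect and leave empty auxiliary stacks, so they can be run in succession on
disjoint sets of these. The bound on the length of `v a` turns the time bound of the second fragment
into a polynomial in the length of `u a`. -/
theorem trans (h : PolyRun u v) (h' : PolyRun v w) : PolyRun u w := by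
  obtain ⟨W, hW, F, hF, p, h⟩ := h
  obtain ⟨W', hW', F', hF', p', h'⟩ := h'
  refine ⟨W ⊕ W', inferInstance, seq (lift (Option.map .inl) F) (lift (Option.map .inr) F'),
    hF.lift.seq hF'.lift, p + p'.comp p, fun a => ?_⟩
  obtain ⟨h1, t, ht, hr⟩ := h a
  obtain ⟨h1', t', ht', hr'⟩ := h' a
  have hm := p'.eval_mono_nat h1
  simp only [Polynomial.eval_add, Polynomial.eval_comp]
  exact ⟨by omega, t + t', by omega,
    (hr.lift_main Sum.inl_injective).seq (hr'.lift_main Sum.inr_injective)⟩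

theorem clear : PolyRun u fun _ => [] := by
  refine ⟨Bool ⊕ Empty, inferInstance, pourTo none [], det_pourTo _ _,
    3 * Polynomial.X + 1, fun a => ⟨by simp, 3 * (u a).length + 1, by simp, ?_⟩⟩
  rw [← auxS_nil, ← auxS_nil]
  exact run_pour_x _ _ _

theorem push (b : Bool) : PolyRun u fun a => b :: u a :=
  ⟨Empty, inferInstance, pushBit b, det_pushPop _ _ _, Polynomial.X + 2,
    fun a => ⟨by simp, _, by simp, run_pushBit _ _⟩⟩

theorem pop : PolyRun u fun a => (u a).tail :=
  ⟨Empty, inferInstance, Frag.pop Option.isNone, det_pop _, Polynomial.X + 1,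
    fun a => ⟨by simp; omega, _, by simp, run_popMain _⟩⟩

theorem refl : PolyRun u u := (push true).trans pop

theorem const (l : List Bool) : PolyRun u fun _ => l := by
  induction l with
  | nil => exact clear
  | cons b l ih => exact ih.trans (push b)

/-- The input is duplicated. The first fragment runs with the auxiliary stack `yS` in the role of
its main stack, the second one on the actual main stack, and `dblLoop` puts the first result in
front of the second. -/
theorem pair (h : PolyRun u v) (h' : PolyRun u w) : PolyRun u fun a => dbl (v a) ++ w a := by
  obtain ⟨W, hW, F, hF, p, h⟩ := h
  obtain ⟨W', hW', F', hF', p', h'⟩ := h'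
  let e : Option W → Option (Bool ⊕ (W ⊕ W')) := fun k => k.elim yS fun w => some (.inr (.inl w))
  let e' : Option W' → Option (Bool ⊕ (W ⊕ W')) := fun k => k.map fun w => .inr (.inr w)
  have he : Function.Injective e := by
    intro i j hij
    cases i <;> cases j <;> simp_all [e]
  have he' : Function.Injective e' :=
    Option.map_injective (Sum.inr_injective.comp Sum.inr_injective)
  refine ⟨Bool ⊕ (W ⊕ W'), inferInstance,
    seq (pourTo none [zS]) (seq (pourTo zS [none, yS]) (seq (lift e F) (seq (lift e' F')
      (seq (pourTo yS [zS]) dblLoop)))),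
    .seq (det_pourTo _ _) (.seq (det_pourTo _ _) (.seq hF.lift (.seq hF'.lift
      (.seq (det_pourTo _ _) det_dblLoop)))),
    9 * p + p' + 6 * Polynomial.X + 20, fun a => ?_⟩
  obtain ⟨h1, t, ht, hr⟩ := h a
  obtain ⟨h1', t', ht', hr'⟩ := h' a
  simp only [Polynomial.eval_add, Polynomial.eval_mul, Polynomial.eval_ofNat, Polynomial.eval_X]
  have hrun := Run.seq (P := pourTo none [zS])
    ((run_pour_xz (W := W ⊕ W') (u a) [] []).congr (S'' := auxS [] [] (u a).reverse) (by simp) rfl) <|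
    Run.seq ((run_pour_zxy [] [] (u a).reverse).congr (S'' := auxS (u a) (u a) []) (by simp) rfl) <|
    Run.seq (P := lift e F) (S₁ := auxS (u a) (v a) []) (t := t) ?_ <|
    Run.seq (P := lift e' F') (S₁ := auxS (w a) (v a) []) (t := t') ?_ <|
    Run.seq ((run_pour_yz (w a) (v a) []).congr (S'' := auxS (w a) [] (v a).reverse) (by simp) rfl)
      (run_dblLoop (w a) [] (v a).reverse)
  · rw [auxS_nil, auxS_nil, List.reverse_reverse] at hrun
    refine ⟨by simp; omega, _, ?_, hrun⟩
    simp only [List.length_reverse]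
    omega
  · refine Run.lift he ?_ ?_
    · convert hr using 1 <;> funext k <;> cases k <;> rfl
    · intro k' hk'
      rcases k' with _ | ⟨_ | _⟩ | _
      · rfl
      · exact absurd rfl (hk' none)
      · rfl
      · rfl
  · refine Run.lift he' ?_ ?_
    · convert hr' using 1 <;> funext k <;> cases k <;> rfl
    · intro k' hk'
      rcases k' with _ | ⟨_ | _⟩ | _
      · exact absurd rfl (hk' none)
      · rfl
      · rfl
      · rfl

theorem fst : PolyRun (fun a => dbl (v a) ++ w a) v := by
  refine ⟨Bool ⊕ Empty, inferInstance,
    seq unpair (seq (pourTo none []) (seq (pourTo yS [zS]) (pourTo zS [none]))),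
    .seq det_unpair (.seq (det_pourTo _ _) (.seq (det_pourTo _ _) (det_pourTo _ _))),
    20 * Polynomial.X + 20, fun a => ?_⟩
  simp only [Polynomial.eval_add, Polynomial.eval_mul, Polynomial.eval_ofNat, Polynomial.eval_X,
    List.length_append, length_dbl]
  refine ⟨by omega, _, ?_, (Run.seq (run_unpair _ _) <| Run.seq (run_pour_x _ _ _) <|
    Run.seq (run_pour_yz _ _ _) (run_pour_zx _ _ _)).congr ?_ rfl⟩
  · simp; omega
  · rw [← auxS_nil]; simp

theorem snd : PolyRun (fun a => dbl (v a) ++ w a) w := by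
  refine ⟨Bool ⊕ Empty, inferInstance,
    seq unpair (seq (pourTo yS [zS]) (pourTo zS [])),
    .seq det_unpair (.seq (det_pourTo _ _) (det_pourTo _ _)),
    20 * Polynomial.X + 20, fun a => ?_⟩
  simp only [Polynomial.eval_add, Polynomial.eval_mul, Polynomial.eval_ofNat, Polynomial.eval_X,
    List.length_append, length_dbl]
  refine ⟨by omega, _, ?_, (Run.seq (run_unpair _ _) <|
    Run.seq (run_pour_yz _ _ _) (run_pour_z _ _ _)).congr ?_ rfl⟩
  · simp; omega
  · rw [← auxS_nil]

/-- Each fragment only has to work on the inputs that reach it; this is the use of indexing `u` and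
`v` by a type of promised inputs. -/
theorem branch (c : Option Bool → Bool)
    (h : PolyRun (fun a : {a // c (u a).head? = true} => u a) fun a => v a)
    (h' : PolyRun (fun a : {a // c (u a).head? = false} => u a) fun a => v a) : PolyRun u v := by
  obtain ⟨W, hW, F, hF, p, h⟩ := h
  obtain ⟨W', hW', F', hF', p', h'⟩ := h'
  refine ⟨W ⊕ W', inferInstance,
    ite (fun h => c (h none)) (lift (Option.map .inl) F) (lift (Option.map .inr) F'),
    hF.lift.ite hF'.lift, p + p' + 1, fun a => ?_⟩
  simp only [Polynomial.eval_add, Polynomial.eval_one]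
  cases hc : c (u a).head?
  · obtain ⟨h1, t, ht, hr⟩ := h' ⟨a, hc⟩
    refine ⟨?_, t + 1, ?_, .ite_false hc (hr.lift_main Sum.inr_injective)⟩ <;> dsimp at * <;> omega
  · obtain ⟨h1, t, ht, hr⟩ := h ⟨a, hc⟩
    refine ⟨?_, t + 1, ?_, .ite_true hc (hr.lift_main Sum.inl_injective)⟩ <;> dsimp at * <;> omega

theorem append : PolyRun (fun a => dbl (v a) ++ w a) fun a => v a ++ w a := by
  refine ⟨Bool ⊕ Empty, inferInstance,
    seq unpair (seq (pourTo yS [zS]) (pourTo zS [none])),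
    .seq det_unpair (.seq (det_pourTo _ _) (det_pourTo _ _)),
    20 * Polynomial.X + 20, fun a => ?_⟩
  simp only [Polynomial.eval_add, Polynomial.eval_mul, Polynomial.eval_ofNat, Polynomial.eval_X,
    List.length_append, length_dbl]
  refine ⟨by omega, _, ?_, (Run.seq (run_unpair _ _) <|
    Run.seq (run_pour_yz _ _ _) (run_pour_zx _ _ _)).congr ?_ rfl⟩
  · simp; omega
  · rw [← auxS_nil]; simp

/-- The string `c a` is only a counter, from which every pass pops one symbol. A bound on all
intermediate descriptions has to be assumed, since a polynomial-time `f` may double the length in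
every pass. -/
theorem iterate {σ : Type} {e : σ → List Bool} {f : σ → σ} (hf : PolyRun e fun s => e (f s))
    (c : α → List Bool) (s : α → σ) (p : Polynomial ℕ)
    (hp : ∀ a, ∀ i ≤ (c a).length, (e (f^[i] (s a))).length ≤ p.eval ((c a).length + (e (s a)).length)) :
    PolyRun (fun a => dbl (c a) ++ e (s a)) fun a => e (f^[(c a).length] (s a)) := by
  obtain ⟨W, hW, F, hF, q, h⟩ := hf
  let e' : Option W → Option (Bool ⊕ W) := Option.map .inr
  have he' : Function.Injective e' := Option.map_injective Sum.inr_injective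
  refine ⟨Bool ⊕ W, inferInstance, seq unpair (loop (fun h => (h yS).isSome)
      (seq (Frag.pop fun k => k.elim false (Sum.elim not fun _ => false)) (lift e' F))),
    .seq det_unpair (.loop (.seq (det_pop _) hF.lift)),
    p + 7 * Polynomial.X + Polynomial.X * (q.comp p + 2) + 5, fun a => ?_⟩
  -- Here `i` is the number of passes still to come, so the induction goes backwards from the end of
  -- the computation.
  have key : ∀ i ≤ (c a).length, ∃ t ≤ i * (q.eval (p.eval ((c a).length + (e (s a)).length)) + 2) + 1,
      (loop (fun h => (h yS).isSome)
        (seq (Frag.pop fun k => k.elim false (Sum.elim not fun _ => false)) (lift e' F))).Run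
        (auxS (e (f^[(c a).length - i] (s a))) ((c a).drop ((c a).length - i)) []) (auxS (e (f^[(c a).length] (s a))) [] []) t
      := by
    intro i
    induction i with
    | zero =>
      intro _
      rw [Nat.sub_zero, List.drop_length]
      exact ⟨1, by omega, run_loop_exit (by simp [auxS])⟩
    | succ i ih =>
      intro hi
      obtain ⟨t, ht, hr⟩ := ih (by omega)
      obtain ⟨h1, t', ht', hr'⟩ := h (f^[(c a).length - (i + 1)] (s a))
      have hm := q.eval_mono_nat (hp a ((c a).length - (i + 1)) (by omega))
      refine ⟨1 + (1 + t') + t, ?_, Run.loop (by simp [auxS]; omega) ?_ hr⟩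
      · rw [Nat.succ_mul]; omega
      · refine Run.seq (S₁ := auxS (e (f^[(c a).length - (i + 1)] (s a))) ((c a).drop ((c a).length - i)) []) ?_ ?_
        · refine (run_pop _ _).congr (funext fun k => ?_) rfl
          rcases k with _ | ⟨_ | _⟩ | _ <;> simp [auxS]
          omega
        · refine Run.lift he' ?_ ?_
          · beta_reduce at hr'
            rw [← Function.iterate_succ_apply' f, show ((c a).length - (i + 1)).succ = (c a).length - i by omega] at hr'
            convert hr' using 1 <;> funext k <;> cases k <;> rfl
          · intro k' hk'
            rcases k' with _ | ⟨_ | _⟩ | _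
            · exact absurd rfl (hk' none)
            · rfl
            · rfl
            · rfl
  obtain ⟨t, ht, hr⟩ := key ((c a).length) le_rfl
  simp only [Polynomial.eval_add, Polynomial.eval_mul, Polynomial.eval_ofNat, Polynomial.eval_X,
    Polynomial.eval_comp, List.length_append, length_dbl]
  have hle : (c a).length + (e (s a)).length ≤ 2 * (c a).length + 1 + (e (s a)).length := by omega
  have hm := p.eval_mono_nat hle
  have hm' := q.eval_mono_nat hm
  have hm'' : (c a).length * (q.eval (p.eval ((c a).length + (e (s a)).length)) + 2) ≤
      (2 * (c a).length + 1 + (e (s a)).length) *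
        (q.eval (p.eval (2 * (c a).length + 1 + (e (s a)).length)) + 2) :=
    Nat.mul_le_mul (by omega) (by omega)
  rw [Nat.sub_self, auxS_nil] at hr
  refine ⟨(hp a _ le_rfl).trans (by omega), _, ?_, Run.seq (run_unpair _ _) hr⟩
  omega

end PolyRun

end

/-! ### Descriptions of data and a calculus of polynomial-time functions -/

section

/-- Types whose elements are described by strings. -/
class Enc (α : Type) where
  enc : α → List Bool

open Enc

/-- A string, described by itself. -/
structure Str where
  bits : List Bool

/-- The descriptions are chosen to coincide where possible: a `Bool` is described like an `Option
Unit`, a successor like `some` of its predecessor, and a nonempty list like the pair of its head and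
its tail. Numbers are written in unary. -/
instance : Enc Unit := ⟨fun _ => []⟩

instance : Enc Bool := ⟨fun b => if b then [true] else []⟩

instance : Enc ℕ := ⟨fun n => List.replicate n true⟩

instance : Enc Str := ⟨Str.bits⟩

instance {α β : Type} [Enc α] [Enc β] : Enc (α × β) := ⟨fun a => dbl (enc a.1) ++ enc a.2⟩

instance {α : Type} [Enc α] : Enc (List α) := ⟨fun l => l.flatMap fun a => dbl (enc a)⟩

instance {α : Type} [Enc α] : Enc (Option α) := ⟨fun o => o.elim [] fun a => true :: enc a⟩

/-- The length of the description. -/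
def size {α : Type} [Enc α] (a : α) : ℕ := (enc a).length

section size

variable {α β : Type} [Enc α] [Enc β]

@[simp] theorem size_nat (n : ℕ) : size n = n := by simp [size, enc]

@[simp] theorem size_str (s : Str) : size s = s.bits.length := rfl

@[simp] theorem size_prod (a : α × β) : size a = 2 * size a.1 + 1 + size a.2 := by
  simp [size, enc]

@[simp] theorem size_nil : size ([] : List α) = 0 := rfl

@[simp] theorem size_cons (a : α) (l : List α) : size (a :: l) = 2 * size a + 1 + size l := by
  simp [size, enc]

@[simp] theorem size_append (l l' : List α) : size (l ++ l') = size l + size l' := by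
  simp [size, enc]

theorem size_bool (b : Bool) : size b ≤ 1 := by cases b <;> simp [size, enc]

theorem length_le_size (l : List α) : l.length ≤ size l := by
  induction l with
  | nil => simp
  | cons a l ih => simp; omega

theorem size_le_of_mem {a : α} {l : List α} (h : a ∈ l) : size a ≤ size l := by
  induction l with
  | nil => simp at h
  | cons b l ih =>
    rcases List.mem_cons.1 h with rfl | h
    · simp; omega
    · have := ih h; simp; omega

theorem size_le_of_forall {l : List α} {m : ℕ} (h : ∀ a ∈ l, size a ≤ m) :
    size l ≤ l.length * (2 * m + 1) := by
  induction l with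
  | nil => simp
  | cons b l ih =>
    have h1 := h b (by simp)
    have h2 := ih fun a ha => h a (by simp [ha])
    rw [size_cons, List.length_cons, Nat.add_mul, Nat.one_mul]
    omega

end size

/-- Polynomial-time computability. -/
@[fun_prop]
def PT {α β : Type} [Enc α] [Enc β] (f : α → β) : Prop := PolyRun (enc : α → _) fun a => enc (f a)

namespace PT

variable {α β γ σ : Type} [Enc α] [Enc β] [Enc γ] [Enc σ]

theorem bound {f : α → β} (hf : PT f) : ∃ p : Polynomial ℕ, ∀ a, size (f a) ≤ p.eval (size a) := by
  obtain ⟨W, hW, F, hF, p, h⟩ := hf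
  exact ⟨p, fun a => (h a).1⟩

/-- Only descriptions matter, so coinciding ones give changes of type for free. -/
theorem of_enc_eq {f : α → β} {g : α → γ} (hg : PT g) (h : ∀ a, enc (f a) = enc (g a)) : PT f := by
  have : (fun a => enc (f a)) = fun a => enc (g a) := funext h
  rw [PT, this]
  exact hg

@[fun_prop] theorem id : PT fun a : α => a := PolyRun.refl

@[fun_prop] theorem const (b : β) : PT fun _ : α => b := PolyRun.const _

@[fun_prop] theorem comp {g : β → γ} {f : α → β} (hg : PT g) (hf : PT f) : PT fun a => g (f a) :=
  hf.trans (PolyRun.comp hg (g := f) (fun _ => rfl) fun _ => rfl)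

@[fun_prop] theorem prodMk {f : α → β} {g : α → γ} (hf : PT f) (hg : PT g) :
    PT fun a => (f a, g a) := PolyRun.pair hf hg

theorem fst' : PT (Prod.fst : α × β → α) :=
  PolyRun.fst (v := fun a : α × β => enc a.1) (w := fun a => enc a.2)

theorem snd' : PT (Prod.snd : α × β → β) :=
  PolyRun.snd (v := fun a : α × β => enc a.1) (w := fun a => enc a.2)

@[fun_prop] theorem fst {f : α → β × γ} (hf : PT f) : PT fun a => (f a).1 := fst'.comp hf

@[fun_prop] theorem snd {f : α → β × γ} (hf : PT f) : PT fun a => (f a).2 := snd'.comp hf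

-- The description of the pair `(o a, a)` starts with `false` exactly if `o a` is `none`, and then
-- removing this symbol leaves `a`. Otherwise, removing two symbols leaves the description of the
-- pair of the value and `a`.
@[fun_prop] theorem optionElim {o : α → Option β} {f : α → γ} {g : α → β → γ} (ho : PT o)
    (hf : PT f) (hg : PT fun q : α × β => g q.1 q.2) : PT fun a => (o a).elim (f a) (g a) := by
  refine comp (g := fun q : Option β × α => q.1.elim (f q.2) (g q.2)) ?_ (ho.prodMk id)
  refine PolyRun.branch (fun o => o == some false) ?_ ?_
  · refine PolyRun.pop.trans (PolyRun.comp hf (g := fun a => a.1.2) ?_ ?_)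
    · rintro ⟨⟨_ | b, a⟩, h⟩
      · simp [enc, dbl]
      · simp [enc, dbl] at h
    · rintro ⟨⟨_ | b, a⟩, h⟩
      · simp
      · simp [enc, dbl] at h
  · refine PolyRun.pop.trans (PolyRun.pop.trans ?_)
    have hg' : PT fun q : β × α => g q.2 q.1 :=
      comp (g := fun q : α × β => g q.1 q.2) (f := fun q : β × α => (q.2, q.1)) hg (by fun_prop)
    -- The default element used to name the value exists unless `β` is empty, and then no input
    -- takes this branch.
    by_cases hb : Nonempty β
    · have : Inhabited β := Classical.inhabited_of_nonempty hb
      refine PolyRun.comp hg' (g := fun a => (a.1.1.getD default, a.1.2)) ?_ ?_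
      · rintro ⟨⟨_ | b, a⟩, h⟩
        · simp [enc, dbl] at h
        · simp [enc, dbl]
      · rintro ⟨⟨_ | b, a⟩, h⟩
        · simp [enc, dbl] at h
        · simp
    · refine PolyRun.comp hf (g := fun a => a.1.2) ?_ ?_
      · rintro ⟨⟨_ | b, a⟩, h⟩
        · simp [enc, dbl] at h
        · exact absurd ⟨b⟩ hb
      · rintro ⟨⟨_ | b, a⟩, h⟩
        · simp [enc, dbl] at h
        · exact absurd ⟨b⟩ hb

@[fun_prop] theorem cond {c : α → Bool} {f g : α → β} (hc : PT c) (hf : PT f) (hg : PT g) :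
    PT fun a => cond (c a) (f a) (g a) := by
  have h : PT fun a => if c a then Option.some () else none :=
    of_enc_eq hc fun a => by cases c a <;> rfl
  have := optionElim (g := fun a _ => f a) h hg (by fun_prop)
  convert this using 2 with a
  cases c a <;> rfl

theorem ite {P : α → Prop} [DecidablePred P] {f g : α → β} (hP : PT fun a => decide (P a))
    (hf : PT f) (hg : PT g) : PT fun a => if P a then f a else g a := by
  have := cond hP hf hg
  convert this using 2 with a
  by_cases h : P a <;> simp [h]

@[fun_prop] theorem and {f g : α → Bool} (hf : PT f) (hg : PT g) : PT fun a => f a && g a := by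
  have := cond hf hg (const false)
  convert this using 2 with a
  cases f a <;> rfl

@[fun_prop] theorem not {f : α → Bool} (hf : PT f) : PT fun a => !f a := by
  have := cond hf (const false) (const true)
  convert this using 2 with a
  cases f a <;> rfl

/-! Natural numbers, lists and strings -/

/-- The predecessor of a positive number. -/
def natOpt : ℕ → Option ℕ
  | 0 => none
  | n + 1 => Option.some n

@[fun_prop] theorem natOpt' {f : α → ℕ} (hf : PT f) : PT fun a => natOpt (f a) :=
  of_enc_eq hf fun a => by cases f a <;> rfl

@[fun_prop] theorem pred {f : α → ℕ} (hf : PT f) : PT fun a => (f a).pred := by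
  have := optionElim (g := fun _ n => n) (natOpt' hf) (const 0) (by fun_prop)
  convert this using 2 with a
  cases f a <;> rfl

@[fun_prop] theorem add {f g : α → ℕ} (hf : PT f) (hg : PT g) : PT fun a => f a + g a := by
  have : PolyRun (fun a => dbl (enc (f a)) ++ enc (g a)) fun a => enc (f a + g a) := by
    convert PolyRun.append (v := fun a => enc (f a)) (w := fun a => enc (g a)) using 2 with a
    simp [enc]
  exact PolyRun.trans (hf.prodMk hg) this

@[fun_prop] theorem append {f g : α → List β} (hf : PT f) (hg : PT g) :
    PT fun a => f a ++ g a := by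
  have : PolyRun (fun a => dbl (enc (f a)) ++ enc (g a)) fun a => enc (f a ++ g a) := by
    convert PolyRun.append (v := fun a => enc (f a)) (w := fun a => enc (g a)) using 2 with a
    simp [enc]
  exact PolyRun.trans (hf.prodMk hg) this

@[fun_prop] theorem cons {f : α → β} {g : α → List β} (hf : PT f) (hg : PT g) :
    PT fun a => f a :: g a :=
  of_enc_eq (hf.prodMk hg) fun _ => rfl

@[fun_prop] theorem strAppend {f g : α → Str} (hf : PT f) (hg : PT g) :
    PT fun a => Str.mk ((f a).bits ++ (g a).bits) :=
  PolyRun.trans (hf.prodMk hg) PolyRun.append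

@[fun_prop] theorem strCons {f : α → Str} (b : Bool) (hf : PT f) :
    PT fun a => Str.mk (b :: (f a).bits) := PolyRun.trans hf (PolyRun.push b)

/-- The head and the tail of a list. -/
def uncons (l : List β) : Option (β × List β) :=
  match l with
  | [] => none
  | b :: l => Option.some (b, l)

-- A nonempty list is already described like the pair of head and tail, so only the symbol of `some`
-- is pushed; the empty list is already described like `none`.
@[fun_prop] theorem uncons' {f : α → List β} (hf : PT f) : PT fun a => uncons (f a) := by
  refine comp (g := uncons) ?_ hf
  refine PolyRun.branch (fun o => o == none) ?_ ?_
  · refine PolyRun.comp (id (α := List β)) (g := Subtype.val) (fun _ => rfl) ?_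
    rintro ⟨_ | ⟨b, l⟩, h⟩
    · rfl
    · simp [enc] at h
      cases hb : enc b <;> simp [hb, dbl] at h
  · have h1 : PolyRun (fun a : List β => enc a) (fun a => true :: enc a) := PolyRun.push true
    refine PolyRun.comp h1 (g := Subtype.val) (fun _ => rfl) ?_
    rintro ⟨_ | ⟨b, l⟩, h⟩
    · simp [enc] at h
    · simp [enc, uncons]

/-- The first bit and the rest of a string. -/
def strUncons (s : Str) : Option (Bool × Str) :=
  match s.bits with
  | [] => none
  | b :: l => Option.some (b, ⟨l⟩)

-- A string that starts with `false` already describes the pair of this bit and the rest. A first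
-- bit `true` has to be replaced by its self-delimiting description.
@[fun_prop] theorem strUncons' {f : α → Str} (hf : PT f) : PT fun a => strUncons (f a) := by
  refine comp (g := strUncons) ?_ hf
  refine PolyRun.branch (fun o => o == Option.some true) ?_ ?_
  · have h1 : PolyRun (fun a : Str => enc a) (fun a => true :: true :: true :: false :: (enc a).tail) :=
      PolyRun.pop.trans <| (PolyRun.push false).trans <| (PolyRun.push true).trans <|
        (PolyRun.push true).trans (PolyRun.push true)
    refine PolyRun.comp h1 (g := Subtype.val) (fun _ => rfl) ?_
    rintro ⟨⟨_ | ⟨_ | _, l⟩⟩, h⟩ <;> simp [enc, strUncons, dbl] at h ⊢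
  · refine PolyRun.branch (fun o => o == none) ?_ ?_
    · refine PolyRun.comp (id (α := Str)) (g := fun a => a.1.1) (fun _ => rfl) ?_
      rintro ⟨⟨⟨_ | ⟨b, l⟩⟩, h⟩, h'⟩
      · rfl
      · simp [enc] at h'
    · have h1 : PolyRun (fun a : Str => enc a) (fun a => true :: enc a) := PolyRun.push true
      refine PolyRun.comp h1 (g := fun a => a.1.1) (fun _ => rfl) ?_
      rintro ⟨⟨⟨_ | ⟨_ | _, l⟩⟩, h⟩, h'⟩ <;> simp [enc, strUncons, dbl] at h h' ⊢

/-! Recursion -/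

/-- `PolyRun.iterate` iterates one fixed map, so the parameter `a` is carried along as a part of the
state. -/
theorem iterate {c : α → β} {s : α → σ} {f : α → σ → σ} (hc : PT c) (hs : PT s)
    (hf : PT fun q : α × σ => f q.1 q.2) (p : Polynomial ℕ)
    (hp : ∀ a, ∀ i ≤ size (c a), size ((f a)^[i] (s a)) ≤ p.eval (size a)) :
    PT fun a => (f a)^[size (c a)] (s a) := by
  let F : α × σ → α × σ := fun q => (q.1, f q.1 q.2)
  have hF : PT F := by fun_prop
  have hit : ∀ a i t, F^[i] (a, t) = (a, (f a)^[i] t) := by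
    intro a i
    induction i with
    | zero => intro t; rfl
    | succ i ih => intro t; rw [Function.iterate_succ_apply, ih, Function.iterate_succ_apply]
  have := PolyRun.iterate hF (fun a => enc (c a)) (fun a => (a, s a)) (2 * Polynomial.X + 1 + p) ?_
  · have h2 := PolyRun.trans (hc.prodMk (id.prodMk hs)) this
    have h3 : PolyRun (fun a : α => enc a) fun a => enc (F^[size (c a)] (a, s a)).2 :=
      PolyRun.trans h2 (PolyRun.comp snd' (g := fun a => F^[size (c a)] (a, s a)) (fun _ => rfl)
        fun _ => rfl)
    simp only [hit] at h3
    exact h3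
  · intro a i hi
    have h1 := hp a i hi
    rw [hit]
    have h2 : size (a, (f a)^[i] (s a)) = 2 * size a + 1 + size ((f a)^[i] (s a)) := by simp
    have h3 : size (a, s a) = 2 * size a + 1 + size (s a) := by simp
    have h4 := p.eval_mono_nat (show size a ≤ (enc (c a)).length + size (a, s a) by omega)
    change size (a, (f a)^[i] (s a)) ≤ Polynomial.eval ((enc (c a)).length + size (a, s a)) _
    simp only [Polynomial.eval_add, Polynomial.eval_mul, Polynomial.eval_ofNat, Polynomial.eval_X,
      Polynomial.eval_one]
    omega

theorem natIterate {c : α → ℕ} {s : α → σ} {f : α → σ → σ} (hc : PT c) (hs : PT s)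
    (hf : PT fun q : α × σ => f q.1 q.2) (p : Polynomial ℕ)
    (hp : ∀ a, ∀ i ≤ c a, size ((f a)^[i] (s a)) ≤ p.eval (size a)) :
    PT fun a => (f a)^[c a] (s a) := by
  have := iterate hc hs hf p (by simpa using hp)
  simpa using this

/-- The iteration consumes one entry of the list per pass. It makes `size (l a)` passes, which is at
least the length; the surplus ones find an empty list and do nothing. The accumulator is bounded on
all prefixes because its intermediate values belong to these. -/
theorem foldl {l : α → List β} {s : α → σ} {f : α → σ → β → σ} (hl : PT l) (hs : PT s)
    (hf : PT fun q : α × σ × β => f q.1 q.2.1 q.2.2) (p : Polynomial ℕ)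
    (hp : ∀ a, ∀ l', l' <+: l a → size (l'.foldl (f a) (s a)) ≤ p.eval (size a)) :
    PT fun a => (l a).foldl (f a) (s a) := by
  let F : α → List β × σ → List β × σ := fun a q =>
    (uncons q.1).elim q fun u => (u.2, f a q.2 u.1)
  have hF : PT fun q : α × List β × σ => F q.1 q.2 := by
    refine optionElim (by fun_prop) (by fun_prop) ?_
    refine prodMk (by fun_prop) ?_
    exact comp (g := fun q : α × σ × β => f q.1 q.2.1 q.2.2)
      (f := fun q : (α × List β × σ) × (β × List β) => (q.1.1, q.1.2.2, q.2.1)) hf (by fun_prop)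
  have hit : ∀ a i l' t, (F a)^[i] (l', t) = (l'.drop i, (l'.take i).foldl (f a) t) := by
    intro a i
    induction i with
    | zero => intro l' t; simp
    | succ i ih =>
      intro l' t
      rw [Function.iterate_succ_apply]
      cases l' with
      | nil => rw [show F a ([], t) = ([], t) from rfl, ih]; simp
      | cons b l' => rw [show F a (b :: l', t) = (l', f a t b) from rfl, ih]; simp
  have hdrop : ∀ (l : List β) i, size (l.drop i) ≤ size l := by
    intro l i
    conv_rhs => rw [← List.take_append_drop i l, size_append]
    omega
  obtain ⟨q, hq⟩ := hl.bound
  have := iterate hl (hl.prodMk hs) hF (2 * q + 1 + p) ?_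
  · have h2 := this.snd
    simp only [hit] at h2
    convert h2 using 3 with a
    rw [List.take_of_length_le (length_le_size _)]
  · intro a i _
    rw [hit]
    have h1 := hp a _ (List.take_prefix i (l a))
    have h2 := hdrop (l a) i
    have h3 := hq a
    simp only [size_prod, Polynomial.eval_add, Polynomial.eval_mul, Polynomial.eval_ofNat,
      Polynomial.eval_one]
    omega

theorem flatMap_size {β : Type} (l : List β) (g : β → List γ) (m : ℕ) (h : ∀ b ∈ l, size (g b) ≤ m) :
    size (l.flatMap g) ≤ l.length * m := by
  induction l with
  | nil => simp
  | cons b l ih =>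
    have h1 := h b (by simp)
    have h2 := ih fun a ha => h a (by simp [ha])
    simp only [List.flatMap_cons, size_append, List.length_cons, Nat.succ_mul]
    omega

@[fun_prop] theorem flatMap {l : α → List β} {g : α → β → List γ} (hl : PT l)
    (hg : PT fun q : α × β => g q.1 q.2) : PT fun a => (l a).flatMap (g a) := by
  obtain ⟨p, hp⟩ := hl.bound
  obtain ⟨q, hq⟩ := hg.bound
  have hfold : ∀ (g : β → List γ) (l : List β) (s : List γ),
      l.foldl (fun s b => s ++ g b) s = s ++ l.flatMap g := by
    intro g l
    induction l with
    | nil => simp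
    | cons b l ih => intro s; simp [ih]
  have := foldl (s := fun _ => ([] : List γ)) (f := fun a s b => s ++ g a b) hl (const _) ?_
    (p * q.comp (2 * Polynomial.X + 1 + p)) ?_
  · simpa only [hfold, List.nil_append] using this
  · refine append (by fun_prop) ?_
    exact comp (g := fun q : α × β => g q.1 q.2)
      (f := fun q : α × List γ × β => (q.1, q.2.2)) hg (by fun_prop)
  · intro a l' hl'
    rw [hfold, List.nil_append, Polynomial.eval_mul, Polynomial.eval_comp]
    refine (flatMap_size _ _ (q.eval ((2 * Polynomial.X + 1 + p).eval (size a))) ?_).trans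
      (Nat.mul_le_mul_right _ ?_)
    · intro b hb
      refine (hq (a, b)).trans (q.eval_mono_nat ?_)
      have h1 := size_le_of_mem (hl'.subset hb)
      have h2 := hp a
      simp only [size_prod, Polynomial.eval_add, Polynomial.eval_mul, Polynomial.eval_ofNat,
        Polynomial.eval_X, Polynomial.eval_one]
      omega
    · exact hl'.length_le.trans ((length_le_size _).trans (hp a))

@[fun_prop] theorem map {l : α → List β} {g : α → β → γ} (hl : PT l)
    (hg : PT fun q : α × β => g q.1 q.2) : PT fun a => (l a).map (g a) := by
  have := flatMap (g := fun a b => [g a b]) hl (by fun_prop)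
  convert this using 2 with a
  induction l a with
  | nil => rfl
  | cons b l ih => simp [ih]

@[fun_prop] theorem filter {l : α → List β} {g : α → β → Bool} (hl : PT l)
    (hg : PT fun q : α × β => g q.1 q.2) : PT fun a => (l a).filter (g a) := by
  have := flatMap (g := fun a b => bif g a b then [b] else []) hl (by fun_prop)
  convert this using 2 with a
  induction l a with
  | nil => rfl
  | cons b l ih => cases h : g a b <;> simp [ih, h]

@[fun_prop] theorem length {l : α → List β} (hl : PT l) : PT fun a => (l a).length := by
  obtain ⟨p, hp⟩ := hl.bound
  have h : ∀ (l : List β) (s : ℕ), l.foldl (fun s _ => s + 1) s = s + l.length := by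
    intro l
    induction l with
    | nil => simp
    | cons b l ih => intro s; simp [ih]; ring
  have := foldl (s := fun _ => 0) (f := fun _ s _ => s + 1) hl (const _) (by fun_prop) p ?_
  · simpa only [h, zero_add] using this
  · intro a l' hl'
    rw [h, zero_add, size_nat]
    exact hl'.length_le.trans ((length_le_size _).trans (hp a))

@[fun_prop] theorem reverse {l : α → List β} (hl : PT l) : PT fun a => (l a).reverse := by
  obtain ⟨p, hp⟩ := hl.bound
  have h : ∀ (l s : List β), l.foldl (fun s b => b :: s) s = l.reverse ++ s := by
    intro l
    induction l with
    | nil => simp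
    | cons b l ih => intro s; simp [ih]
  have hr : ∀ l : List β, size l.reverse = size l := by
    intro l
    induction l with
    | nil => simp
    | cons b l ih => simp [ih]; omega
  have := foldl (s := fun _ => []) (f := fun _ s b => b :: s) hl (const _) (by fun_prop) p ?_
  · simpa only [h, List.append_nil] using this
  · intro a l' hl'
    rw [h, List.append_nil, hr]
    obtain ⟨l'', h''⟩ := hl'
    have := hp a
    rw [← h'', size_append] at this
    omega

@[fun_prop] theorem range {f : α → ℕ} (hf : PT f) : PT fun a => List.range (f a) := by
  obtain ⟨p, hp⟩ := hf.bound
  have h : ∀ i, (fun q : List ℕ × ℕ => (q.1 ++ [q.2], q.2 + 1))^[i] ([], 0) = (List.range i, i) := by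
    intro i
    induction i with
    | zero => rfl
    | succ i ih => rw [Function.iterate_succ_apply', ih, List.range_succ]
  have := natIterate (s := fun _ => (([], 0) : List ℕ × ℕ))
    (f := fun _ q => (q.1 ++ [q.2], q.2 + 1)) hf (const _) (by fun_prop)
    (2 * (p * (2 * p + 1)) + 1 + p) ?_
  · simpa only [h] using this.fst
  · intro a i hi
    have h1 := hp a
    rw [size_nat] at h1
    have h2 := size_le_of_forall (l := List.range i) (m := f a) (by
      intro j hj; rw [size_nat]; have := List.mem_range.1 hj; omega)
    have h3 : i * (2 * f a + 1) ≤ p.eval (size a) * (2 * p.eval (size a) + 1) :=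
      Nat.mul_le_mul (by omega) (by omega)
    rw [List.length_range] at h2
    simp only [h, size_prod, size_nat, Polynomial.eval_add, Polynomial.eval_mul,
      Polynomial.eval_ofNat, Polynomial.eval_one]
    omega

@[fun_prop] theorem mul {f g : α → ℕ} (hf : PT f) (hg : PT g) : PT fun a => f a * g a := by
  have := length (flatMap (g := fun a (_ : ℕ) => List.range (g a)) (range hf) (by fun_prop))
  convert this using 2 with a
  simp

@[fun_prop] theorem pow {f : α → ℕ} (hf : PT f) (k : ℕ) : PT fun a => f a ^ k := by
  induction k with
  | zero => simpa using const 1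
  | succ k ih => simp only [pow_succ]; fun_prop

@[fun_prop] theorem sub {f g : α → ℕ} (hf : PT f) (hg : PT g) : PT fun a => f a - g a := by
  obtain ⟨p, hp⟩ := hf.bound
  have h : ∀ m i, Nat.pred^[i] m = m - i := by
    intro m i
    induction i with
    | zero => rfl
    | succ i ih => rw [Function.iterate_succ_apply', ih]; rfl
  have := natIterate (f := fun _ n => n.pred) hg hf (by fun_prop) p ?_
  · simpa only [h] using this
  · intro a i _
    have := hp a
    simp only [h, size_nat] at this ⊢
    omega

@[fun_prop] theorem decide_le {f g : α → ℕ} (hf : PT f) (hg : PT g) :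
    PT fun a => decide (f a ≤ g a) := by
  have := optionElim (g := fun _ _ => false) (natOpt' (hf.sub hg)) (const true) (by fun_prop)
  convert this using 2 with a
  rcases h : f a - g a with _ | n
  · simp [natOpt]; omega
  · simp [natOpt]; omega

@[fun_prop] theorem decide_eq {f g : α → ℕ} (hf : PT f) (hg : PT g) :
    PT fun a => decide (f a = g a) := by
  have := and (hf.decide_le hg) (hg.decide_le hf)
  convert this using 2 with a
  rw [← Bool.decide_and, decide_eq_decide]
  exact le_antisymm_iff

/-- The list of the bits of a string. -/
theorem toList {f : α → Str} (hf : PT f) : PT fun a => (f a).bits := by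
  obtain ⟨p, hp⟩ := hf.bound
  let F : Str × List Bool → Str × List Bool := fun q =>
    (strUncons q.1).elim q fun u => (u.2, q.2 ++ [u.1])
  have hit : ∀ i l acc, F^[i] (⟨l⟩, acc) = (⟨l.drop i⟩, acc ++ l.take i) := by
    intro i
    induction i with
    | zero => intro l t; simp
    | succ i ih =>
      intro l t
      rw [Function.iterate_succ_apply]
      cases l with
      | nil => rw [show F (⟨[]⟩, t) = (⟨[]⟩, t) from rfl, ih]; simp
      | cons b l => rw [show F (⟨b :: l⟩, t) = (⟨l⟩, t ++ [b]) from rfl, ih]; simp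
  have := iterate (f := fun _ => F) (s := fun a => (f a, ([] : List Bool))) hf (by fun_prop)
    (by fun_prop) (5 * p + 1) ?_
  · have h2 := this.snd
    convert h2 using 2 with a
    rw [hit]
    simp
  · intro a i _
    rw [hit]
    have h1 := hp a
    have h2 := size_le_of_forall (l := (f a).bits.take i) (m := 1) (by
      intro b _; exact size_bool b)
    simp only [size_str, size_prod, List.length_take, List.length_drop, List.nil_append,
      Polynomial.eval_add, Polynomial.eval_mul, Polynomial.eval_ofNat,
      Polynomial.eval_one] at h1 h2 ⊢
    omega

/-- A list of strings can be concatenated. -/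
theorem strFlatten {l : α → List Str} (hl : PT l) :
    PT fun a => Str.mk ((l a).flatMap Str.bits) := by
  obtain ⟨p, hp⟩ := hl.bound
  have h : ∀ (l : List Str) (s : Str), l.foldl (fun s b => ⟨s.bits ++ b.bits⟩) s =
      ⟨s.bits ++ l.flatMap Str.bits⟩ := by
    intro l
    induction l with
    | nil => simp
    | cons b l ih => intro s; simp [ih]
  have hs : ∀ l : List Str, (l.flatMap Str.bits).length ≤ size l := by
    intro l
    induction l with
    | nil => simp
    | cons b l ih => simp only [List.flatMap_cons, List.length_append, size_cons, size_str]; omega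
  have := foldl (s := fun _ => Str.mk []) (f := fun _ s b => ⟨s.bits ++ b.bits⟩) hl (const _)
    (by fun_prop) p ?_
  · simpa only [h, List.nil_append] using this
  · intro a l' hl'
    simp only [h, size_str, List.nil_append]
    obtain ⟨l'', h''⟩ := hl'
    have h1 := hp a
    have h2 := hs l'
    rw [← h'', size_append] at h1
    omega

end PT

end

/-! ### Locality of computations, and machines for the functions in `PT` -/

section

open Turing (Tape ListBlank Dir)

open Frag Enc

namespace ProbTM

/-- The displacement of the head. -/
def dirInt : Option Dir → ℤ
  | none => 0
  | some Dir.left => -1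
  | some Dir.right => 1

/-- Cells are numbered relative to the head, so a move shifts all numbers, and the cell just written
gets the number `-dirInt a.2`. -/
theorem act_nth (a : Option Bool × Option Dir) (T : Tape (Option Bool)) (i : ℤ) :
    (act a T).nth i = if i + dirInt a.2 = 0 then a.1 else T.nth (i + dirInt a.2) := by
  rcases a with ⟨a, _ | _ | _⟩
  · simp [act, dirInt, Tape.write_nth]
  · by_cases h : i + -1 = 0
    · simp [act, dirInt, Tape.move_left_nth, sub_eq_add_neg, h]; rfl
    · simp [act, dirInt, Tape.write_nth, Tape.move_left_nth, sub_eq_add_neg, h]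
  · by_cases h : i + 1 = 0
    · simp [act, dirInt, Tape.move_right_nth, h]; rfl
    · simp [act, dirInt, Tape.write_nth, Tape.move_right_nth, h]

theorem dirInt_bounds (o : Option Dir) : -1 ≤ dirInt o ∧ dirInt o ≤ 1 := by
  rcases o with _ | _ | _ <;> simp [dirInt]

theorem mk₁_nth_nat (l : List (Option Bool)) (i : ℕ) : (Tape.mk₁ l).nth i = (l[i]?).getD none := by
  simp [Tape.mk₁, Tape.mk₂, Tape.mk'_nth_nat, ListBlank.nth_mk, List.getI_eq_getElem?_getD]
  rfl

theorem mk₁_nth_neg (l : List (Option Bool)) (i : ℤ) (hi : i < 0) : (Tape.mk₁ l).nth i = none := by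
  obtain ⟨n, rfl⟩ := Int.eq_negSucc_of_lt_zero hi
  change (ListBlank.mk ([] : List (Option Bool))).nth n = none
  simp [ListBlank.nth_mk, List.getI_nil]
  rfl

theorem run_append (M : ProbTM) (x r r' : List Bool) :
    M.run x (r ++ r') = r'.foldl M.step (M.run x r) := by
  simp [run]

theorem run_of_halted (M : ProbTM) {x r : List Bool} (h : M.halts (M.run x r).state = true)
    (r' : List Bool) : M.run x (r ++ r') = M.run x r := by
  rw [run_append, foldl_halted M h]

theorem run_take (M : ProbTM) {x r : List Bool} {t : ℕ} (ht : M.HaltsWithin x t)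
    (hr : t ≤ r.length) : M.run x r = M.run x (r.take t) := by
  conv_lhs => rw [← List.take_append_drop t r]
  exact M.run_of_halted (ht _ (by simp [hr])) _

/-- The cells to the right of the input are blank unless the machine has had the time to go
there. -/
theorem run_nth_none (M : ProbTM) (x r : List Bool) (k : M.K) (i : ℤ)
    (hi : (x.length : ℤ) + r.length < i) : ((M.run x r).tape k).nth i = none := by
  induction r using List.reverseRecOn generalizing k i with
  | nil =>
    simp only [List.length_nil, Nat.cast_zero, add_zero] at hi
    lift i to ℕ using (by omega)
    have hi' : x.length ≤ i := by omega
    simp only [run, List.foldl_nil, init]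
    split_ifs
    · rw [mk₁_nth_nat]
      simp [List.getElem?_eq_none hi']
    · rw [mk₁_nth_nat]; rfl
  | append_singleton r b ih =>
    simp only [List.length_append, List.length_singleton, Nat.cast_add, Nat.cast_one] at hi
    rw [run_append, List.foldl_cons, List.foldl_nil, step]
    split_ifs
    · exact ih k i (by omega)
    · have hb := dirInt_bounds ((M.δ b (M.run x r).state fun i => ((M.run x r).tape i).head).2 k).2
      rw [act_nth, if_neg (by omega)]
      exact ih k _ (by omega)

/-- The output contains no blank, whereas all cells far to the right are blank. -/
theorem Outputs.length_le {M : ProbTM} {x r y : List Bool} (h : M.Outputs (M.run x r) y) :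
    y.length ≤ x.length + r.length + 1 := by
  by_contra! hlt
  have h1 := h (x.length + r.length + 1) (by omega)
  rw [M.run_nth_none x r _ _ (by push_cast; omega)] at h1
  rw [List.getElem?_eq_getElem hlt] at h1
  simp at h1

theorem Outputs.unique {M : ProbTM} {c : M.Cfg} {y y' : List Bool} (h : M.Outputs c y)
    (h' : M.Outputs c y') : y = y' := by
  have key : ∀ {y y' : List Bool}, M.Outputs c y → M.Outputs c y' → y.length ≤ y'.length := by
    intro y y' h h'
    by_contra! hlt
    have h1 := h y'.length hlt.le
    rw [h' y'.length le_rfl, List.getElem?_eq_getElem hlt] at h1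
    simp at h1
  refine List.ext_getElem? fun i => ?_
  have hl := le_antisymm (key h h') (key h' h)
  by_cases hi : i ≤ y.length
  · rw [← h i hi, h' i (hl ▸ hi)]
  · rw [List.getElem?_eq_none (by omega), List.getElem?_eq_none (by omega)]

/-- Inputs that agree on the first `m` cells cannot be distinguished within less than `m` steps. -/
theorem run_congr (M : ProbTM) {m : ℕ} {x x' : List Bool} (h : ∀ i < m, x[i]? = x'[i]?)
    (r : List Bool) (hr : r.length < m) :
    (M.run x r).state = (M.run x' r).state ∧ ∀ k, ∀ i : ℤ, i < m - r.length →
      ((M.run x r).tape k).nth i = ((M.run x' r).tape k).nth i := by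
  induction r using List.reverseRecOn with
  | nil =>
    refine ⟨rfl, fun k i hi => ?_⟩
    simp only [List.length_nil, Nat.cast_zero, sub_zero] at hi
    simp only [run, List.foldl_nil, init]
    split_ifs
    · rcases lt_or_ge i 0 with hi0 | hi0
      · rw [mk₁_nth_neg _ _ hi0, mk₁_nth_neg _ _ hi0]
      · lift i to ℕ using hi0
        rw [mk₁_nth_nat, mk₁_nth_nat, List.getElem?_map, List.getElem?_map, h i (by omega)]
    · rfl
  | append_singleton r b ih =>
    simp only [List.length_append, List.length_singleton] at hr
    obtain ⟨h1, h2⟩ := ih (by omega)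
    rw [run_append, run_append]
    simp only [List.foldl_cons, List.foldl_nil, step]
    have hh : (fun i => ((M.run x r).tape i).head) = fun i => ((M.run x' r).tape i).head := by
      funext k
      exact h2 k 0 (by omega)
    rw [h1, hh]
    split_ifs
    · refine ⟨h1, fun k i hi => h2 k i ?_⟩
      simp only [List.length_append, List.length_singleton, Nat.cast_add, Nat.cast_one] at hi
      omega
    · refine ⟨rfl, fun k i hi => ?_⟩
      simp only [List.length_append, List.length_singleton, Nat.cast_add, Nat.cast_one] at hi
      have hb := dirInt_bounds ((M.δ b (M.run x' r).state fun i => ((M.run x' r).tape i).head).2 k).2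
      rw [act_nth, act_nth, h2 k _ (by omega)]

end ProbTM

namespace Frag

variable {K : Type}

/-- The first fragment may leave at a time that depends on the coins, so the second one is required
to work for every remaining sequence of tosses that is long enough. -/
theorem seq_prefix {P R : Frag K} {T T₁ T' : K → Tape (Option Bool)} {m m' : ℕ} {r : List Bool}
    (hr : m + m' ≤ r.length) (h : ∃ s ≤ m, P.Path P.start T (r.take s) T₁)
    (h' : ∀ r' : List Bool, m' ≤ r'.length → ∃ s ≤ m', R.Path R.start T₁ (r'.take s) T') :
    ∃ s ≤ m + m', (seq P R).Path (seq P R).start T (r.take s) T' := by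
  obtain ⟨s, hs, hp⟩ := h
  obtain ⟨s', hs', hp'⟩ := h' (r.drop s) (by simp; omega)
  exact ⟨s + s', by omega, by rw [List.take_add]; exact hp.seq hp'⟩

theorem Run.prefix {F : Frag K} {S S' : K → List Bool} {t m : ℕ} (h : F.Run S S' t) (ht : t ≤ m)
    (r : List Bool) (hr : m ≤ r.length) : ∃ s ≤ m, F.Path F.start (stk S) (r.take s) (stk S') :=
  ⟨t, ht, h _ (by simp; omega)⟩

theorem outputs_stackTape (M : ProbTM) (c : M.Cfg) (y : List Bool)
    (h : c.tape M.out = stackTape y) : M.Outputs c y := by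
  intro i _
  rw [h, stackTape, ProbTM.mk₁_nth_nat]
  by_cases hi : i < y.length <;> simp [hi]

/-- Copy the output of a machine, reversed, to a stack. -/
def copy {K W : Type} [DecidableEq K] (o : K) : Frag (K ⊕ Option (Bool ⊕ W)) :=
  loop (fun h => (h (.inl o)).isSome)
    (seq (act fun h => Sum.elim (fun k => (h (.inl k), none)) fun k =>
        (h (.inr k), (k.elim none (Sum.elim (fun b => if b then some Dir.left else none)
          fun _ => none))))
      (act fun h => Sum.elim (fun k => (h (.inl k), if k = o then some Dir.right else none)) fun k =>
        (k.elim (h (.inr none)) (Sum.elim (fun b => if b then h (.inl o) else h (.inr (some (.inl b))))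
          fun w => h (.inr (some (.inr w)))), none)))

/-- The output tape of an arbitrary machine is not a stack, as there may be symbols to the left of
its head; it is read without being erased. The final tapes `T'` do not depend on the coins. -/
theorem path_copy {K W : Type} [DecidableEq K] (o : K) (y z : List Bool)
    (T : K ⊕ Option (Bool ⊕ W) → Tape (Option Bool))
    (hT : ∀ i : ℕ, i ≤ y.length → (T (.inl o)).nth i = y[i]?) (hz : T ∘ .inr = stk (auxS [] [] z)) :
    ∃ T', T' ∘ .inr = stk (auxS (W := W) [] [] (y.reverse ++ z)) ∧
      ∀ r : List Bool, r.length = 3 * y.length + 1 → (copy o).Path none T r T' := by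
  induction y generalizing z T with
  | nil =>
    refine ⟨T, by simpa using hz, fun r hr => ?_⟩
    obtain ⟨b, rfl⟩ := List.length_eq_one_iff.1 hr
    refine path_loop_exit b ?_
    have := hT 0 le_rfl
    simp only [Nat.cast_zero, Tape.nth_zero] at this
    simp [this]
  | cons b y ih =>
    have h0 : (T (.inl o)).head = some b := by simpa using hT 0 (by simp)
    have hzk : ∀ k, T (.inr k) = stackTape (auxS [] [] z k) := fun k => congrFun hz k
    let T₁ : K ⊕ Option (Bool ⊕ W) → Tape (Option Bool) :=
      Sum.elim (fun k => T (.inl k)) fun k =>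
        k.elim (T (.inr none)) (Sum.elim (fun b => if b then beforeTape z else T (.inr yS))
          fun w => T (.inr (some (.inr w))))
    let T₂ : K ⊕ Option (Bool ⊕ W) → Tape (Option Bool) :=
      Sum.elim (fun k => if k = o then (T (.inl k)).move Dir.right else T (.inl k))
        (stk (auxS [] [] (b :: z)))
    obtain ⟨T', hT', hp⟩ := ih (b :: z) T₂ (by
      intro i hi
      simp only [T₂, Sum.elim_inl, if_true, Tape.move_right_nth]
      simpa using hT (i + 1) (by simp; omega)) rfl
    refine ⟨T', by simpa using hT', fun r hr => ?_⟩
    obtain ⟨b₁, b₂, b₃, r, rfl⟩ : ∃ b₁ b₂ b₃ r', r = b₁ :: b₂ :: b₃ :: r' := by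
      rcases r with _ | ⟨b₁, _ | ⟨b₂, _ | ⟨b₃, r⟩⟩⟩
      · simp at hr
      · simp at hr
      · simp at hr
      · exact ⟨_, _, _, _, rfl⟩
    refine Path.loop b₁ (r := [b₂, b₃]) (by simp [h0]) (Path.seq (r := [b₂]) (T₁ := T₁)
      (.exit rfl ?_) (.exit rfl ?_)) (hp r (by simp at hr; omega))
    · funext k
      rcases k with k | _ | ⟨_ | _⟩ | k
      · exact (Tape.write_self _).symm
      · exact (Tape.write_self _).symm
      · exact (Tape.write_self _).symm
      · simp only [T₁, act, acts, heads, Sum.elim_inr, hzk, auxS, stackTape_head]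
        exact (stackTape_left _).symm
      · exact (Tape.write_self _).symm
    · funext k
      rcases k with k | _ | ⟨_ | _⟩ | k
      · simp only [T₂, T₁, act, acts, heads, Sum.elim_inl, ProbTM.act]
        by_cases hk : k = o
        · simp only [hk, if_true, Tape.write_self]
        · simp only [hk, if_false, Tape.write_self]
      · have := hzk none
        simp only [T₂, T₁, act, acts, heads, Sum.elim_inr]
        simp [ProbTM.act, this, auxS]
        exact (stackTape_idle _).symm
      · have := hzk yS
        simp only [T₂, T₁, act, acts, heads, Sum.elim_inr]
        simp [this, auxS]
        exact (stackTape_idle _).symm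
      · simp only [T₂, T₁, act, acts, heads, Sum.elim_inr]
        simp [h0]
        exact (beforeTape_write _ _).symm
      · have := hzk (some (.inr k))
        simp only [T₂, T₁, act, acts, heads, Sum.elim_inr]
        simp [this, auxS]
        exact (stackTape_idle _).symm

theorem det_copy {K W : Type} [DecidableEq K] (o : K) :
    (copy o : Frag (K ⊕ Option (Bool ⊕ W))).Det := .loop (.seq rfl rfl)

theorem init_toTM [Finite K] [DecidableEq K] (F : Frag K) (inp out : K) (x : List Bool) :
    (toTM F inp out).init x = ⟨some F.start, stk fun k : K => if k = inp then x else []⟩ := by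
  simp only [ProbTM.init, toTM]
  congr 1
  funext k
  by_cases hk : k = inp <;> simp [hk, stackTape]

theorem computesWithin_of_prefix [Finite K] [DecidableEq K] {F : Frag K} {inp out : K}
    {x y : List Bool} {t : ℕ}
    (h : ∀ r : List Bool, r.length = t → ∃ T', T' out = stackTape y ∧ ∃ s ≤ t,
      F.Path F.start (stk fun k : K => if k = inp then x else []) (r.take s) T') :
    (toTM F inp out).ComputesWithin x y t := by
  have key : ∀ r : List Bool, r.length = t → ∃ T', T' out = stackTape y ∧
      (toTM F inp out).run x r = ⟨none, T'⟩ := by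
    intro r hr
    obtain ⟨T', hT, s, hs, hp⟩ := h r hr
    refine ⟨T', hT, ?_⟩
    have := hp.toTM inp out (r.drop s)
    rw [List.take_append_drop] at this
    rw [ProbTM.run, init_toTM]
    exact this
  constructor
  · intro r hr
    obtain ⟨T', -, h⟩ := key r hr
    rw [h]; rfl
  · intro r hr
    obtain ⟨T', hT, h⟩ := key r hr
    rw [h]
    exact outputs_stackTape _ _ _ hT

end Frag

/-- A sampling algorithm is given as an arbitrary machine. To apply a function in `PT` to its
result, the output is copied to a fresh stack, on which the fragment for `G` then works. By
`Outputs.length_le` the output has polynomial length, which keeps the last phase polynomial. -/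
theorem PT.polyTime_comp {f : List Bool → List Bool} (hf : PolyTime f) {G : Str → Str}
    (hG : PT G) : PolyTime fun x => (G ⟨f x⟩).bits := by
  obtain ⟨M, hM, p, h⟩ := hf
  obtain ⟨W, hW, F, hF, q, hq⟩ := hG
  let F' : Frag (M.K ⊕ Option (Bool ⊕ W)) :=
    seq (lift .inl (ofTM M)) (seq (copy M.out)
      (lift .inr (seq (pourTo zS [none]) (lift (Option.map .inr) F))))
  have := Classical.decEq W
  refine ⟨toTM F' (.inl M.inp) (.inr none),
    Det.toTM ((det_ofTM hM).lift.seq (det_copy _ |>.seq (((det_pourTo _ _).seq hF.lift).lift))) _ _,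
    p + 6 * (Polynomial.X + p + 1) + q.comp (Polynomial.X + p + 1) + 3,
    fun x => computesWithin_of_prefix fun r hr => ?_⟩
  obtain ⟨hh, ho⟩ := h x
  set t := p.eval x.length with ht
  simp only [Polynomial.eval_add, Polynomial.eval_mul, Polynomial.eval_ofNat, Polynomial.eval_X,
    Polynomial.eval_comp, Polynomial.eval_one, ← ht] at hr ⊢
  have hrt : (r.take t).length = t := by simp; omega
  have hout := ho _ hrt
  have hlen := hout.length_le
  rw [hrt] at hlen
  obtain ⟨-, t', ht', hrun⟩ := hq ⟨f x⟩
  have hqm := q.eval_mono_nat hlen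
  let T₁ : M.K ⊕ Option (Bool ⊕ W) → Tape (Option Bool) :=
    Sum.elim (M.run x (r.take t)).tape (stk (auxS [] [] []))
  obtain ⟨T₂, hT₂, hc⟩ := path_copy (W := W) M.out (f x) [] T₁ hout rfl
  rw [List.append_nil] at hT₂
  refine ⟨Sum.elim (T₂ ∘ .inl) (stk (mainS (G ⟨f x⟩).bits)), rfl, ?_⟩
  have h1 : ∃ s ≤ t + 1, (lift Sum.inl (ofTM M)).Path (lift Sum.inl (ofTM M)).start
      (stk fun k : M.K ⊕ Option (Bool ⊕ W) => if k = Sum.inl M.inp then x else []) (r.take s) T₁ := by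
    obtain ⟨s, hs, hp⟩ := path_ofTM M t (M.init x) (r.take (t + 1)) (by simp; omega) (by
      rw [List.take_take, min_eq_left (by omega)]
      exact hh _ hrt)
    rw [List.take_take, List.take_take, min_eq_left (by omega), min_eq_left (by omega)] at hp
    refine ⟨s, hs, Path.lift Sum.inl_injective hp (funext fun k => ?_) rfl fun k hk => ?_⟩
    · by_cases hk : k = M.inp <;> simp [ProbTM.init, hk, stackTape]
    · rcases k with k | k
      · exact absurd rfl (hk k)
      · change stackTape (auxS [] [] [] k) = stackTape (if _ then _ else _)
        rw [if_neg Sum.inr_ne_inl]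
        rcases k with _ | ⟨_ | _⟩ | _ <;> rfl
  refine (seq_prefix (m := t + 1) (m' := (3 * (f x).length + 1) + (3 * (f x).length + 1 + t'))
    (by dsimp [enc] at *; omega) h1 fun r' hr' =>
    seq_prefix hr' ⟨3 * (f x).length + 1, le_rfl, hc _ (by simp; omega)⟩ fun r'' hr'' =>
    ⟨3 * (f x).length + 1 + t', le_rfl, ?_⟩).imp fun s hs => ⟨?_, hs.2⟩
  · have h2 := Run.seq (run_pour_zx (W := W) [] [] (f x).reverse) (by
      rw [auxS_nil, List.reverse_reverse, List.append_nil]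
      exact hrun.lift_main (e := (.inr : W → Bool ⊕ W)) Sum.inr_injective)
    refine Path.lift Sum.inr_injective (h2 _ (by simp; omega)) hT₂ rfl fun k hk => ?_
    rcases k with k | k
    · rfl
    · exact absurd rfl (hk k)
  · have := hs.1
    dsimp [enc] at *
    omega

theorem PT.polyTime {G : Str → Str} (hG : PT G) : PolyTime fun x => (G ⟨x⟩).bits := by
  obtain ⟨W, hW, F, hF, q, hq⟩ := hG
  have := Classical.decEq W
  refine ⟨toTM F none none, Det.toTM hF _ _, q, fun x => computesWithin_of_prefix fun r hr => ?_⟩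
  obtain ⟨-, t, ht, h⟩ := hq ⟨x⟩
  refine ⟨stk (mainS (G ⟨x⟩).bits), rfl, ?_⟩
  have h1 : (fun k : Option W => if k = none then x else []) = mainS (enc (Str.mk x)) := by
    funext k
    cases k <;> rfl
  rw [h1]
  exact h.prefix ht r hr.ge

end

section

/-! ### Straight-line programs over a Boolean memory -/

/-- The names of the memory cells. -/
abbrev Addr := ℕ × ℕ × ℕ × ℕ

/-- Operation, target, and operands: `0` reads the next input bit, `1` negates, `2` is the
conjunction, and everything else is the disjunction. -/
abbrev Instr := ℕ × Addr × Addr × Addr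

abbrev Mem := Addr → Bool

namespace Instr

abbrev tgt (I : Instr) : Addr := I.2.1

/-- Execute an instruction; the second component of the state counts the input bits read so far. -/
def exec (y : List Bool) (s : Mem × ℕ) (I : Instr) : Mem × ℕ :=
  match I.1 with
  | 0 => (Function.update s.1 I.tgt (y.getD s.2 false), s.2 + 1)
  | 1 => (Function.update s.1 I.tgt (!s.1 I.2.2.1), s.2)
  | 2 => (Function.update s.1 I.tgt (s.1 I.2.2.1 && s.1 I.2.2.2), s.2)
  | _ => (Function.update s.1 I.tgt (s.1 I.2.2.1 || s.1 I.2.2.2), s.2)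

/-- The number of the last gate that was written to `a` by the program with reversed list of
instructions `q`; if there is none, a number that is too large. -/
def lookup (a : Addr) (q : List Instr) : ℕ :=
  let r := q.dropWhile fun I => !decide (I.tgt = a)
  if r.length = 0 then q.length else r.length - 1

/-- The number of input bits read. -/
def reads (q : List Instr) : ℕ := (q.filter fun I => decide (I.1 = 0)).length

/-- The operation and the references of the gate for the instruction `I` after `q`. -/
def gateCode (I : Instr) (q : List Instr) : ℕ × ℕ × ℕ :=
  if I.1 = 0 then (0, reads q, 0) else (I.1, lookup I.2.2.1 q, lookup I.2.2.2 q)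

/-- The gate with a given code. -/
def toGate (g : ℕ × ℕ × ℕ) : Gate :=
  match g.1 with
  | 0 => .input g.2.1
  | 1 => .not g.2.1
  | 2 => .and g.2.1 g.2.2
  | _ => .or g.2.1 g.2.2

/-- The gates of the program with reversed list of instructions `q`. -/
def codes : List Instr → List (ℕ × ℕ × ℕ)
  | [] => []
  | I :: q => codes q ++ [gateCode I q]

/-- The state after the execution of the program with reversed list of instructions `q`. -/
def final (y : List Bool) (q : List Instr) : Mem × ℕ :=
  q.foldr (fun I s => exec y s I) (fun _ => false, 0)

@[simp] theorem length_codes (q : List Instr) : (codes q).length = q.length := by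
  induction q with
  | nil => rfl
  | cons I q ih => simp [codes, ih]

/-- The values of a list of gates. -/
def values (y : List Bool) (G : List Gate) : List Bool :=
  G.foldl (fun v g => v ++ [g.eval y v]) []

theorem values_append (y : List Bool) (G : List Gate) (g : Gate) :
    values y (G ++ [g]) = values y G ++ [g.eval y (values y G)] := by
  simp [values]

@[simp] theorem length_values (y : List Bool) (G : List Gate) : (values y G).length = G.length := by
  induction G using List.reverseRecOn with
  | nil => rfl
  | append_singleton G g ih => rw [values_append]; simp [ih]

theorem lookup_cons (a : Addr) (I : Instr) (q : List Instr) :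
    lookup a (I :: q) = if I.tgt = a then q.length else
      if lookup a q = q.length then q.length + 1 else lookup a q := by
  have hl : (q.dropWhile fun I => !decide (I.tgt = a)).length ≤ q.length :=
    (List.dropWhile_suffix _).length_le
  by_cases h : I.tgt = a
  · simp [lookup, h]
  · simp only [lookup, List.dropWhile_cons, h, decide_false, Bool.not_false, if_true, if_false,
      List.length_cons]
    split_ifs <;> omega

theorem lookup_le (a : Addr) (q : List Instr) : lookup a q ≤ q.length := by
  have hl : (q.dropWhile fun I => !decide (I.tgt = a)).length ≤ q.length :=
    (List.dropWhile_suffix _).length_le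
  simp only [lookup]
  split_ifs <;> omega

theorem reads_le (q : List Instr) : reads q ≤ q.length := List.length_filter_le _ _

/-- Every instruction becomes one gate, and a cell contains the value of the last gate that was
written to it. For a cell that was never written to, `lookup` is out of range and evaluates to
`false`, in accordance with the initial memory. -/
theorem final_spec (y : List Bool) (q : List Instr) :
    (∀ a, (final y q).1 a = (values y ((codes q).map toGate)).getD (lookup a q) false) ∧
      (final y q).2 = reads q := by
  induction q with
  | nil => simp [final, codes, values, reads]
  | cons I q ih =>
    obtain ⟨ih1, ih2⟩ := ih
    have hv : (final y (I :: q)).1 = Function.update (final y q).1 I.tgt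
        ((toGate (gateCode I q)).eval y (values y ((codes q).map toGate))) := by
      change (exec y (final y q) I).1 = _
      obtain ⟨op, t, a, b⟩ := I
      rcases op with _ | _ | _ | op <;>
        simp only [exec, gateCode, toGate, Gate.eval, ← ih1, ih2, if_true, if_false, Nat.add_eq_zero_iff,
          one_ne_zero, and_false, zero_add]
    constructor
    · intro a
      rw [hv, codes, List.map_append, List.map_singleton, values_append, lookup_cons]
      by_cases h : I.tgt = a
      · subst h
        rw [if_pos rfl, Function.update_self]
        rw [List.getD_append_right _ _ _ _ (by simp)]
        simp
      · rw [if_neg h, Function.update_of_ne (fun h' => h h'.symm), ih1]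
        have := lookup_le a q
        split_ifs with h'
        · rw [h', List.getD_eq_default _ _ (by simp), List.getD_eq_default _ _ (by simp)]
        · rw [List.getD_append _ _ _ _ (by simp; omega)]
    · change (exec y (final y q) I).2 = _
      obtain ⟨op, t, a, b⟩ := I
      rcases op with _ | _ | _ | op <;> simp [exec, reads, ih2]

theorem evalCircuit_codes (y : List Bool) (I : Instr) (q : List Instr) :
    evalCircuit ((codes (I :: q)).map toGate) y = (final y (I :: q)).1 I.tgt := by
  rw [(final_spec y (I :: q)).1, lookup_cons, if_pos rfl, codes, List.map_append, List.map_singleton,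
    values_append, List.getD_append_right _ _ _ _ (by simp)]
  change (values y _).getLastD false = _
  rw [values_append]
  simp

end Instr

/-! ### Boolean expressions -/

/-- Boolean expressions whose variables are memory cells. -/
inductive BExpr
  | var (a : Addr)
  | not (e : BExpr)
  | and (e f : BExpr)
  | or (e f : BExpr)

/-- An auxiliary cell. -/
abbrev tmpAddr (k : ℕ) : Addr := (6, k, 0, 0)

/-- A cell that always contains `0`. -/
abbrev zeroAddr : Addr := (7, 0, 0, 0)

namespace BExpr

def eval (m : Mem) : BExpr → Bool
  | var a => m a
  | not e => !e.eval m
  | and e f => e.eval m && f.eval m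
  | or e f => e.eval m || f.eval m

/-- Every variable satisfies `P`. -/
def All (P : Addr → Prop) : BExpr → Prop
  | var a => P a
  | not e => e.All P
  | and e f => e.All P ∧ f.All P
  | or e f => e.All P ∧ f.All P

abbrev false' : BExpr := var zeroAddr

abbrev true' : BExpr := not false'

/-- Instructions that compute the value of an expression in the auxiliary cell `k`, where only the
auxiliary cells from `k` on are used. -/
def compile : BExpr → ℕ → List Instr
  | var a, k => [(3, tmpAddr k, a, a)]
  | not e, k => e.compile k ++ [(1, tmpAddr k, tmpAddr k, tmpAddr k)]
  | and e f, k => e.compile k ++ (f.compile (k + 1) ++ [(2, tmpAddr k, tmpAddr k, tmpAddr (k + 1))])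
  | or e f, k => e.compile k ++ (f.compile (k + 1) ++ [(3, tmpAddr k, tmpAddr k, tmpAddr (k + 1))])

theorem eval_congr {P : Addr → Prop} {m m' : Mem} (e : BExpr) (he : e.All P)
    (h : ∀ a, P a → m a = m' a) : e.eval m = e.eval m' := by
  induction e with
  | var a => exact h a he
  | not e ih => simp [eval, ih he]
  | and e f ih ih' => simp [eval, ih he.1, ih' he.2]
  | or e f ih ih' => simp [eval, ih he.1, ih' he.2]

theorem All.mono {P P' : Addr → Prop} {e : BExpr} (he : e.All P) (h : ∀ a, P a → P' a) :
    e.All P' := by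
  induction e with
  | var a => exact h a he
  | not e ih => exact ih he
  | and e f ih ih' => exact ⟨ih he.1, ih' he.2⟩
  | or e f ih ih' => exact ⟨ih he.1, ih' he.2⟩

/-- The auxiliary cells form a stack: while the second operand is computed from cell `k + 1` on, the
value of the first one waits in cell `k`. Variables must not be auxiliary cells, because the
evaluation of the first operand could change them. -/
theorem compile_spec (y : List Bool) (e : BExpr) (he : e.All fun a => a.1 ≠ 6) (k : ℕ)
    (s : Mem × ℕ) :
    let s' := (e.compile k).foldl (Instr.exec y) s
    s'.2 = s.2 ∧ s'.1 (tmpAddr k) = e.eval s.1 ∧ (∀ i < k, s'.1 (tmpAddr i) = s.1 (tmpAddr i)) ∧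
      ∀ a : Addr, a.1 ≠ 6 → s'.1 a = s.1 a := by
  induction e generalizing k s with
  | var a =>
    refine ⟨rfl, ?_, ?_, ?_⟩
    · simp [compile, Instr.exec, eval]
    · intro i hi
      have : tmpAddr i ≠ tmpAddr k := by simp; omega
      simp [compile, Instr.exec, Function.update_of_ne this]
    · intro b hb
      have : b ≠ tmpAddr k := fun h => hb (by rw [h])
      simp [compile, Instr.exec, Function.update_of_ne this]
  | not e ih =>
    obtain ⟨h1, h2, h3, h4⟩ := ih he k s
    simp only [compile, List.foldl_append, List.foldl_cons, List.foldl_nil]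
    refine ⟨h1, ?_, ?_, ?_⟩
    · simp [Instr.exec, eval, h2]
    · intro i hi
      have : tmpAddr i ≠ tmpAddr k := by simp; omega
      simp only [Instr.exec, Function.update_of_ne this]
      exact h3 i hi
    · intro b hb
      have : b ≠ tmpAddr k := fun h => hb (by rw [h])
      simp only [Instr.exec, Function.update_of_ne this]
      exact h4 b hb
  | and e f ih ih' =>
    obtain ⟨h1, h2, h3, h4⟩ := ih he.1 k s
    obtain ⟨h1', h2', h3', h4'⟩ := ih' he.2 (k + 1) ((e.compile k).foldl (Instr.exec y) s)
    simp only [compile, List.foldl_append, List.foldl_cons, List.foldl_nil]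
    refine ⟨h1'.trans h1, ?_, ?_, ?_⟩
    · simp only [Instr.exec, eval, Function.update_self, h2', h3' k (by omega), h2]
      rw [eval_congr f he.2 h4]
    · intro i hi
      have : tmpAddr i ≠ tmpAddr k := by simp; omega
      simp only [Instr.exec, Function.update_of_ne this]
      exact (h3' i (by omega)).trans (h3 i hi)
    · intro b hb
      have : b ≠ tmpAddr k := fun h => hb (by rw [h])
      simp only [Instr.exec, Function.update_of_ne this]
      exact (h4' b hb).trans (h4 b hb)
  | or e f ih ih' =>
    obtain ⟨h1, h2, h3, h4⟩ := ih he.1 k s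
    obtain ⟨h1', h2', h3', h4'⟩ := ih' he.2 (k + 1) ((e.compile k).foldl (Instr.exec y) s)
    simp only [compile, List.foldl_append, List.foldl_cons, List.foldl_nil]
    refine ⟨h1'.trans h1, ?_, ?_, ?_⟩
    · simp only [Instr.exec, eval, Function.update_self, h2', h3' k (by omega), h2]
      rw [eval_congr f he.2 h4]
    · intro i hi
      have : tmpAddr i ≠ tmpAddr k := by simp; omega
      simp only [Instr.exec, Function.update_of_ne this]
      exact (h3' i (by omega)).trans (h3 i hi)
    · intro b hb
      have : b ≠ tmpAddr k := fun h => hb (by rw [h])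
      simp only [Instr.exec, Function.update_of_ne this]
      exact (h4' b hb).trans (h4 b hb)

/-- Every Boolean function of finitely many memory cells is given by an expression. -/
theorem exists_eval_eq (l : List Addr) (f : Mem → Bool)
    (hf : ∀ m m' : Mem, (∀ a ∈ l, m a = m' a) → f m = f m') :
    ∃ e : BExpr, e.All (fun a => a ∈ l ∨ a = zeroAddr) ∧
      ∀ m : Mem, m zeroAddr = false → e.eval m = f m := by
  induction l generalizing f with
  | nil =>
    cases h : f fun _ => false
    · exact ⟨false', Or.inr rfl, fun m hm => by
        rw [hf m (fun _ => false) (by simp), h]; exact hm⟩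
    · exact ⟨true', Or.inr rfl, fun m hm => by
        rw [hf m (fun _ => false) (by simp), h]; simp [eval, hm]⟩
  | cons a l ih =>
    have key : ∀ b : Bool, ∀ m m' : Mem, (∀ a ∈ l, m a = m' a) →
        f (Function.update m a b) = f (Function.update m' a b) := by
      intro b m m' h
      refine hf _ _ fun a' ha' => ?_
      by_cases haa : a' = a
      · subst haa; simp
      · rw [Function.update_of_ne haa, Function.update_of_ne haa]
        exact h _ ((List.mem_cons.1 ha').resolve_left haa)
    obtain ⟨e, he, he'⟩ := ih _ (key true)
    obtain ⟨e₀, he₀, he₀'⟩ := ih _ (key false)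
    have hP : ∀ a', (a' ∈ l ∨ a' = zeroAddr) → (a' ∈ a :: l ∨ a' = zeroAddr) := by
      rintro a' (h | h)
      · exact Or.inl (List.mem_cons_of_mem _ h)
      · exact Or.inr h
    -- Shannon expansion with respect to the variable `a`.
    refine ⟨or (and (var a) e) (and (not (var a)) e₀),
      ⟨⟨Or.inl (by simp), he.mono hP⟩, ⟨Or.inl (by simp), he₀.mono hP⟩⟩, fun m hm => ?_⟩
    simp only [eval, he' m hm, he₀' m hm]
    cases h : m a
    · rw [show Function.update m a false = m from Function.update_eq_self_iff.2 h.symm]; simp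
    · rw [show Function.update m a true = m from Function.update_eq_self_iff.2 h.symm]; simp

end BExpr

/-! ### Assignments of expressions to memory cells -/

/-- An assignment of the value of an expression, or of the next input bit, to a memory cell. -/
abbrev Item := Addr × Option BExpr

namespace Item

def exec (y : List Bool) (s : Mem × ℕ) (x : Item) : Mem × ℕ :=
  match x.2 with
  | none => (Function.update s.1 x.1 (y.getD s.2 false), s.2 + 1)
  | some e => (Function.update s.1 x.1 (e.eval s.1), s.2)

def compile (x : Item) : List Instr :=
  match x.2 with
  | none => [(0, x.1, x.1, x.1)]
  | some e => e.compile 0 ++ [(3, x.1, tmpAddr 0, tmpAddr 0)]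

/-- The item does not use the auxiliary cells, and it does not write to the cell that must
contain `0`. -/
def Good (x : Item) : Prop :=
  x.1.1 ≠ 6 ∧ x.1 ≠ zeroAddr ∧ ∀ e, x.2 = some e → e.All fun a => a.1 ≠ 6

/-- Compiled items leave garbage in the auxiliary cells. The two executions are therefore compared
outside of these, starting from states that may already differ there. -/
theorem compile_spec (y : List Bool) (l : List Item) (hl : ∀ x ∈ l, x.Good) (s s' : Mem × ℕ)
    (h : s.2 = s'.2) (h' : ∀ a : Addr, a.1 ≠ 6 → s.1 a = s'.1 a) :
    ((l.flatMap compile).foldl (Instr.exec y) s).2 = (l.foldl (exec y) s').2 ∧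
      ∀ a : Addr, a.1 ≠ 6 →
        ((l.flatMap compile).foldl (Instr.exec y) s).1 a = (l.foldl (exec y) s').1 a := by
  induction l generalizing s s' with
  | nil => exact ⟨h, h'⟩
  | cons x l ih =>
    rw [List.flatMap_cons, List.foldl_append, List.foldl_cons]
    obtain ⟨hx1, -, hx2⟩ := hl x (by simp)
    refine ih (fun z hz => hl z (by simp [hz])) _ _ ?_ ?_
    · obtain ⟨t, _ | e⟩ := x
      · simp [compile, Instr.exec, exec, h]
      · simp only [compile, List.foldl_append, List.foldl_cons, List.foldl_nil, Instr.exec, exec]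
        rw [(BExpr.compile_spec y e (hx2 e rfl) 0 s).1, h]
    · intro a ha
      obtain ⟨t, _ | e⟩ := x
      · simp only [compile, List.foldl_cons, List.foldl_nil, Instr.exec, exec, h, Instr.tgt]
        by_cases hat : a = t
        · subst hat; simp
        · rw [Function.update_of_ne hat, Function.update_of_ne hat, h' a ha]
      · have hs := BExpr.compile_spec y e (hx2 e rfl) 0 s
        simp only [compile, List.foldl_append, List.foldl_cons, List.foldl_nil, Instr.exec, exec]
        by_cases hat : a = t
        · subst hat
          simp only [Instr.tgt, Function.update_self, Bool.or_self]
          rw [hs.2.1]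
          exact BExpr.eval_congr e (hx2 e rfl) h'
        · rw [Function.update_of_ne hat, Function.update_of_ne hat, hs.2.2.2 a ha, h' a ha]

/-- Assignments to different cells, of which none reads a cell that has been written to before. -/
theorem foldl_map {ι : Type} (y : List Bool) (X : List ι) (hX : X.Nodup) (t : ι → Addr)
    (e : ι → BExpr) (ht : ∀ x ∈ X, ∀ x' ∈ X, t x = t x' → x = x') (s : Mem × ℕ)
    (he : ∀ x ∈ X, ∀ m : Mem, (∀ a, (∀ x' ∈ X, x' ≠ x → a ≠ t x') → m a = s.1 a) →
      (e x).eval m = (e x).eval s.1) :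
    let s' := (X.map fun x => ((t x, some (e x)) : Item)).foldl (exec y) s
    s'.2 = s.2 ∧ (∀ x ∈ X, s'.1 (t x) = (e x).eval s.1) ∧
      ∀ a, (∀ x ∈ X, a ≠ t x) → s'.1 a = s.1 a := by
  induction X generalizing s with
  | nil => simp
  | cons x X ih =>
    obtain ⟨hx, hX⟩ := List.nodup_cons.1 hX
    have htx : ∀ x' ∈ X, t x' ≠ t x := fun x' hx' h =>
      hx (ht x' (by simp [hx']) x (by simp) h ▸ hx')
    simp only [List.map_cons, List.foldl_cons]
    set s₁ : Mem × ℕ := exec y s (t x, some (e x)) with hs₁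
    have h1 : s₁.1 = Function.update s.1 (t x) ((e x).eval s.1) := rfl
    have hev : ∀ x' ∈ X, (e x').eval s₁.1 = (e x').eval s.1 := by
      intro x' hx'
      refine he x' (by simp [hx']) _ fun a ha => ?_
      rw [h1, Function.update_of_ne]
      exact ha x (by simp) fun h => hx (h ▸ hx')
    obtain ⟨k1, k2, k3⟩ := ih hX (fun a ha b hb => ht a (by simp [ha]) b (by simp [hb])) s₁ (by
      intro x' hx' m hm
      rw [hev x' hx']
      refine he x' (by simp [hx']) m fun a ha => ?_
      rw [hm a fun z hz hzx => ha z (by simp [hz]) hzx, h1, Function.update_of_ne]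
      exact ha x (by simp) fun h => hx (h ▸ hx'))
    refine ⟨k1, ?_, ?_⟩
    · intro x' hx'
      rcases List.mem_cons.1 hx' with rfl | hx'
      · rw [k3 _ fun z hz h => htx z hz h.symm, h1, Function.update_self]
      · rw [k2 x' hx', hev x' hx']
    · intro a ha
      rw [k3 a fun z hz => ha z (by simp [hz]), h1, Function.update_of_ne (ha x (by simp))]

/-- Compute a disjunction in the cell `t`. -/
theorem foldl_or {ι : Type} (y : List Bool) (X : List ι) (t : Addr) (e : ι → BExpr)
    (he : ∀ x ∈ X, (e x).All fun a => a ≠ t) (s : Mem × ℕ) :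
    let s' := (X.map fun x => ((t, some (.or (.var t) (e x))) : Item)).foldl (exec y) s
    s'.2 = s.2 ∧ s'.1 t = (s.1 t || X.any fun x => (e x).eval s.1) ∧
      ∀ a, a ≠ t → s'.1 a = s.1 a := by
  induction X generalizing s with
  | nil => simp
  | cons x X ih =>
    simp only [List.map_cons, List.foldl_cons]
    set s₁ : Mem × ℕ := exec y s (t, some (.or (.var t) (e x))) with hs₁
    have h1 : s₁.1 = Function.update s.1 t (s.1 t || (e x).eval s.1) := rfl
    obtain ⟨k1, k2, k3⟩ := ih (fun x hx => he x (by simp [hx])) s₁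
    refine ⟨k1, ?_, ?_⟩
    · have : (X.any fun x => (e x).eval s₁.1) = X.any fun x => (e x).eval s.1 := by
        rw [Bool.eq_iff_iff, List.any_eq_true, List.any_eq_true]
        refine exists_congr fun z => and_congr_right fun hz => ?_
        rw [BExpr.eval_congr _ (he z (by simp [hz])) fun a ha => by
          rw [h1, Function.update_of_ne ha]]
      rw [k2, this, h1, Function.update_self, List.any_cons, Bool.or_assoc]
    · intro a ha
      rw [k3 a ha, h1, Function.update_of_ne ha]

end Item

end

section

open Turing (Tape Dir)

open ProbTM

/-! ### Configurations with absolute positions -/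

/-- A configuration whose tapes are indexed by absolute positions. -/
structure AbsCfg (M : ProbTM) where
  state : M.Q
  pos : M.K → ℤ
  cont : M.K → ℤ → Option Bool

namespace AbsCfg

variable {M : ProbTM}

def step (c : AbsCfg M) (b : Bool) : AbsCfg M :=
  if M.halts c.state then c
  else
    let a := M.δ b c.state fun k => c.cont k (c.pos k)
    ⟨a.1, fun k => c.pos k + dirInt (a.2 k).2,
      fun k => Function.update (c.cont k) (c.pos k) (a.2 k).1⟩

/-- Cells of a `Tape` are numbered from the head, absolute cells from a fixed origin; the position
of the head converts one into the other. -/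
def Matches (C : M.Cfg) (c : AbsCfg M) : Prop :=
  C.state = c.state ∧ ∀ k i, (C.tape k).nth i = c.cont k (c.pos k + i)

theorem Matches.step {C : M.Cfg} {c : AbsCfg M} (h : Matches C c) (b : Bool) :
    Matches (M.step C b) (c.step b) := by
  obtain ⟨h1, h2⟩ := h
  rw [ProbTM.step, AbsCfg.step, h1]
  split_ifs with hh
  · exact ⟨h1, h2⟩
  · have hd : (fun i => (C.tape i).head) = fun k => c.cont k (c.pos k) := by
      funext k
      have := h2 k 0
      rwa [add_zero] at this
    rw [hd]
    refine ⟨rfl, fun k i => ?_⟩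
    rw [act_nth]
    set a := M.δ b c.state fun k => c.cont k (c.pos k)
    change _ = Function.update (c.cont k) (c.pos k) (a.2 k).1 (c.pos k + dirInt (a.2 k).2 + i)
    split_ifs with hi
    · rw [show c.pos k + dirInt (a.2 k).2 + i = c.pos k by omega, Function.update_self]
    · rw [Function.update_of_ne (by omega), h2]
      congr 1
      ring

theorem Matches.foldl {C : M.Cfg} {c : AbsCfg M} (h : Matches C c) (r : List Bool) :
    Matches (r.foldl M.step C) (r.foldl AbsCfg.step c) := by
  induction r generalizing C c with
  | nil => exact h
  | cons b r ih => exact ih (h.step b)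

/-- A head moves by at most one cell per step. Since a step writes before it moves, even a cell at
distance exactly `r.length` is unchanged. -/
theorem foldl_near (c : AbsCfg M) (r : List Bool) (k : M.K) :
    c.pos k - r.length ≤ (r.foldl step c).pos k ∧ (r.foldl step c).pos k ≤ c.pos k + r.length ∧
      ∀ p : ℤ, (p ≤ c.pos k - r.length ∨ c.pos k + r.length ≤ p) →
        (r.foldl step c).cont k p = c.cont k p := by
  induction r using List.reverseRecOn with
  | nil => simp
  | append_singleton r b ih =>
    obtain ⟨h1, h2, h3⟩ := ih
    simp only [List.foldl_append, List.foldl_cons, List.foldl_nil, List.length_append,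
      List.length_singleton, Nat.cast_add, Nat.cast_one]
    set c' := r.foldl step c
    rw [step]
    split_ifs
    · exact ⟨by omega, by omega, fun p hp => h3 p (by omega)⟩
    · set a := M.δ b c'.state fun k => c'.cont k (c'.pos k)
      have hb := dirInt_bounds (a.2 k).2
      refine ⟨?_, ?_, fun p hp => ?_⟩
      · change _ ≤ c'.pos k + dirInt (a.2 k).2
        omega
      · change c'.pos k + dirInt (a.2 k).2 ≤ _
        omega
      · change Function.update (c'.cont k) (c'.pos k) (a.2 k).1 p = _
        rw [Function.update_of_ne (by omega), h3 p (by omega)]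

/-- A bit of the description of a cell: whether it is not blank, whether it contains `1`, whether the
head is there. -/
def bit (c : AbsCfg M) (f : ℕ) (k : M.K) (p : ℤ) : Bool :=
  match f with
  | 0 => (c.cont k p).isSome
  | 1 => c.cont k p == some true
  | _ => decide (c.pos k = p)

end AbsCfg

/-! ### The memory layout and the simulation program -/

section Simulation

variable (M : ProbTM)

noncomputable instance : Fintype M.K := Fintype.ofFinite _

noncomputable instance : Fintype M.Q := Fintype.ofFinite _

noncomputable instance : DecidableEq M.Q := Classical.decEq _

/-- The number of a tape. -/
noncomputable def tapeIx (k : M.K) : ℕ := (Finite.equivFin M.K k).val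

/-- The number of a state. -/
noncomputable def stateIx (q : M.Q) : ℕ := (Finite.equivFin M.Q q).val

theorem tapeIx_inj {k k' : M.K} : tapeIx M k = tapeIx M k' ↔ k = k' :=
  ⟨fun h => (Finite.equivFin M.K).injective (Fin.ext h), fun h => h ▸ rfl⟩

theorem stateIx_inj {q q' : M.Q} : stateIx M q = stateIx M q' ↔ q = q' :=
  ⟨fun h => (Finite.equivFin M.Q).injective (Fin.ext h), fun h => h ▸ rfl⟩

/-- The tapes. -/
noncomputable def tapes : List M.K := Finset.univ.toList

@[simp] theorem mem_tapes (k : M.K) : k ∈ tapes M := by simp [tapes]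

theorem nodup_tapes : (tapes M).Nodup := Finset.nodup_toList _

variable {M}

/-- The first component of an address gives the kind of the cell: `0`, `1`, `2` for the three bits
of a tape cell as in `AbsCfg.bit`, `3` for block selectors, `4` for the state (one cell per state),
`5` for the coin, `6` for auxiliary cells, `7` for the constant `0` and the result, and from `8` on
for temporary copies. For the kinds `0` to `3` the second component is the level. -/
noncomputable abbrev cellA (f j i : ℕ) (k : M.K) : Addr := (f, j, i, tapeIx M k)

noncomputable abbrev selA (j b : ℕ) (k : M.K) : Addr := (3, j, b, tapeIx M k)

noncomputable abbrev stA (q : M.Q) : Addr := (4, stateIx M q, 0, 0)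

abbrev coinA : Addr := (5, 0, 0, 0)

/-- Decide in which block of length `w` of the window at level `j` the head is. -/
noncomputable def selItem (j w : ℕ) (k : M.K) (b : ℕ) : List Item :=
  (selA j b k, some .false') :: (List.range w).map fun i =>
    (selA j b k, some (.or (.var (selA j b k)) (.var (cellA 2 j (b * w + i) k))))

variable (M) in
noncomputable def selItems (j w : ℕ) : List Item :=
  ((tapes M).product [1, 2, 3, 4]).flatMap fun x => selItem j w x.1 x.2

/-- The three blocks around block `b` begin with block `b - 1`. -/
noncomputable def loadTerm (j w f i : ℕ) (k : M.K) (b : ℕ) : BExpr :=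
  .and (.var (selA (j + 1) b k)) (.var (cellA f (j + 1) ((b - 1) * w + i) k))

noncomputable def loadItem (j w : ℕ) (x : M.K × ℕ × ℕ) : Item :=
  (cellA x.2.1 j x.2.2 x.1,
    some (.or (.or (loadTerm j w x.2.1 x.2.2 x.1 1) (loadTerm j w x.2.1 x.2.2 x.1 2))
      (.or (loadTerm j w x.2.1 x.2.2 x.1 3) (loadTerm j w x.2.1 x.2.2 x.1 4))))

variable (M) in
/-- The cells of the window at level `j`, where `w = 2 ^ j`. -/
noncomputable def cells (w : ℕ) : List (M.K × ℕ × ℕ) :=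
  (tapes M).product ([0, 1, 2].product (List.range (3 * w)))

/-- If `b` is not the selected block, the cell receives its old value. The sequence of instructions
is thus the same for all positions of the heads, as it must be in a circuit. -/
noncomputable def storeItem (j w b : ℕ) (x : M.K × ℕ × ℕ) : Item :=
  (cellA x.2.1 (j + 1) ((b - 1) * w + x.2.2) x.1,
    some (.or (.and (.var (selA (j + 1) b x.1)) (.var (cellA x.2.1 j x.2.2 x.1)))
      (.and (.not (.var (selA (j + 1) b x.1)))
        (.var (cellA x.2.1 (j + 1) ((b - 1) * w + x.2.2) x.1)))))

variable (M) in
noncomputable def loadItems (j w : ℕ) : List Item := (cells M w).map (loadItem j w)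

variable (M) in
noncomputable def storeItems (j w : ℕ) (B : List ℕ) : List Item :=
  B.flatMap fun b => (cells M w).map (storeItem j w b)

variable (M) in
/-- The program that simulates `2 ^ j` steps, given a program that simulates one step. -/
noncomputable def simItems (base : List Item) : ℕ → List Item
  | 0 => base
  | j + 1 =>
    -- The same code serves for both halves. A head that starts in one of the two middle blocks out
    -- of six is in one of the blocks `1` to `4` when `W` begins for the second time.
    let W := selItems M (j + 1) (2 ^ j) ++ loadItems M j (2 ^ j) ++ simItems base j ++
      storeItems M j (2 ^ j) [1, 2, 3, 4]
    W ++ W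

/-- The window at level `j` with offset `o` contains the configuration `c`. -/
def MemRep (j : ℕ) (m : Mem) (c : AbsCfg M) (o : M.K → ℤ) : Prop :=
  (∀ k, ∀ f < 3, ∀ i < 3 * 2 ^ j, m (cellA f j i k) = c.bit f k (o k + i)) ∧
    ∀ q, m (stA q) = decide (c.state = q)

variable (M) in
/-- Nothing belonging to a higher level has changed. -/
def Frame (j : ℕ) (m m' : Mem) : Prop :=
  m' zeroAddr = m zeroAddr ∧
    ∀ j' > j, ∀ k : M.K, (∀ f < 3, ∀ i, m' (cellA f j' i k) = m (cellA f j' i k)) ∧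
      ∀ b, m' (selA j' b k) = m (selA j' b k)

/-- The coin tosses number `a`, …, `a + n - 1`. -/
def coins (y : List Bool) (a n : ℕ) : List Bool := (List.range n).map fun i => y.getD (a + i) false

@[simp] theorem length_coins (y : List Bool) (a n : ℕ) : (coins y a n).length = n := by simp [coins]

theorem coins_add (y : List Bool) (a n m : ℕ) :
    coins y a (n + m) = coins y a n ++ coins y (a + n) m := by
  simp [coins, List.range_add, Function.comp_def, Nat.add_assoc]

variable (M) in
/-- The program simulates `n` steps from configurations with the heads in the blocks of length `w`
with numbers from `lo` to `hi - 1` of the window at level `j`. -/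
def Simulates (y : List Bool) (P : List Item) (j w lo hi n : ℕ) : Prop :=
  ∀ (s : Mem × ℕ) (c : AbsCfg M) (o : M.K → ℤ), MemRep j s.1 c o → s.1 zeroAddr = false →
    (∀ k, o k + lo * w ≤ c.pos k ∧ c.pos k < o k + hi * w) →
    (P.foldl (Item.exec y) s).2 = s.2 + n ∧
    MemRep j (P.foldl (Item.exec y) s).1 ((coins y s.2 n).foldl AbsCfg.step c) o ∧
    Frame M j s.1 (P.foldl (Item.exec y) s).1

theorem selItem_spec (y : List Bool) (j w : ℕ) (k : M.K) (b : ℕ) (s : Mem × ℕ)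
    (h0 : s.1 zeroAddr = false) :
    let s' := (selItem j w k b).foldl (Item.exec y) s
    s'.2 = s.2 ∧ s'.1 (selA j b k) = ((List.range w).any fun i => s.1 (cellA 2 j (b * w + i) k)) ∧
      ∀ a, a ≠ selA j b k → s'.1 a = s.1 a := by
  rw [selItem, List.foldl_cons]
  set s₁ : Mem × ℕ := Item.exec y s (selA j b k, some .false') with hs₁
  have h1 : s₁.1 = Function.update s.1 (selA j b k) (s.1 zeroAddr) := rfl
  obtain ⟨k1, k2, k3⟩ := Item.foldl_or y (List.range w) (selA j b k)
    (fun i => .var (cellA 2 j (b * w + i) k)) (by intro i _ h; simp at h) s₁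
  refine ⟨k1, ?_, ?_⟩
  · refine k2.trans ?_
    have h2 : s₁.1 (selA j b k) = false := by rw [h1, Function.update_self, h0]
    rw [h2, Bool.false_or]
    congr 1
  · intro a ha
    rw [k3 a ha, h1, Function.update_of_ne ha]

theorem selItems_spec (y : List Bool) (j w : ℕ) (Y : List (M.K × ℕ)) (hY : Y.Nodup) (s : Mem × ℕ)
    (h0 : s.1 zeroAddr = false) :
    let s' := (Y.flatMap fun x => selItem j w x.1 x.2).foldl (Item.exec y) s
    s'.2 = s.2 ∧ (∀ x ∈ Y, s'.1 (selA j x.2 x.1) =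
        ((List.range w).any fun i => s.1 (cellA 2 j (x.2 * w + i) x.1))) ∧
      ∀ a, (∀ x ∈ Y, a ≠ selA j x.2 x.1) → s'.1 a = s.1 a := by
  induction Y generalizing s with
  | nil => simp
  | cons x Y ih =>
    obtain ⟨hx, hY⟩ := List.nodup_cons.1 hY
    simp only [List.flatMap_cons, List.foldl_append]
    obtain ⟨h1, h2, h3⟩ := selItem_spec y j w x.1 x.2 s h0
    set s₁ := (selItem j w x.1 x.2).foldl (Item.exec y) s
    obtain ⟨k1, k2, k3⟩ := ih hY s₁ (by rw [h3 _ (by simp), h0])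
    refine ⟨k1.trans h1, ?_, ?_⟩
    · intro z hz
      rcases List.mem_cons.1 hz with rfl | hz
      · rw [k3, h2]
        intro z' hz' h
        simp only [Prod.mk.injEq, true_and, tapeIx_inj] at h
        exact hx (by rwa [show z = z' from Prod.ext h.2 h.1])
      · rw [k2 z hz]
        congr 1
        funext i
        rw [h3 _ (by simp)]
    · intro a ha
      rw [k3 a fun z hz => ha z (by simp [hz]), h3 a (ha x (by simp))]

theorem mem_cells {w : ℕ} {x : M.K × ℕ × ℕ} : x ∈ cells M w ↔ x.2.1 < 3 ∧ x.2.2 < 3 * w := by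
  obtain ⟨k, f, i⟩ := x
  simp only [cells, List.pair_mem_product, mem_tapes, true_and, List.mem_range, List.mem_cons,
    List.not_mem_nil, or_false]
  omega

theorem nodup_cells (w : ℕ) : (cells M w).Nodup :=
  (nodup_tapes M).product ((by simp : [0, 1, 2].Nodup).product List.nodup_range)

/-- The assignments do not interfere: all targets are at level `j`, and everything that is read
belongs to level `j + 1`. -/
theorem loadItems_spec (y : List Bool) (j w : ℕ) (s : Mem × ℕ) :
    let s' := (loadItems M j w).foldl (Item.exec y) s
    s'.2 = s.2 ∧ (∀ k : M.K, ∀ f < 3, ∀ i < 3 * w, s'.1 (cellA f j i k) =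
        ((s.1 (selA (j + 1) 1 k) && s.1 (cellA f (j + 1) (0 * w + i) k) ||
          s.1 (selA (j + 1) 2 k) && s.1 (cellA f (j + 1) (1 * w + i) k)) ||
        (s.1 (selA (j + 1) 3 k) && s.1 (cellA f (j + 1) (2 * w + i) k) ||
          s.1 (selA (j + 1) 4 k) && s.1 (cellA f (j + 1) (3 * w + i) k)))) ∧
      ∀ a, (∀ f < 3, ∀ i, ∀ k : M.K, a ≠ cellA f j i k) → s'.1 a = s.1 a := by
  have hmain := Item.foldl_map y (cells M w) (nodup_cells w)
    (fun x => cellA x.2.1 j x.2.2 x.1)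
    (fun x => .or (.or (loadTerm j w x.2.1 x.2.2 x.1 1) (loadTerm j w x.2.1 x.2.2 x.1 2))
      (.or (loadTerm j w x.2.1 x.2.2 x.1 3) (loadTerm j w x.2.1 x.2.2 x.1 4))) ?_ s ?_
  · obtain ⟨h1, h2, h3⟩ := hmain
    refine ⟨h1, ?_, ?_⟩
    · intro k f hf i hi
      exact h2 (k, f, i) (mem_cells.2 ⟨hf, hi⟩)
    · intro a ha
      exact h3 a fun x hx => ha _ (mem_cells.1 hx).1 _ _
  · rintro ⟨k, f, i⟩ - ⟨k', f', i'⟩ - h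
    simp only [Prod.mk.injEq, tapeIx_inj, true_and] at h
    obtain ⟨rfl, rfl, rfl⟩ := h
    rfl
  · rintro ⟨k, f, i⟩ hx m hm
    have hx' := (mem_cells.1 hx).1
    simp only at hx'
    simp only [BExpr.eval, loadTerm]
    have hs : ∀ b, m (selA (j + 1) b k) = s.1 (selA (j + 1) b k) := by
      intro b
      refine hm _ fun x' hx' _ h => ?_
      have := (mem_cells.1 hx').1
      simp only [Prod.mk.injEq] at h
      omega
    have hc : ∀ i, m (cellA f (j + 1) i k) = s.1 (cellA f (j + 1) i k) := by
      intro i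
      refine hm _ fun x' hx' _ h => ?_
      simp only [Prod.mk.injEq] at h
      omega
    rw [hs, hs, hs, hs, hc, hc, hc, hc]

theorem storeItem_spec (y : List Bool) (j w b : ℕ) (s : Mem × ℕ) :
    let s' := ((cells M w).map (storeItem j w b)).foldl (Item.exec y) s
    s'.2 = s.2 ∧ (∀ k : M.K, ∀ f < 3, ∀ i, s'.1 (cellA f (j + 1) i k) =
        if s.1 (selA (j + 1) b k) = true ∧ (b - 1) * w ≤ i ∧ i < (b - 1) * w + 3 * w then
          s.1 (cellA f j (i - (b - 1) * w) k) else s.1 (cellA f (j + 1) i k)) ∧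
      ∀ a, (∀ f < 3, ∀ i, ∀ k : M.K, a ≠ cellA f (j + 1) i k) → s'.1 a = s.1 a := by
  have hmain := Item.foldl_map y (cells M w) (nodup_cells w)
    (fun x => cellA x.2.1 (j + 1) ((b - 1) * w + x.2.2) x.1)
    (fun x => .or (.and (.var (selA (j + 1) b x.1)) (.var (cellA x.2.1 j x.2.2 x.1)))
      (.and (.not (.var (selA (j + 1) b x.1)))
        (.var (cellA x.2.1 (j + 1) ((b - 1) * w + x.2.2) x.1)))) ?_ s ?_
  · obtain ⟨h1, h2, h3⟩ := hmain
    refine ⟨h1, ?_, ?_⟩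
    · intro k f hf i
      by_cases hi : (b - 1) * w ≤ i ∧ i < (b - 1) * w + 3 * w
      · have := h2 (k, f, i - (b - 1) * w) (mem_cells.2 ⟨hf, by simp; omega⟩)
        simp only [BExpr.eval, show (b - 1) * w + (i - (b - 1) * w) = i by omega] at this
        refine this.trans ?_
        simp only [hi, and_true]
        cases s.1 (selA (j + 1) b k) <;> simp
      · rw [if_neg (by tauto)]
        refine h3 _ fun x hx h => hi ?_
        have := (mem_cells.1 hx).2
        simp only [Prod.mk.injEq] at h
        omega
    · intro a ha
      exact h3 a fun x hx => ha _ (mem_cells.1 hx).1 _ _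
  · rintro ⟨k, f, i⟩ - ⟨k', f', i'⟩ - h
    simp only [Prod.mk.injEq, tapeIx_inj, true_and, Nat.add_left_cancel_iff] at h
    obtain ⟨rfl, rfl, rfl⟩ := h
    rfl
  · rintro ⟨k, f, i⟩ hx m hm
    simp only [BExpr.eval]
    rw [hm (selA (j + 1) b k), hm (cellA f j i k), hm (cellA f (j + 1) ((b - 1) * w + i) k)]
    · rintro ⟨k', f', i'⟩ _ hne h
      simp only [Prod.mk.injEq, tapeIx_inj, true_and, Nat.add_left_cancel_iff] at h
      obtain ⟨rfl, rfl, rfl⟩ := h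
      exact hne rfl
    · rintro x' _ _ h
      simp only [Prod.mk.injEq] at h
      omega
    · rintro x' hx' _ h
      have := (mem_cells.1 hx').1
      simp only [Prod.mk.injEq] at h
      omega

/-- The pass for `b` changes only the tapes `k` with `β k = b`, so every tape is changed by at most
one pass. -/
theorem storeItems_spec (y : List Bool) (j w : ℕ) (B : List ℕ) (β : M.K → ℕ) (s : Mem × ℕ)
    (hB : B.Nodup) (hβ : ∀ b ∈ B, ∀ k, s.1 (selA (j + 1) b k) = decide (b = β k)) :
    let s' := (storeItems M j w B).foldl (Item.exec y) s
    s'.2 = s.2 ∧ (∀ k : M.K, ∀ f < 3, ∀ i, s'.1 (cellA f (j + 1) i k) =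
        if β k ∈ B ∧ (β k - 1) * w ≤ i ∧ i < (β k - 1) * w + 3 * w then
          s.1 (cellA f j (i - (β k - 1) * w) k) else s.1 (cellA f (j + 1) i k)) ∧
      ∀ a, (∀ f < 3, ∀ i, ∀ k : M.K, a ≠ cellA f (j + 1) i k) → s'.1 a = s.1 a := by
  induction B generalizing s with
  | nil => simp [storeItems]
  | cons b B ih =>
    obtain ⟨hb, hB⟩ := List.nodup_cons.1 hB
    rw [storeItems, List.flatMap_cons, List.foldl_append]
    obtain ⟨h1, h2, h3⟩ := storeItem_spec (M := M) y j w b s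
    set s₁ := ((cells M w).map (storeItem j w b)).foldl (Item.exec y) s
    have hsel : ∀ b k, s₁.1 (selA (M := M) (j + 1) b k) = s.1 (selA (j + 1) b k) := by
      intro b k
      refine h3 _ fun f hf i k' h => ?_
      simp only [Prod.mk.injEq] at h
      omega
    have hlow : ∀ f i k, s₁.1 (cellA (M := M) f j i k) = s.1 (cellA f j i k) := by
      intro f i k
      refine h3 _ fun f hf i k' h => ?_
      simp only [Prod.mk.injEq] at h
      omega
    obtain ⟨k1, k2, k3⟩ := ih s₁ hB (by
      intro b' hb' k; rw [hsel, hβ b' (by simp [hb']) k])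
    refine ⟨k1.trans h1, ?_, ?_⟩
    · intro k f hf i
      refine (k2 k f hf i).trans ?_
      rw [hlow, h2 k f hf i, hβ b (by simp) k]
      by_cases hbk : b = β k
      · subst hbk
        simp [hb]
      · have : β k ≠ b := fun h => hbk h.symm
        simp [hbk, this]
    · intro a ha
      exact (k3 a ha).trans (h3 a ha)

end Simulation

end

/-! ### Correctness of the recursive simulation -/

section

open ProbTM

section Simulation

variable {M : ProbTM}

theorem Frame.trans {j : ℕ} {m m' m'' : Mem} (h : Frame M j m m') (h' : Frame M j m' m'') :
    Frame M j m m'' :=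
  ⟨h'.1.trans h.1, fun j' hj k => ⟨fun f hf i => ((h'.2 j' hj k).1 f hf i).trans
    ((h.2 j' hj k).1 f hf i), fun b => ((h'.2 j' hj k).2 b).trans ((h.2 j' hj k).2 b)⟩⟩

theorem bit_congr_pos (c : AbsCfg M) (f : ℕ) (k : M.K) {p p' : ℤ} (h : p = p') :
    c.bit f k p = c.bit f k p' := h ▸ rfl

/-- During `w` steps, the heads stay within the block in which they start and its two neighbours,
and no other cells change. These three blocks form a window with the head in the middle, to which
`P` applies. In the outer blocks `0` and `5` one neighbour would be missing. -/
theorem Simulates.window {y : List Bool} {P : List Item} {j : ℕ}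
    (hP : Simulates M y P j (2 ^ j) 1 2 (2 ^ j)) :
    Simulates M y (selItems M (j + 1) (2 ^ j) ++ loadItems M j (2 ^ j) ++ P ++
      storeItems M j (2 ^ j) [1, 2, 3, 4]) (j + 1) (2 ^ j) 1 5 (2 ^ j) := by
  intro s c o hs h0 hpos
  have hw : 0 < 2 ^ j := by positivity
  generalize hwd : 2 ^ j = w at hP hpos hw ⊢
  have hw6 : 3 * 2 ^ (j + 1) = 6 * w := by rw [pow_succ, hwd]; ring
  obtain ⟨hs1, hs2⟩ := hs
  rw [hw6] at hs1
  have hex : ∀ k, ∃ b : ℕ, 1 ≤ b ∧ b ≤ 4 ∧ o k + b * w ≤ c.pos k ∧ c.pos k < o k + (b + 1) * w := by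
    intro k
    have h := hpos k
    rcases lt_or_ge (c.pos k) (o k + 2 * w) with h2 | h2
    · exact ⟨1, by omega, by omega, by push_cast at h ⊢; omega, by push_cast; omega⟩
    rcases lt_or_ge (c.pos k) (o k + 3 * w) with h3 | h3
    · exact ⟨2, by omega, by omega, by push_cast at h ⊢; omega, by push_cast; omega⟩
    rcases lt_or_ge (c.pos k) (o k + 4 * w) with h4 | h4
    · exact ⟨3, by omega, by omega, by push_cast at h ⊢; omega, by push_cast; omega⟩
    · exact ⟨4, by omega, by omega, by push_cast at h ⊢; omega, by push_cast at h ⊢; omega⟩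
  choose β hβ1 hβ4 hβ using hex
  simp only [List.foldl_append]
  -- the selectors
  obtain ⟨a1, a2, a3⟩ := selItems_spec y (j + 1) w ((tapes M).product [1, 2, 3, 4])
    ((nodup_tapes M).product (by simp)) s h0
  rw [← selItems] at a1 a2 a3
  set s₁ := (selItems M (j + 1) w).foldl (Item.exec y) s
  have hsel : ∀ k, ∀ b ∈ [1, 2, 3, 4], s₁.1 (selA (M := M) (j + 1) b k) = decide (b = β k) := by
    intro k b hb
    rw [a2 (k, b) (List.pair_mem_product.2 ⟨mem_tapes M k, hb⟩), Bool.eq_iff_iff, List.any_eq_true,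
      decide_eq_true_iff]
    have hb5 : b ≤ 4 := by simp at hb; omega
    have hbw : b * w ≤ 4 * w := Nat.mul_le_mul_right _ hb5
    have hb' := hβ k
    constructor
    · rintro ⟨i, hi, h⟩
      rw [List.mem_range] at hi
      rw [hs1 k 2 (by omega) _ (by dsimp; omega)] at h
      have h : c.pos k = o k + ((b * w + i : ℕ) : ℤ) := of_decide_eq_true h
      push_cast at h
      have h1 : (b : ℤ) * w < (β k + 1) * w := by omega
      have h2 : (β k : ℤ) * w < (b + 1) * w := by
        have : ((b : ℤ) + 1) * w = b * w + w := by ring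
        omega
      have h1 := lt_of_mul_lt_mul_right h1 (by positivity)
      have h2 := lt_of_mul_lt_mul_right h2 (by positivity)
      omega
    · rintro rfl
      have h2 : ((β k : ℤ) + 1) * w = β k * w + w := by ring
      refine ⟨(c.pos k - o k - β k * w).toNat, List.mem_range.2 (by omega), ?_⟩
      rw [hs1 k 2 (by omega) _ (by dsimp; omega)]
      refine decide_eq_true ?_
      push_cast
      omega
  have hc₁ : ∀ f < 3, ∀ i (k : M.K) j', s₁.1 (cellA f j' i k) = s.1 (cellA f j' i k) := by
    intro f hf i k j'
    refine a3 _ fun x _ h => ?_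
    simp only [Prod.mk.injEq] at h
    omega
  -- load
  obtain ⟨b1, b2, b3⟩ := loadItems_spec (M := M) y j w s₁
  set s₂ := (loadItems M j w).foldl (Item.exec y) s₁
  have hc₂ : ∀ f < 3, ∀ i (k : M.K), ∀ j' ≠ j, s₂.1 (cellA f j' i k) = s.1 (cellA f j' i k) := by
    intro f hf i k j' hj'
    refine (b3 _ fun f' hf' i' k' h => ?_).trans (hc₁ f hf i k j')
    simp only [Prod.mk.injEq] at h
    omega
  have hs₂ : ∀ j' b (k : M.K), s₂.1 (selA j' b k) = s₁.1 (selA j' b k) := by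
    intro j' b k
    refine b3 _ fun f' hf' i' k' h => ?_
    simp only [Prod.mk.injEq] at h
    omega
  -- The loaded window begins one block before the block of the head, hence the shift of the offset.
  have hrep : MemRep j s₂.1 c fun k => o k + ((β k - 1) * w : ℕ) := by
    rw [MemRep, hwd]
    constructor
    · intro k f hf i hi
      rw [b2 k f hf i hi, hsel k 1 (by simp), hsel k 2 (by simp), hsel k 3 (by simp),
        hsel k 4 (by simp), hc₁ f hf, hc₁ f hf, hc₁ f hf, hc₁ f hf,
        hs1 k f hf _ (by omega), hs1 k f hf _ (by omega), hs1 k f hf _ (by omega),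
        hs1 k f hf _ (by omega)]
      have h1 := hβ1 k
      have h4 := hβ4 k
      generalize β k = b at *
      interval_cases b <;> simp <;> exact bit_congr_pos _ _ _ (by ring)
    · intro q
      rw [b3 _ (by intro f hf i k h; simp only [Prod.mk.injEq] at h; omega),
        a3 _ (by intro x _ h; simp only [Prod.mk.injEq] at h; omega), hs2]
  have hz₂ : s₂.1 zeroAddr = false := by
    rw [b3 _ (by intro f hf i k h; simp only [Prod.mk.injEq] at h; omega),
        a3 _ (by intro x _ h; simp only [Prod.mk.injEq] at h; omega), h0]
  have hcast : ∀ k, (((β k - 1) * w : ℕ) : ℤ) = (β k : ℤ) * w - w := by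
    intro k
    rw [Nat.cast_mul, Nat.cast_sub (hβ1 k)]
    push_cast
    ring
  have hcast' : ∀ k, ((β k : ℤ) + 1) * w = (β k : ℤ) * w + w := fun k => by ring
  obtain ⟨p1, p2, p3⟩ := hP s₂ c _ hrep hz₂ (by
    intro k
    have := hβ k
    have := hcast k
    have := hcast' k
    push_cast at *
    omega)
  set s₃ := P.foldl (Item.exec y) s₂
  set c' := (coins y s₂.2 w).foldl AbsCfg.step c with hc'
  have hc₃ : ∀ f < 3, ∀ i (k : M.K), ∀ j' > j, s₃.1 (cellA f j' i k) = s.1 (cellA f j' i k) :=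
    fun f hf i k j' hj' => ((p3.2 j' hj' k).1 f hf i).trans (hc₂ f hf i k j' (by omega))
  have hs₃ : ∀ b (k : M.K), ∀ j' > j, s₃.1 (selA j' b k) = s₁.1 (selA j' b k) :=
    fun b k j' hj' => ((p3.2 j' hj' k).2 b).trans (hs₂ j' b k)
  -- store
  obtain ⟨d1, d2, d3⟩ := storeItems_spec (M := M) y j w [1, 2, 3, 4] β s₃ (by simp) (by
    intro b hb k
    rw [hs₃ b k (j + 1) (by omega), hsel k b hb])
  set s₄ := (storeItems M j w [1, 2, 3, 4]).foldl (Item.exec y) s₃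
  have hcnt : s₂.2 = s.2 := b1.trans a1
  refine ⟨by rw [d1, p1, hcnt], ?_, ?_, ?_⟩
  · rw [← hcnt, ← hc', MemRep, hw6]
    constructor
    · intro k f hf i hi
      have hb1 := hβ1 k
      have hb4 := hβ4 k
      have hβm : β k ∈ [1, 2, 3, 4] := by simp; omega
      rw [d2 k f hf i]
      split_ifs with hin
      · rw [p2.1 k f hf _ (by rw [hwd]; omega)]
        refine bit_congr_pos _ _ _ ?_
        rw [Nat.cast_sub hin.2.1]
        ring
      · have hout : i < (β k - 1) * w ∨ (β k - 1) * w + 3 * w ≤ i := by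
          by_contra! hcon
          exact hin ⟨hβm, hcon.1, hcon.2⟩
        rw [hc₃ f hf i k (j + 1) (by omega), hs1 k f hf i hi]
        have hnear := AbsCfg.foldl_near c (coins y s₂.2 w) k
        rw [length_coins, ← hc'] at hnear
        obtain ⟨n1, n2, n3⟩ := hnear
        have hb := hβ k
        have hk := hcast k
        have hk' := hcast' k
        -- A cell that was not loaded is at distance at least `w` from the old position of the head,
        -- so its contents are unchanged; and the head is there neither before nor after the `w`
        -- steps.
        have hp : o k + i ≤ c.pos k - w ∧ o k + i < c'.pos k ∧ o k + i < c.pos k ∨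
            c.pos k + w ≤ o k + i ∧ c'.pos k < o k + i ∧ c.pos k < o k + i := by
          rcases hout with hout | hout
          · left
            have hout : (i : ℤ) < (((β k - 1) * w : ℕ) : ℤ) := by exact_mod_cast hout
            omega
          · right
            have hout : (((β k - 1) * w : ℕ) : ℤ) + 3 * w ≤ i := by exact_mod_cast hout
            omega
        have hcont := n3 (o k + i) (by tauto)
        rcases f with _ | _ | _ | f
        · simp only [AbsCfg.bit, hcont]
        · simp only [AbsCfg.bit, hcont]
        · simp only [AbsCfg.bit]
          rw [decide_eq_decide]
          omega
        · omega
    · intro q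
      rw [d3 _ (by intro f hf i k h; simp only [Prod.mk.injEq] at h; omega), p2.2]
  · rw [d3 _ (by intro f hf i k h; simp only [Prod.mk.injEq] at h; omega), p3.1, hz₂, h0]
  · intro j' hj' k
    constructor
    · intro f hf i
      rw [d3 _ (by intro f hf i k h; simp only [Prod.mk.injEq] at h; omega),
        hc₃ f hf i k j' (by omega)]
    · intro b
      rw [d3 _ (by intro f hf i k h; simp only [Prod.mk.injEq] at h; omega),
        hs₃ b k j' (by omega)]
      refine a3 _ fun x _ h => ?_
      simp only [Prod.mk.injEq] at h
      omega

/-- Heads in the middle third, which consists of the blocks `2` and `3` of length `w`, are in the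
blocks `1` to `4` after `w` steps, so `W` applies a second time. -/
theorem Simulates.double {y : List Bool} {W : List Item} {j w : ℕ}
    (hW : Simulates M y W j w 1 5 w) : Simulates M y (W ++ W) j (2 * w) 1 2 (2 * w) := by
  intro s c o hs h0 hpos
  obtain ⟨h1, h2, h3⟩ := hW s c o hs h0 fun k => by
    have := hpos k
    push_cast at this ⊢
    omega
  obtain ⟨k1, k2, k3⟩ := hW _ _ o h2 (h3.1.trans h0) fun k => by
    have h := hpos k
    have hn := AbsCfg.foldl_near c (coins y s.2 w) k
    rw [length_coins] at hn
    push_cast at h ⊢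
    omega
  rw [List.foldl_append]
  refine ⟨by rw [k1, h1]; ring, ?_, h3.trans k3⟩
  rw [two_mul, coins_add, List.foldl_append, ← h1]
  exact k2

theorem simItems_spec {y : List Bool} {base : List Item} (hb : Simulates M y base 0 1 1 2 1)
    (j : ℕ) : Simulates M y (simItems M base j) j (2 ^ j) 1 2 (2 ^ j) := by
  induction j with
  | zero => exact hb
  | succ j ih =>
    rw [pow_succ, mul_comm]
    exact ih.window.double

end Simulation

end

section

open ProbTM

section Simulation

variable {M : ProbTM}

/-! ### The simulation of a single step -/

/-- The configurations `c` and `c'` agree on windows of length three with offsets `o` and `o'`. -/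
def AbsCfg.Agree (c : AbsCfg M) (o : M.K → ℤ) (c' : AbsCfg M) (o' : M.K → ℤ) : Prop :=
  c.state = c'.state ∧ (∀ k, ∀ i : ℕ, i < 3 → c.cont k (o k + i) = c'.cont k (o' k + i)) ∧
    ∀ k, c.pos k - o k = c'.pos k - o' k

/-- The head is in the middle of its window, so the scanned symbols agree, and one step neither
reads nor writes any other cell. -/
theorem AbsCfg.Agree.step {c c' : AbsCfg M} {o o' : M.K → ℤ} (h : c.Agree o c' o')
    (hc : ∀ k, c.pos k = o k + 1) (b : Bool) : (c.step b).Agree o (c'.step b) o' := by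
  obtain ⟨h1, h2, h3⟩ := h
  have hr : (fun k => c.cont k (c.pos k)) = fun k => c'.cont k (c'.pos k) := by
    funext k
    have h := h2 k 1 (by omega)
    have h' := hc k
    have h'' := h3 k
    rw [show c'.pos k = o' k + (1 : ℕ) by push_cast; omega, ← h, h']
    rfl
  rw [AbsCfg.step, AbsCfg.step, ← h1, ← hr]
  split_ifs
  · exact ⟨h1, h2, h3⟩
  · refine ⟨rfl, fun k i hi => ?_, fun k => ?_⟩
    · have h'' := h3 k
      simp only
      by_cases hik : o k + i = c.pos k
      · rw [hik, show o' k + i = c'.pos k by omega, Function.update_self, Function.update_self]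
      · rw [Function.update_of_ne hik, Function.update_of_ne (by omega), h2 k i hi]
    · have h'' := h3 k
      simp only
      omega

variable (M) in
/-- The cells that describe a window at level `0`. -/
noncomputable def localCells : List ((M.K × ℕ × ℕ) ⊕ M.Q) :=
  (cells M 1).map .inl ++ (Finset.univ : Finset M.Q).toList.map .inr

noncomputable def localAddr : (M.K × ℕ × ℕ) ⊕ M.Q → Addr
  | .inl x => cellA x.2.1 0 x.2.2 x.1
  | .inr q => stA q

noncomputable def localBit (c : AbsCfg M) (o : M.K → ℤ) : (M.K × ℕ × ℕ) ⊕ M.Q → Bool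
  | .inl x => c.bit x.2.1 x.1 (o x.1 + x.2.2)
  | .inr q => decide (c.state = q)

@[simp] theorem inl_mem_localCells {x : M.K × ℕ × ℕ} :
    Sum.inl x ∈ localCells M ↔ x.2.1 < 3 ∧ x.2.2 < 3 := by
  simp [localCells, mem_cells]

@[simp] theorem inr_mem_localCells {q : M.Q} : Sum.inr q ∈ localCells M := by
  simp [localCells]

theorem nodup_localCells : (localCells M).Nodup := by
  rw [localCells, List.nodup_append]
  refine ⟨(nodup_cells 1).map Sum.inl_injective,
    (Finset.nodup_toList _).map Sum.inr_injective, ?_⟩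
  intro a ha b hb
  obtain ⟨x, -, rfl⟩ := List.mem_map.1 ha
  obtain ⟨q, -, rfl⟩ := List.mem_map.1 hb
  simp

theorem localAddr_inj {x x' : (M.K × ℕ × ℕ) ⊕ M.Q} (hx : x ∈ localCells M)
    (hx' : x' ∈ localCells M) (h : localAddr x = localAddr x') : x = x' := by
  rcases x with ⟨k, f, i⟩ | q <;> rcases x' with ⟨k', f', i'⟩ | q' <;>
    simp only [localAddr, Prod.mk.injEq, tapeIx_inj, stateIx_inj, inl_mem_localCells] at h hx hx'
  · obtain ⟨rfl, -, rfl, rfl⟩ := h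
    rfl
  · omega
  · omega
  · rw [h.2.1]

theorem localAddr_fst {x : (M.K × ℕ × ℕ) ⊕ M.Q} (hx : x ∈ localCells M) :
    (localAddr x).1 < 3 ∧ (localAddr x).2.1 = 0 ∨ (localAddr x).1 = 4 := by
  rcases x with ⟨k, f, i⟩ | q
  · exact Or.inl ⟨(inl_mem_localCells.1 hx).1, rfl⟩
  · exact Or.inr rfl

theorem memRep_zero_iff {m : Mem} {c : AbsCfg M} {o : M.K → ℤ} :
    MemRep 0 m c o ↔ ∀ x ∈ localCells M, m (localAddr x) = localBit c o x := by
  constructor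
  · rintro ⟨h1, h2⟩ (⟨k, f, i⟩ | q) hx
    · have := inl_mem_localCells.1 hx
      exact h1 k f this.1 i (by simpa using this.2)
    · exact h2 q
  · intro h
    exact ⟨fun k f hf i hi => h (.inl (k, f, i)) (inl_mem_localCells.2 ⟨hf, by simpa using hi⟩),
      fun q => h (.inr q) inr_mem_localCells⟩

theorem AbsCfg.Agree.localBit_eq {c c' : AbsCfg M} {o o' : M.K → ℤ} (h : c.Agree o c' o')
    {x : (M.K × ℕ × ℕ) ⊕ M.Q} (hx : x ∈ localCells M) : localBit c o x = localBit c' o' x := by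
  obtain ⟨h1, h2, h3⟩ := h
  rcases x with ⟨k, f, i⟩ | q
  · have := inl_mem_localCells.1 hx
    simp only [localBit]
    rcases f with _ | _ | f
    · simp only [AbsCfg.bit, h2 k i this.2]
    · simp only [AbsCfg.bit, h2 k i this.2]
    · simp only [AbsCfg.bit]
      rw [decide_eq_decide]
      have := h3 k
      omega
  · simp only [localBit, h1]

/-- The first two bits of a cell determine its contents. The bits for the head are not needed, since
both heads are centred. -/
theorem AbsCfg.agree_of_localBit {c c' : AbsCfg M} {o o' : M.K → ℤ}
    (hc : ∀ k, c.pos k = o k + 1) (hc' : ∀ k, c'.pos k = o' k + 1)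
    (h : ∀ x ∈ localCells M, localBit c o x = localBit c' o' x) : c.Agree o c' o' := by
  refine ⟨?_, fun k i hi => ?_, fun k => ?_⟩
  · have := h (.inr c.state) inr_mem_localCells
    simpa [localBit, eq_comm] using this
  · have h0 := h (.inl (k, 0, i)) (by simpa using hi)
    have h1 := h (.inl (k, 1, i)) (by simpa using hi)
    simp only [localBit, AbsCfg.bit] at h0 h1
    revert h0 h1
    rcases c.cont k (o k + i) with _ | _ | _ <;> rcases c'.cont k (o' k + i) with _ | _ | _ <;> simp
  · rw [hc, hc']
    ring

/-- Auxiliary copies of the cells. -/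
abbrev copyAddr (a : Addr) : Addr := (a.1 + 8, a.2)

-- Every new bit is a function of the coin and the bits of the window, so `BExpr.exists_eval_eq`
-- provides an expression for it. This function is specified by the existence of a configuration
-- with the given bits; by `AbsCfg.Agree.step` all such configurations lead to the same new bits.
variable (M) in
theorem exists_step_program : ∃ base : List Item, (∀ x ∈ base, x.Good) ∧
    ∀ y, Simulates M y base 0 1 1 2 1 := by
  classical
  have hex : ∀ x : (M.K × ℕ × ℕ) ⊕ M.Q, ∃ e : BExpr,
      e.All (fun a => a ∈ coinA :: (localCells M).map localAddr ∨ a = zeroAddr) ∧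
      ∀ m : Mem, m zeroAddr = false → e.eval m = decide (∃ (c : AbsCfg M) (o : M.K → ℤ),
        (∀ x ∈ localCells M, m (localAddr x) = localBit c o x) ∧ (∀ k, c.pos k = o k + 1) ∧
        localBit (c.step (m coinA)) o x = true) := by
    intro x
    refine BExpr.exists_eval_eq _ (fun m => decide (∃ (c : AbsCfg M) (o : M.K → ℤ),
        (∀ x ∈ localCells M, m (localAddr x) = localBit c o x) ∧ (∀ k, c.pos k = o k + 1) ∧
        localBit (c.step (m coinA)) o x = true)) fun m m' h => ?_
    rw [decide_eq_decide]
    refine exists_congr fun c => exists_congr fun o => and_congr ?_ (and_congr_right fun _ => ?_)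
    · exact forall₂_congr fun x hx => by
        rw [h _ (List.mem_cons_of_mem _ (List.mem_map_of_mem hx))]
    · rw [h coinA (by simp)]
  choose e he he' using hex
  have hread : ∀ x, (e x).All fun a => a.1 < 6 ∨ a.1 = 7 := by
    intro x
    refine (he x).mono fun a ha => ?_
    rcases ha with ha | rfl
    · rcases List.mem_cons.1 ha with rfl | ha
      · exact Or.inl (by norm_num)
      · obtain ⟨x, hx, rfl⟩ := List.mem_map.1 ha
        have := localAddr_fst hx
        omega
    · exact Or.inr rfl
  -- All new bits are computed into copies before the first of them is written back, because every
  -- expression refers to the old bits.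
  refine ⟨(coinA, none) :: ((localCells M).map fun x => (copyAddr (localAddr x), some (e x))) ++
    (localCells M).map fun x => (localAddr x, some (.var (copyAddr (localAddr x)))), ?_, ?_⟩
  · intro x hx
    rcases List.mem_append.1 hx with hx | hx
    · rcases List.mem_cons.1 hx with rfl | hx
      · exact ⟨by norm_num, by simp, by simp⟩
      · obtain ⟨z, hz, rfl⟩ := List.mem_map.1 hx
        have := localAddr_fst hz
        refine ⟨by dsimp; omega, fun h => ?_, ?_⟩
        · have := congrArg Prod.fst h
          dsimp at this
          omega
        · rintro _ ⟨⟩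
          exact (hread z).mono fun a ha => by omega
    · obtain ⟨z, hz, rfl⟩ := List.mem_map.1 hx
      have := localAddr_fst hz
      refine ⟨by dsimp; omega, fun h => ?_, ?_⟩
      · have := congrArg Prod.fst h
        dsimp at this
        omega
      · rintro _ ⟨⟩
        simp only [BExpr.All]
        omega
  · intro y s c o hs h0 hpos
    have hcen : ∀ k, c.pos k = o k + 1 := fun k => by have := hpos k; push_cast at this; omega
    rw [memRep_zero_iff] at hs
    rw [List.cons_append, List.foldl_cons, List.foldl_append]
    set s₁ : Mem × ℕ := Item.exec y s (coinA, none) with hs₁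
    have e1 : s₁.1 = Function.update s.1 coinA (y.getD s.2 false) := rfl
    have e2 : s₁.2 = s.2 + 1 := rfl
    obtain ⟨k1, k2, k3⟩ := Item.foldl_map y (localCells M) nodup_localCells
      (fun x => copyAddr (localAddr x)) e (fun x hx x' hx' h => localAddr_inj hx hx' (by
        simp only [Prod.mk.injEq, Nat.add_right_cancel_iff] at h
        exact Prod.ext h.1 h.2)) s₁ (fun x hx m hm => by
        refine BExpr.eval_congr _ (hread x) fun a ha => hm a fun z hz _ h => ?_
        have := congrArg Prod.fst h
        dsimp at this
        omega)
    set s₂ := ((localCells M).map fun x => ((copyAddr (localAddr x), some (e x)) : Item)).foldl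
      (Item.exec y) s₁
    obtain ⟨l1, l2, l3⟩ := Item.foldl_map y (localCells M) nodup_localCells
      localAddr (fun x => .var (copyAddr (localAddr x)))
      (fun x hx x' hx' h => localAddr_inj hx hx' h) s₂ (fun x hx m hm => by
        refine hm _ fun z hz _ h => ?_
        have h := congrArg Prod.fst h
        have := localAddr_fst hz
        dsimp at h
        omega)
    set s₃ := ((localCells M).map fun x =>
      ((localAddr x, some (.var (copyAddr (localAddr x)))) : Item)).foldl (Item.exec y) s₂
    have hne : ∀ a : Addr, a.1 ≠ 5 → s₁.1 a = s.1 a := fun a ha => by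
      rw [e1, Function.update_of_ne]
      rintro rfl
      exact ha rfl
    have hz : s₁.1 zeroAddr = false := by rw [hne _ (by norm_num), h0]
    have hsame : ∀ a : Addr, a.1 < 8 → a.1 ≠ 5 → (a.1 < 3 → a.2.1 ≠ 0) → a.1 ≠ 4 →
        s₃.1 a = s.1 a := by
      intro a h1 h2 h3 h4
      rw [l3 a, k3 a, hne a h2]
      · intro x hx h
        have := congrArg Prod.fst h
        dsimp at this
        omega
      · rintro x hx rfl
        have := localAddr_fst hx
        omega
    refine ⟨by rw [l1, k1, e2], ?_, ?_, ?_⟩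
    · rw [memRep_zero_iff]
      intro x hx
      refine (l2 x hx).trans ?_
      simp only [BExpr.eval]
      rw [k2 x hx, he' x _ hz, Bool.eq_iff_iff, decide_eq_true_iff]
      have hcoin : coins y s.2 1 = [s₁.1 coinA] := by simp [coins, e1]
      rw [hcoin, List.foldl_cons, List.foldl_nil]
      have hs' : ∀ x ∈ localCells M, s₁.1 (localAddr x) = localBit c o x := by
        intro x hx
        have := localAddr_fst hx
        rw [hne _ (by omega), hs x hx]
      constructor
      · rintro ⟨c', o', h1, h2, h3⟩
        have := (AbsCfg.agree_of_localBit hcen h2 fun x hx => (hs' x hx).symm.trans (h1 x hx)).step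
          hcen (s₁.1 coinA)
        rwa [this.localBit_eq hx]
      · exact fun h => ⟨c, o, hs', hcen, h⟩
    · exact hsame _ (by norm_num) (by norm_num) (by norm_num) (by norm_num)
    · intro j' hj' k
      exact ⟨fun f hf i => hsame _ (by dsimp; omega) (by dsimp; omega) (by dsimp; omega)
        (by dsimp; omega), fun b => hsame _ (by norm_num) (by norm_num) (by norm_num) (by norm_num)⟩

/-! ### Auxiliary cells are not used otherwise -/

theorem good_selItems (j w : ℕ) : ∀ x ∈ selItems M j w, x.Good := by
  intro x hx
  obtain ⟨⟨k, b⟩, -, hx⟩ := List.mem_flatMap.1 hx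
  rcases List.mem_cons.1 hx with rfl | hx
  · refine ⟨by norm_num, by simp, ?_⟩
    rintro _ ⟨⟩
    simp [BExpr.All]
  · obtain ⟨i, -, rfl⟩ := List.mem_map.1 hx
    refine ⟨by norm_num, by simp, ?_⟩
    rintro _ ⟨⟩
    simp [BExpr.All]

theorem good_cellA {f j i : ℕ} {k : M.K} (hf : f < 3) :
    (cellA f j i k).1 ≠ 6 ∧ cellA f j i k ≠ zeroAddr := by
  refine ⟨by dsimp; omega, fun h => ?_⟩
  have := congrArg Prod.fst h
  dsimp at this
  omega

theorem good_loadItems (j w : ℕ) : ∀ x ∈ loadItems M j w, x.Good := by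
  intro x hx
  obtain ⟨⟨k, f, i⟩, h, rfl⟩ := List.mem_map.1 hx
  have hf := (mem_cells.1 h).1
  refine ⟨(good_cellA hf).1, (good_cellA hf).2, ?_⟩
  rintro _ ⟨⟩
  simp only [loadTerm, BExpr.All] at hf ⊢
  omega

theorem good_storeItems (j w : ℕ) (B : List ℕ) : ∀ x ∈ storeItems M j w B, x.Good := by
  intro x hx
  obtain ⟨b, -, hx⟩ := List.mem_flatMap.1 hx
  obtain ⟨⟨k, f, i⟩, h, rfl⟩ := List.mem_map.1 hx
  have hf := (mem_cells.1 h).1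
  refine ⟨(good_cellA hf).1, (good_cellA hf).2, ?_⟩
  rintro _ ⟨⟩
  simp only [BExpr.All] at hf ⊢
  omega

theorem good_simItems {base : List Item} (hb : ∀ x ∈ base, x.Good) (j : ℕ) :
    ∀ x ∈ simItems M base j, x.Good := by
  induction j with
  | zero => exact hb
  | succ j ih =>
    intro x hx
    simp only [simItems, List.mem_append, or_self] at hx
    rcases hx with ((hx | hx) | hx) | hx
    · exact good_selItems _ _ x hx
    · exact good_loadItems _ _ x hx
    · exact ih x hx
    · exact good_storeItems _ _ _ x hx

end Simulation

end

section

open ProbTM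

section Simulation

variable {M : ProbTM}

/-! ### The circuit that simulates a machine -/

/-- The constant `true'` is the negation of the zero cell, which therefore must not be a target. -/
theorem Item.foldl_true (y : List Bool) (l : List Addr) (hl : zeroAddr ∉ l) (s : Mem × ℕ)
    (h0 : s.1 zeroAddr = false) :
    let s' := (l.map fun a => ((a, some .true') : Item)).foldl (Item.exec y) s
    s'.2 = s.2 ∧ ∀ a, s'.1 a = (decide (a ∈ l) || s.1 a) := by
  induction l generalizing s with
  | nil => simp
  | cons b l ih =>
    simp only [List.mem_cons, not_or] at hl
    obtain ⟨h1, h2⟩ := ih hl.2 (Item.exec y s (b, some .true')) (by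
      simp [Item.exec, Function.update_of_ne hl.1, h0])
    rw [List.map_cons, List.foldl_cons]
    refine ⟨h1, fun a => ?_⟩
    rw [h2]
    by_cases hab : a = b
    · subst hab
      simp [Item.exec, BExpr.eval, h0]
    · simp [Item.exec, hab]

variable (M) in
/-- The cells of the window at level `j` that contain `1` if the input is `x`. -/
noncomputable def initCells (j : ℕ) (x : List Bool) : List Addr :=
  stA M.start :: ((tapes M).map (cellA 2 j (2 ^ j)) ++
    ((List.range x.length).map (fun i => cellA 0 j (2 ^ j + i) M.inp) ++
      ((List.range x.length).filter fun i => x.getD i false).map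
        fun i => cellA 1 j (2 ^ j + i) M.inp))

abbrev accAddr : Addr := (7, 1, 0, 0)

variable (M) in
/-- The head on the output tape is in cell `i` of the window, and the output is the string `1`. -/
noncomputable def acceptTerm (j i : ℕ) : BExpr :=
  .and (.and (.var (cellA 2 j i M.out)) (.var (cellA 0 j i M.out)))
    (.and (.var (cellA 1 j i M.out)) (.not (.var (cellA 0 j (i + 1) M.out))))

variable (M) in
noncomputable def acceptItems (j : ℕ) : List Item :=
  (accAddr, some .false') :: (List.range (3 * 2 ^ j - 1)).map fun i => (accAddr, some (.or (.var accAddr) (acceptTerm M j i)))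

variable (M) in
/-- The program that decides whether the output of `M` on input `x` after `2 ^ j` steps is `1`. -/
noncomputable def acceptProgram (base : List Item) (j : ℕ) (x : List Bool) : List Instr :=
  (((initCells M j x).map fun a => ((a, some .true') : Item)) ++ simItems M base j ++
    acceptItems M j).flatMap Item.compile ++ [(3, accAddr, accAddr, accAddr)]

variable (M) in
/-- The initial configuration on input `x`. -/
def AbsCfg.init (x : List Bool) : AbsCfg M :=
  ⟨M.start, fun _ => 0, fun k p => if k = M.inp ∧ 0 ≤ p then x[p.toNat]? else none⟩

theorem AbsCfg.matches_init (x : List Bool) : AbsCfg.Matches (M.init x) (AbsCfg.init M x) := by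
  refine ⟨rfl, fun k i => ?_⟩
  simp only [ProbTM.init, AbsCfg.init, zero_add]
  rcases lt_or_ge i 0 with hi | hi
  · rw [if_neg (show ¬(k = M.inp ∧ 0 ≤ i) by omega)]
    split_ifs
    · exact mk₁_nth_neg _ _ hi
    · exact mk₁_nth_neg _ _ hi
  · lift i to ℕ using hi
    by_cases hk : k = M.inp
    · rw [if_pos hk, if_pos ⟨hk, by omega⟩, mk₁_nth_nat]
      simp only [List.getElem?_map, Int.toNat_natCast]
      cases x[i]? <;> rfl
    · rw [if_neg hk, if_neg (by tauto), mk₁_nth_nat]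
      simp

theorem cellA_zero_mem_initCells {j i : ℕ} {x : List Bool} {k : M.K} :
    cellA 0 j i k ∈ initCells M j x ↔ k = M.inp ∧ ∃ i' < x.length, 2 ^ j + i' = i := by
  simp only [initCells, List.mem_cons, List.mem_append, List.mem_map, List.mem_range, Prod.mk.injEq,
    tapeIx_inj]
  constructor
  · rintro (h | ⟨k', h⟩ | ⟨i', h1, -, -, h2, h3⟩ | ⟨i', h⟩)
    · omega
    · omega
    · exact ⟨h3.symm, i', h1, h2⟩
    · omega
  · rintro ⟨rfl, i', h1, h2⟩
    exact Or.inr (Or.inr (Or.inl ⟨i', h1, trivial, trivial, h2, rfl⟩))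

theorem cellA_one_mem_initCells {j i : ℕ} {x : List Bool} {k : M.K} :
    cellA 1 j i k ∈ initCells M j x ↔
      k = M.inp ∧ ∃ i', x[i']? = some true ∧ 2 ^ j + i' = i := by
  simp only [initCells, List.mem_cons, List.mem_append, List.mem_map, List.mem_filter,
    List.mem_range, Prod.mk.injEq, tapeIx_inj]
  constructor
  · rintro (h | ⟨k', h⟩ | ⟨i', h⟩ | ⟨i', ⟨h1, h1'⟩, -, -, h2, h3⟩)
    · omega
    · omega
    · omega
    · rw [List.getD_eq_getElem _ _ h1] at h1'
      exact ⟨h3.symm, i', by rw [List.getElem?_eq_getElem h1, h1'], h2⟩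
  · rintro ⟨rfl, i', h1, h2⟩
    exact Or.inr (Or.inr (Or.inr ⟨i', ⟨(List.getElem?_eq_some_iff.1 h1).1, by
      rw [List.getD_eq_getElem?_getD, h1]; rfl⟩, trivial, trivial, h2, rfl⟩))

theorem cellA_two_mem_initCells {j i : ℕ} {x : List Bool} {k : M.K} :
    cellA 2 j i k ∈ initCells M j x ↔ 2 ^ j = i := by
  simp only [initCells, List.mem_cons, List.mem_append, List.mem_map, Prod.mk.injEq, tapeIx_inj,
    mem_tapes, true_and]
  constructor
  · rintro (h | ⟨k', h⟩ | ⟨i', h⟩ | ⟨i', h⟩)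
    · omega
    · exact h.1
    · omega
    · omega
  · exact fun h => Or.inr (Or.inl ⟨k, h, rfl⟩)

theorem stA_mem_initCells {j : ℕ} {x : List Bool} {q : M.Q} :
    stA q ∈ initCells M j x ↔ M.start = q := by
  simp only [initCells, List.mem_cons, List.mem_append, List.mem_map, Prod.mk.injEq, stateIx_inj]
  constructor
  · rintro (h | ⟨k', h⟩ | ⟨i', h⟩ | ⟨i', h⟩)
    · exact h.2.1.symm
    · omega
    · omega
    · omega
  · rintro rfl
    simp

/-- With the offset `-2 ^ j`, the initial head position `0` is the first cell of the middle third.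
-/
theorem memRep_init (j : ℕ) (x : List Bool) :
    MemRep j (fun a => decide (a ∈ initCells M j x)) (AbsCfg.init M x) fun _ => -2 ^ j := by
  constructor
  · intro k f hf i _
    rw [Bool.eq_iff_iff, decide_eq_true_iff]
    have hcont : ∀ b, (AbsCfg.init M x).cont k (-2 ^ j + i) = some b ↔
        k = M.inp ∧ ∃ i', x[i']? = some b ∧ 2 ^ j + i' = i := by
      intro b
      simp only [AbsCfg.init]
      constructor
      · intro h
        split_ifs at h with hk
        refine ⟨hk.1, _, h, ?_⟩
        zify
        rw [Int.toNat_of_nonneg hk.2]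
        ring
      · rintro ⟨rfl, i', h, rfl⟩
        have hp : (-2 ^ j + ((2 ^ j + i' : ℕ) : ℤ)) = i' := by push_cast; ring
        rw [hp, if_pos ⟨rfl, by omega⟩, Int.toNat_natCast, h]
    interval_cases f
    · rw [cellA_zero_mem_initCells, AbsCfg.bit, Option.isSome_iff_exists]
      simp only [hcont]
      constructor
      · rintro ⟨h, i', h1, h2⟩
        exact ⟨x[i'], h, i', List.getElem?_eq_getElem h1, h2⟩
      · rintro ⟨b, h, i', h1, h2⟩
        exact ⟨h, i', (List.getElem?_eq_some_iff.1 h1).1, h2⟩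
    · rw [cellA_one_mem_initCells, AbsCfg.bit, beq_iff_eq, hcont]
    · rw [cellA_two_mem_initCells]
      refine Iff.trans ?_ (decide_eq_true_iff (p := (0 : ℤ) = -2 ^ j + i)).symm
      zify
      constructor <;> intro h <;> linarith
  · intro q
    rw [decide_eq_decide, stA_mem_initCells]
    rfl

theorem AbsCfg.Matches.outputs_true_iff {C : M.Cfg} {c : AbsCfg M} (h : AbsCfg.Matches C c) :
    M.Outputs C [true] ↔ c.cont M.out (c.pos M.out) = some true ∧
      c.cont M.out (c.pos M.out + 1) = none := by
  have h0 := h.2 M.out 0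
  have h1 := h.2 M.out 1
  rw [add_zero] at h0
  rw [← h0, ← h1]
  constructor
  · intro ho
    exact ⟨ho 0 (by simp), ho 1 (by simp)⟩
  · rintro ⟨ho0, ho1⟩ i hi
    simp only [List.length_singleton] at hi
    interval_cases i
    · exact ho0
    · exact ho1

theorem good_initCells (j : ℕ) (x : List Bool) :
    ∀ a ∈ initCells M j x, a.1 < 5 := by
  intro a ha
  simp only [initCells, List.mem_cons, List.mem_append, List.mem_map] at ha
  rcases ha with rfl | ⟨_, _, rfl⟩ | ⟨_, _, rfl⟩ | ⟨_, _, rfl⟩ <;> norm_num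

theorem good_acceptItems (j : ℕ) : ∀ x ∈ acceptItems M j, x.Good := by
  intro x hx
  rcases List.mem_cons.1 hx with rfl | hx
  · refine ⟨by norm_num, by simp, ?_⟩
    rintro _ ⟨⟩
    simp [BExpr.All]
  · obtain ⟨i, -, rfl⟩ := List.mem_map.1 hx
    refine ⟨by norm_num, by simp, ?_⟩
    rintro _ ⟨⟩
    simp [BExpr.All, acceptTerm]

/-- After `2 ^ j` steps the head on the output tape is still inside the window, so the disjunction
over the places in the window finds it. The last instruction assigns the result to itself and
thereby makes it the value of the last gate. -/
theorem evalCircuit_acceptProgram {base : List Item} (hg : ∀ x ∈ base, x.Good)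
    (hb : ∀ y, Simulates M y base 0 1 1 2 1) {j : ℕ} (hj : 1 ≤ j) (x y : List Bool) :
    evalCircuit ((Instr.codes (acceptProgram M base j x).reverse).map Instr.toGate) y = true ↔
      M.Outputs (M.run x (coins y 0 (2 ^ j))) [true] := by
  have hgood : ∀ z ∈ ((initCells M j x).map fun a => ((a, some .true') : Item)) ++
      simItems M base j ++ acceptItems M j, Item.Good z := by
    intro z hz
    simp only [List.mem_append] at hz
    rcases hz with (hz | hz) | hz
    · obtain ⟨a, ha, rfl⟩ := List.mem_map.1 hz
      have := good_initCells j x a ha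
      refine ⟨by dsimp; omega, fun h => ?_, ?_⟩
      · have := congrArg Prod.fst h
        dsimp at this
        omega
      · rintro _ ⟨⟩
        simp [BExpr.All]
    · exact good_simItems hg j z hz
    · exact good_acceptItems j z hz
  rw [acceptProgram, List.reverse_append, List.reverse_singleton, List.singleton_append,
    Instr.evalCircuit_codes]
  rw [Instr.final, List.foldr_cons, Instr.exec]
  simp only [Instr.tgt, Function.update_self, Bool.or_self]
  rw [List.foldr_reverse, (Item.compile_spec y _ hgood _ _ rfl fun _ _ => rfl).2 _
    (by norm_num), List.foldl_append, List.foldl_append]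
  have hz : zeroAddr ∉ initCells M j x := fun h => by
    have := good_initCells j x _ h
    norm_num at this
  obtain ⟨a1, a2⟩ := Item.foldl_true y (initCells M j x) hz (fun _ => false, 0) rfl
  simp only [Bool.or_false] at a2
  set s₁ := ((initCells M j x).map fun a => ((a, some .true') : Item)).foldl (Item.exec y)
    (fun _ => false, 0)
  have a3 : s₁.1 = fun a => decide (a ∈ initCells M j x) := funext a2
  obtain ⟨b1, b2, b3⟩ := simItems_spec (hb y) j s₁ (AbsCfg.init M x) (fun _ => -2 ^ j)
    (by rw [a3]; exact memRep_init j x) (by rw [a2]; simpa using hz) (by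
      intro k
      simp only [AbsCfg.init]
      push_cast
      have : (0 : ℤ) < 2 ^ j := by positivity
      omega)
  rw [a1] at b2
  set s₂ := (simItems M base j).foldl (Item.exec y) s₁
  have hz₂ : s₂.1 zeroAddr = false := by rw [b3.1, a2]; simpa using hz
  rw [acceptItems, List.foldl_cons]
  set s₃ := Item.exec y s₂ (accAddr, some .false') with hs₃
  have e3 : s₃.1 = Function.update s₂.1 accAddr (s₂.1 zeroAddr) := rfl
  have hs₃' : ∀ f < 3, ∀ i k, s₃.1 (cellA (M := M) f j i k) = s₂.1 (cellA f j i k) := by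
    intro f hf i k
    rw [e3, Function.update_of_ne]
    intro h
    have := congrArg Prod.fst h
    dsimp at this
    omega
  rw [(Item.foldl_or y _ accAddr (acceptTerm M j) (by
    intro i _
    simp [BExpr.All, acceptTerm]) s₃).2.1,
    show s₃.1 accAddr = false by rw [e3, Function.update_self, hz₂], Bool.false_or,
    List.any_eq_true]
  have hm := (AbsCfg.matches_init (M := M) x).foldl (coins y 0 (2 ^ j))
  change _ ↔ M.Outputs ((coins y 0 (2 ^ j)).foldl M.step (M.init x)) [true]
  rw [hm.outputs_true_iff]
  have hnear := AbsCfg.foldl_near (AbsCfg.init M x) (coins y 0 (2 ^ j)) M.out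
  set c' := (coins y 0 (2 ^ j)).foldl AbsCfg.step (AbsCfg.init M x)
  have hnear : -2 ^ j ≤ c'.pos M.out ∧ c'.pos M.out ≤ 2 ^ j := by
    rw [length_coins] at hnear
    simp only [AbsCfg.init] at hnear
    push_cast at hnear
    omega
  -- For `j = 0` the head could reach the last cell of the window, and the cell to its right, which
  -- has to be blank, would be missing.
  have h2 : 2 ≤ 2 ^ j := by
    calc 2 = 2 ^ 1 := rfl
      _ ≤ 2 ^ j := Nat.pow_le_pow_right (by norm_num) hj
  have hp : (((2 : ℕ) ^ j : ℕ) : ℤ) = 2 ^ j := by push_cast; rfl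
  have hterm : ∀ i < 3 * 2 ^ j - 1, (acceptTerm M j i).eval s₃.1 = true ↔
      c'.pos M.out = -2 ^ j + i ∧ c'.cont M.out (-2 ^ j + i) = some true ∧
        c'.cont M.out (-2 ^ j + i + 1) = none := by
    intro i hi
    simp only [acceptTerm, BExpr.eval]
    rw [hs₃' 2 (by norm_num), hs₃' 1 (by norm_num), hs₃' 0 (by norm_num), hs₃' 0 (by norm_num),
      b2.1 _ _ (by norm_num) _ (by omega), b2.1 _ _ (by norm_num) _ (by omega),
      b2.1 _ _ (by norm_num) _ (by omega), b2.1 _ _ (by norm_num) _ (by omega)]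
    simp only [AbsCfg.bit, Bool.and_eq_true, decide_eq_true_iff, beq_iff_eq, Bool.not_eq_true',
      Option.isSome_eq_false_iff, Option.isNone_iff_eq_none]
    push_cast
    rw [← add_assoc]
    constructor
    · rintro ⟨⟨h1, -⟩, h2, h3⟩
      exact ⟨h1, h2, h3⟩
    · rintro ⟨h1, h2, h3⟩
      exact ⟨⟨h1, by rw [h2]; rfl⟩, h2, h3⟩
  constructor
  · rintro ⟨i, hi, h⟩
    obtain ⟨h1, h2, h3⟩ := (hterm i (List.mem_range.1 hi)).1 h
    rw [h1]
    exact ⟨h2, h3⟩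
  · rintro ⟨h3, h4⟩
    have hi : -2 ^ j + ((c'.pos M.out + 2 ^ j).toNat : ℤ) = c'.pos M.out := by
      rw [Int.toNat_of_nonneg (by omega)]
      ring
    have hlt : (c'.pos M.out + 2 ^ j).toNat < 3 * 2 ^ j - 1 := by omega
    refine ⟨_, List.mem_range.2 hlt, (hterm _ hlt).2 ?_⟩
    rw [hi]
    exact ⟨rfl, h3, h4⟩

end Simulation

end

section

/-! ### Descriptions of circuits -/

/-- The description of a number. -/
def natStr (n : ℕ) : List Bool := dbl n.bits

/-- The description of the gate with a given code. -/
def gateStr (g : ℕ × ℕ × ℕ) : List Bool :=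
  match g.1 with
  | 0 => true :: false :: false :: natStr g.2.1
  | 1 => true :: false :: true :: natStr g.2.1
  | 2 => true :: true :: false :: (natStr g.2.1 ++ natStr g.2.2)
  | _ => true :: true :: true :: (natStr g.2.1 ++ natStr g.2.2)

theorem decodeNat_natStr (n : ℕ) (l : List Bool) : decodeNat (natStr n ++ l) = some (n, l) := by
  induction n using Nat.binaryRec' with
  | zero => rfl
  | bit b n h ih =>
    rw [natStr, Nat.bits_append_bit n b h]
    have : dbl (b :: n.bits) ++ l = true :: b :: (dbl n.bits ++ l) := rfl
    rw [this, decodeNat]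
    rw [natStr] at ih
    rw [ih]
    rfl

theorem decodeGate_gateStr (g : ℕ × ℕ × ℕ) (l : List Bool) :
    decodeGate (gateStr g ++ l) = some (Instr.toGate g, l) := by
  obtain ⟨op, j, k⟩ := g
  rcases op with _ | _ | _ | op <;>
    simp [gateStr, decodeGate, Instr.toGate, decodeNat_natStr, decodeNat₂, List.append_assoc]

theorem decodeGates_append (G : List (ℕ × ℕ × ℕ)) (s : ℕ) (l : List Bool) :
    decodeGates (G.length + s) (G.flatMap gateStr ++ l) = G.map Instr.toGate ++ decodeGates s l := by
  induction G with
  | nil => simp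
  | cons g G ih =>
    rw [List.length_cons, show G.length + 1 + s = G.length + s + 1 by ring, decodeGates,
      List.flatMap_cons, List.append_assoc, decodeGate_gateStr]
    simp [ih]

/-- No gate description begins with `false`, so decoding stops at the padding. -/
theorem decodeGates_replicate (s m : ℕ) : decodeGates s (List.replicate m false) = [] := by
  rcases s with _ | s
  · rfl
  · rcases m with _ | m <;> rfl

/-- Fill up with zeros to length `N`. -/
def padTo (N : ℕ) (l : List Bool) : List Bool :=
  -- The second case only keeps the length correct; in the reduction it does not occur for large
  -- `n`.
  if l.length ≤ N then l ++ List.replicate (N - l.length) false else List.replicate N false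

@[simp] theorem length_padTo (N : ℕ) (l : List Bool) : (padTo N l).length = N := by
  rw [padTo]
  split_ifs
  · simp; omega
  · simp

theorem length_gateStr_pos (g : ℕ × ℕ × ℕ) : 1 ≤ (gateStr g).length := by
  obtain ⟨op, j, k⟩ := g
  rcases op with _ | _ | _ | op <;> simp [gateStr]

theorem decodeCircuit_padTo {N : ℕ} {G : List (ℕ × ℕ × ℕ)}
    (h : (G.flatMap gateStr).length ≤ N) :
    decodeCircuit (padTo N (G.flatMap gateStr)) = G.map Instr.toGate := by
  -- The decoder reads at most as many gates as the string has bits. This is enough, because every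
  -- gate takes at least one bit.
  have hG : G.length ≤ (G.flatMap gateStr).length := by
    clear h
    induction G with
    | nil => simp
    | cons g G ih =>
      have := length_gateStr_pos g
      simp only [List.length_cons, List.flatMap_cons, List.length_append]
      omega
  rw [decodeCircuit, length_padTo, padTo, if_pos h,
    show N = G.length + (N - G.length) by omega, decodeGates_append]
  rw [show G.length + (N - G.length) - (List.flatMap gateStr G).length =
    N - (G.flatMap gateStr).length by omega, decodeGates_replicate, List.append_nil]

theorem length_natStr (n : ℕ) : (natStr n).length = 2 * n.size + 1 := by
  rw [natStr, length_dbl, Nat.size_eq_bits_len]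

theorem length_gateStr_le {N : ℕ} {g : ℕ × ℕ × ℕ} (h : g.2.1 ≤ N) (h' : g.2.2 ≤ N) :
    (gateStr g).length ≤ 4 * N.size + 5 := by
  have h1 := Nat.size_le_size h
  have h2 := Nat.size_le_size h'
  obtain ⟨op, j, k⟩ := g
  rcases op with _ | _ | _ | op <;>
    simp only [gateStr, List.length_cons, List.length_append, length_natStr] at h1 h2 ⊢ <;> omega

theorem Instr.codes_le {q : List Instr} {g : ℕ × ℕ × ℕ} (hg : g ∈ Instr.codes q) :
    g.2.1 ≤ q.length ∧ g.2.2 ≤ q.length := by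
  induction q with
  | nil => simp [codes] at hg
  | cons I q ih =>
    rw [codes, List.mem_append, List.mem_singleton] at hg
    rw [List.length_cons]
    rcases hg with hg | rfl
    · have := ih hg
      omega
    · rw [gateCode]
      have h1 := lookup_le I.2.2.1 q
      have h2 := lookup_le I.2.2.2 q
      have h3 := reads_le q
      split_ifs
      · exact ⟨by dsimp; omega, by dsimp; omega⟩
      · exact ⟨by dsimp; omega, by dsimp; omega⟩

/-- References are bounded by the number of instructions, so a gate takes logarithmically many bits.
-/
theorem length_flatMap_gateStr_codes (q : List Instr) :
    ((Instr.codes q).flatMap gateStr).length ≤ q.length * (4 * q.length.size + 5) := by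
  have h : ∀ G : List (ℕ × ℕ × ℕ), (∀ g ∈ G, (gateStr g).length ≤ 4 * q.length.size + 5) →
      (G.flatMap gateStr).length ≤ G.length * (4 * q.length.size + 5) := by
    intro G hG
    induction G with
    | nil => simp
    | cons g G ih =>
      have h1 := hG g (by simp)
      have h2 := ih fun g hg => hG g (by simp [hg])
      rw [List.flatMap_cons, List.length_append, List.length_cons, Nat.add_mul, Nat.one_mul]
      omega
  have := h (Instr.codes q) fun g hg =>
    length_gateStr_le (Instr.codes_le hg).1 (Instr.codes_le hg).2
  rwa [Instr.length_codes] at this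

end

section

open Enc

namespace PT

variable {α β γ σ : Type} [Enc α] [Enc β] [Enc γ] [Enc σ]

/-! ### The binary expansion of a number -/

/-- Numbers are in unary, so `n` is halved by counting up to it while tracking quotient and
remainder. -/
theorem boddDiv2 : PT fun n : ℕ => (n.div2, n.bodd) := by
  have h : ∀ i, (fun q : ℕ × Bool => (bif q.2 then q.1 + 1 else q.1, !q.2))^[i] (0, false) =
      (i.div2, i.bodd) := by
    intro i
    induction i with
    | zero => rfl
    | succ i ih => rw [Function.iterate_succ_apply', ih, Nat.div2_succ, Nat.bodd_succ]
  have := natIterate (c := fun n : ℕ => n) (s := fun _ : ℕ => (0, false))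
    (f := fun _ q => (bif q.2 then q.1 + 1 else q.1, !q.2)) id (const _)
    (cond (by fun_prop) (by fun_prop) (by fun_prop) |>.prodMk (by fun_prop))
    (2 * Polynomial.X + 2) ?_
  · simpa only [h] using this
  · intro n i hi
    have h1 := size_bool i.bodd
    have h2 : i.div2 ≤ i := by rw [Nat.div2_val]; exact Nat.div_le_self _ _
    simp only [h, size_prod, size_nat, Polynomial.eval_add, Polynomial.eval_mul,
      Polynomial.eval_ofNat, Polynomial.eval_X]
    omega

/-- Bits are split off by repeated halving. As every halving decreases a positive number, `n` passes
suffice; surplus ones find the number `0`. -/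
theorem bits {f : α → ℕ} (hf : PT f) : PT fun a => Str.mk (f a).bits := by
  refine comp (g := fun n : ℕ => Str.mk n.bits) ?_ hf
  let F : ℕ × Str → ℕ × Str := fun q =>
    if q.1 ≤ 0 then q else (q.1.div2, ⟨q.2.bits ++ (Str.mk [q.1.bodd]).bits⟩)
  have h1 : PT fun b : Bool => Str.mk [b] := by
    have := cond (c := fun b : Bool => b) id (const (Str.mk [true])) (const (Str.mk [false]))
    convert this using 2 with b
    cases b <;> rfl
  have hF : PT F := by
    refine ite (by fun_prop) (by fun_prop) (prodMk ?_ (strAppend (by fun_prop) ?_))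
    · exact boddDiv2.fst.comp (f := fun q : ℕ × Str => q.1) (by fun_prop)
    · exact h1.comp (boddDiv2.snd.comp (f := fun q : ℕ × Str => q.1) (by fun_prop))
  have hit : ∀ n i, (F^[i] (n, ⟨[]⟩)).2.bits ++ (F^[i] (n, ⟨[]⟩)).1.bits = n.bits ∧
      (F^[i] (n, ⟨[]⟩)).1 ≤ n - i := by
    intro n i
    induction i with
    | zero => simp
    | succ i ih =>
      rw [Function.iterate_succ_apply']
      generalize F^[i] (n, ⟨[]⟩) = q at ih
      obtain ⟨m, acc⟩ := q
      simp only [F]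
      split_ifs with hm
      · have : m = 0 := by omega
        exact ⟨ih.1, by dsimp; omega⟩
      · have hb : m.bits = m.bodd :: m.div2.bits := by
          conv_lhs => rw [← Nat.bit_bodd_div2 m]
          refine Nat.bits_append_bit _ _ fun h => ?_
          have := Nat.bodd_add_div2 m
          rw [h] at this
          cases hb : m.bodd
          · rw [hb] at this
            simp at this
            omega
          · rfl
        refine ⟨?_, ?_⟩
        · rw [← ih.1, hb]
          simp
        · have h2 : m.div2 < m := by
            rw [Nat.div2_val]
            exact Nat.div_lt_self (by omega) (by norm_num)
          have := ih.2
          dsimp at this ⊢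
          omega
  have := natIterate (c := fun n : ℕ => n) (s := fun n : ℕ => (n, Str.mk []))
    (f := fun _ => F) id (by fun_prop) (hF.comp snd')
    (3 * Polynomial.X + 1) ?_
  · convert this.snd using 2 with n
    obtain ⟨h1, h2⟩ := hit n n
    have h3 : (F^[n] (n, ⟨[]⟩)).1 = 0 := by omega
    rw [h3] at h1
    simp only [Nat.zero_bits, List.append_nil] at h1
    rw [← h1]
  · intro n i _
    obtain ⟨h1, h2⟩ := hit n i
    have h3 := congrArg List.length h1
    have h4 : n.size ≤ n := Nat.size_le.2 Nat.lt_two_pow_self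
    rw [List.length_append, Nat.size_eq_bits_len n] at h3
    simp only [size_prod, size_nat, size_str, Polynomial.eval_add, Polynomial.eval_mul,
      Polynomial.eval_ofNat, Polynomial.eval_X, Polynomial.eval_one]
    omega

theorem natStr {f : α → ℕ} (hf : PT f) : PT fun a => Str.mk (natStr (f a)) := by
  refine of_enc_eq ((bits hf).prodMk (const ())) fun a => ?_
  simp [enc, _root_.natStr]

theorem gateStr {g : α → ℕ × ℕ × ℕ} (hg : PT g) : PT fun a => Str.mk (gateStr (g a)) := by
  have h : PT fun g : ℕ × ℕ × ℕ => if g.1 ≤ 0 then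
      Str.mk (true :: false :: false :: _root_.natStr g.2.1) else if g.1 ≤ 1 then
      Str.mk (true :: false :: true :: _root_.natStr g.2.1) else if g.1 ≤ 2 then
      Str.mk (true :: true :: false :: (_root_.natStr g.2.1 ++ _root_.natStr g.2.2)) else
      Str.mk (true :: true :: true :: (_root_.natStr g.2.1 ++ _root_.natStr g.2.2)) := by
    have h1 : PT fun g : ℕ × ℕ × ℕ => Str.mk (_root_.natStr g.2.1) := natStr (by fun_prop)
    have h2 : PT fun g : ℕ × ℕ × ℕ => Str.mk (_root_.natStr g.2.2) := natStr (by fun_prop)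
    exact ite (by fun_prop) (((h1.strCons false).strCons false).strCons true)
      (ite (by fun_prop) (((h1.strCons true).strCons false).strCons true)
      (ite (by fun_prop) ((((h1.strAppend h2).strCons false).strCons true).strCons true)
        ((((h1.strAppend h2).strCons true).strCons true).strCons true)))
  have h' := h.comp hg
  convert h' using 2 with a
  obtain ⟨op, j, k⟩ := g a
  rcases op with _ | _ | _ | op <;> simp [_root_.gateStr]

theorem replicateFalse {f : α → ℕ} (hf : PT f) : PT fun a => Str.mk (List.replicate (f a) false) := by
  have := strFlatten (map (g := fun _ _ => Str.mk [false]) (range hf) (const _))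
  convert this using 2 with a
  induction f a with
  | zero => rfl
  | succ n ih =>
    rw [List.range_succ, List.map_append, List.flatMap_append, List.replicate_succ', Str.mk.injEq,
      Str.mk.inj ih]
    rfl

theorem strLength {s : α → Str} (hs : PT s) : PT fun a => (s a).bits.length := (toList hs).length

theorem padTo {f : α → ℕ} {s : α → Str} (hf : PT f) (hs : PT s) :
    PT fun a => Str.mk (padTo (f a) (s a).bits) := by
  have hl := strLength hs
  have := ite (hl.decide_le hf) (hs.strAppend (replicateFalse (hf.sub hl))) (replicateFalse hf)
  convert this using 2 with a
  rw [_root_.padTo]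
  split_ifs <;> rfl

/-! ### The gates of a program -/

theorem decide_addr_eq {f g : α → Addr} (hf : PT f) (hg : PT g) :
    PT fun a => decide (f a = g a) := by
  have := (hf.fst.decide_eq hg.fst).and ((hf.snd.fst.decide_eq hg.snd.fst).and
    ((hf.snd.snd.fst.decide_eq hg.snd.snd.fst).and (hf.snd.snd.snd.decide_eq hg.snd.snd.snd)))
  convert this using 2 with a
  rw [← Bool.decide_and, ← Bool.decide_and, ← Bool.decide_and, decide_eq_decide]
  simp only [Prod.ext_iff]

/-- By `Instr.lookup_cons`, one scan suffices that maintains the number of instructions seen so far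
and the current value. -/
theorem lookup {f : α → Addr} {q : α → List Instr} (hf : PT f) (hq : PT q) :
    PT fun a => Instr.lookup (f a) (q a) := by
  let F : α → ℕ × ℕ → Instr → ℕ × ℕ := fun a s I =>
    (s.1 + 1, if I.2.1 = f a then s.1 else if s.2 = s.1 then s.1 + 1 else s.2)
  have h : ∀ a (l : List Instr), l.foldl (F a) (0, 0) = (l.length, Instr.lookup (f a) l.reverse) := by
    intro a l
    induction l using List.reverseRecOn with
    | nil => rfl
    | append_singleton l I ih =>
      rw [List.foldl_append, ih, List.reverse_append, List.reverse_singleton,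
        List.singleton_append, Instr.lookup_cons]
      simp [F]
  obtain ⟨p, hp⟩ := hq.bound
  have := foldl (l := fun a => (q a).reverse) (s := fun _ => (0, 0)) (f := F) hq.reverse (const _)
    ?_ (3 * p + 1) ?_
  · convert this.snd using 2 with a
    rw [h, List.reverse_reverse]
  · refine prodMk (by fun_prop) (ite (decide_addr_eq (by fun_prop) ?_) (by fun_prop)
      (ite (by fun_prop) (by fun_prop) (by fun_prop)))
    exact comp hf (f := fun q : α × (ℕ × ℕ) × Instr => q.1) (by fun_prop)
  · intro a l' hl'
    have h1 := Instr.lookup_le (f a) l'.reverse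
    have h2 := hl'.length_le
    have h3 := hp a
    have h4 := length_le_size (q a)
    rw [h]
    rw [List.length_reverse] at h1 h2
    simp only [size_prod, size_nat, Polynomial.eval_add, Polynomial.eval_mul,
      Polynomial.eval_ofNat, Polynomial.eval_one]
    omega

theorem gateCode : PT fun u : Instr × List Instr => Instr.gateCode u.1 u.2 := by
  have hr : PT fun u : Instr × List Instr => Instr.reads u.2 :=
    length (filter (g := fun _ (I : Instr) => decide (I.1 = 0)) (by fun_prop) (by fun_prop))
  have h := ite (P := fun u : Instr × List Instr => u.1.1 = 0) (by fun_prop)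
    ((const 0).prodMk (hr.prodMk (const 0)))
    ((by fun_prop : PT fun u : Instr × List Instr => u.1.1).prodMk
      ((lookup (f := fun u : Instr × List Instr => u.1.2.2.1) (q := fun u => u.2)
        (by fun_prop) (by fun_prop)).prodMk (lookup
        (f := fun u : Instr × List Instr => u.1.2.2.2) (q := fun u => u.2)
        (by fun_prop) (by fun_prop))))
  exact h

/-- The fold carries the reversed list of the instructions already treated, to which `gateCode`
refers. -/
theorem codes {P : α → List Instr} (hP : PT P) : PT fun a => Instr.codes (P a).reverse := by
  let F : List Instr × List (ℕ × ℕ × ℕ) → Instr → List Instr × List (ℕ × ℕ × ℕ) := fun s I =>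
    (I :: s.1, s.2 ++ [Instr.gateCode I s.1])
  have h : ∀ l : List Instr, l.foldl F ([], []) = (l.reverse, Instr.codes l.reverse) := by
    intro l
    induction l using List.reverseRecOn with
    | nil => rfl
    | append_singleton l I ih => rw [List.foldl_append, ih, List.reverse_append]; rfl
  have hsr : ∀ l : List Instr, size l.reverse = size l := by
    intro l
    induction l with
    | nil => rfl
    | cons I l ih => simp [ih]; omega
  -- The operation of a gate is copied from the program and needs a bound of its own; the references
  -- are bounded by `Instr.codes_le`.
  have hop : ∀ q : List Instr, ∀ g ∈ Instr.codes q, g.1 ≤ size q := by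
    intro q
    induction q with
    | nil => simp [Instr.codes]
    | cons I q ih =>
      intro g hg
      rw [Instr.codes, List.mem_append, List.mem_singleton] at hg
      rw [size_cons]
      rcases hg with hg | rfl
      · have := ih g hg
        omega
      · rw [Instr.gateCode]
        split_ifs
        · simp
        · simp only [size_prod, size_nat]
          omega
  obtain ⟨p, hp⟩ := hP.bound
  have := foldl (s := fun _ => ([], [])) (f := fun _ => F) hP (const _)
    ?_ (2 * p + 1 + p * (2 * (5 * p + 2) + 1)) ?_
  · convert this.snd using 2 with a
    rw [h]
  · refine prodMk (by fun_prop) (append (by fun_prop) (cons ?_ (const _)))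
    exact comp gateCode (f := fun q : α × (List Instr × List (ℕ × ℕ × ℕ)) × Instr =>
      (q.2.2, q.2.1.1)) (by fun_prop)
  · rintro a l' ⟨l'', hl⟩
    have h3 := hp a
    rw [← hl, size_append] at h3
    have h5 := length_le_size l'
    have h4 := size_le_of_forall (l := Instr.codes l'.reverse) (m := 5 * p.eval (size a) + 2) (by
      intro g hg
      have h1 := hop _ g hg
      have h2 := Instr.codes_le hg
      rw [List.length_reverse] at h2
      rw [hsr] at h1
      simp only [size_prod, size_nat]
      omega)
    rw [Instr.length_codes, List.length_reverse] at h4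
    have h6 : l'.length * (2 * (5 * p.eval (size a) + 2) + 1) ≤
      p.eval (size a) * (2 * (5 * p.eval (size a) + 2) + 1) := Nat.mul_le_mul_right _ (by omega)
    rw [h, size_prod, hsr]
    simp only [Polynomial.eval_add, Polynomial.eval_mul, Polynomial.eval_ofNat,
      Polynomial.eval_one]
    omega

theorem circuitStr {P : α → List Instr} (hP : PT P) :
    PT fun a => Str.mk ((Instr.codes (P a).reverse).flatMap _root_.gateStr) := by
  have := strFlatten (map (g := fun _ g => Str.mk (_root_.gateStr g)) (codes hP)
    (gateStr (by fun_prop)))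
  convert this using 2 with a
  rw [List.flatMap_map]

end PT

end

section

open Enc ProbTM

variable {α β γ σ : Type} [Enc α] [Enc β] [Enc γ] [Enc σ]

/-! ### The computation of programs -/

/-- The instructions for the expression are computable in polynomial time. -/
def PTExpr (e : α → BExpr) : Prop := ∀ k, PT fun a => (e a).compile k

/-- The instructions for the items are computable in polynomial time. -/
def PTItems (l : α → List Item) : Prop := PT fun a => (l a).flatMap Item.compile

namespace PTExpr

theorem var {f : α → Addr} (hf : PT f) : PTExpr fun a => .var (f a) := fun k => by
  simp only [BExpr.compile]
  fun_prop

theorem not {e : α → BExpr} (he : PTExpr e) : PTExpr fun a => .not (e a) := fun k =>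
  (he k).append (PT.const _)

theorem and {e f : α → BExpr} (he : PTExpr e) (hf : PTExpr f) : PTExpr fun a => .and (e a) (f a) :=
  fun k => (he k).append ((hf (k + 1)).append (PT.const _))

theorem or {e f : α → BExpr} (he : PTExpr e) (hf : PTExpr f) : PTExpr fun a => .or (e a) (f a) :=
  fun k => (he k).append ((hf (k + 1)).append (PT.const _))

theorem const (e : BExpr) : PTExpr fun _ : α => e := fun _ => PT.const _

theorem item {t : α → Addr} {e : α → BExpr} (he : PTExpr e) (ht : PT t) :
    PT fun a => Item.compile (t a, some (e a)) := by
  have := he 0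
  simp only [Item.compile]
  fun_prop

end PTExpr

namespace PTItems

theorem nil : PTItems fun _ : α => [] := PT.const _

theorem cons {t : α → Addr} {e : α → BExpr} {l : α → List Item} (ht : PT t) (he : PTExpr e)
    (hl : PTItems l) : PTItems fun a => (t a, some (e a)) :: l a :=
  (he.item ht).append hl

theorem append {l l' : α → List Item} (hl : PTItems l) (hl' : PTItems l') :
    PTItems fun a => l a ++ l' a := by
  simp only [PTItems, List.flatMap_append]
  exact PT.append hl hl'

theorem map {l : α → List β} {t : α → β → Addr} {e : α → β → BExpr} (hl : PT l)
    (ht : PT fun q : α × β => t q.1 q.2) (he : PTExpr fun q : α × β => e q.1 q.2) :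
    PTItems fun a => (l a).map fun b => (t a b, some (e a b)) := by
  simp only [PTItems, List.flatMap_map]
  exact PT.flatMap hl (he.item ht)

/-- Loops over tapes, blocks or kinds of bits have a fixed range for a given machine. They are
unrolled, so the index type needs no description. -/
theorem flatMap_const {κ : Type} (K : List κ) {g : κ → α → List Item} (h : ∀ k ∈ K, PTItems (g k)) :
    PTItems fun a => K.flatMap fun k => g k a := by
  induction K with
  | nil => exact nil
  | cons k K ih => exact (h k (by simp)).append (ih fun k' hk' => h k' (by simp [hk']))

end PTItems

variable {M : ProbTM}

theorem map_cells {δ : Type} (w : ℕ) (f : M.K × ℕ × ℕ → δ) : (cells M w).map f =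
    (tapes M).flatMap fun k => [0, 1, 2].flatMap fun φ => (List.range (3 * w)).map fun i =>
      f (k, φ, i) := by
  simp [cells, List.product, List.map_flatMap, Function.comp_def]

theorem ptItems_selItems : PTItems fun q : ℕ × ℕ => selItems M q.1 q.2 := by
  refine PTItems.flatMap_const _ fun x _ => ?_
  refine .cons (by fun_prop) (.const _) ?_
  exact .map (by fun_prop) (by fun_prop) ((PTExpr.var (by fun_prop)).or (.var (by fun_prop)))

theorem ptItems_loadItems : PTItems fun q : ℕ × ℕ => loadItems M q.1 q.2 := by
  simp only [loadItems, map_cells, loadItem]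
  refine PTItems.flatMap_const _ fun k _ => PTItems.flatMap_const _ fun f _ => ?_
  have h : ∀ b, PTExpr fun u : (ℕ × ℕ) × ℕ => loadTerm u.1.1 u.1.2 f u.2 k b := fun b =>
    (PTExpr.var (by fun_prop)).and (.var (by fun_prop))
  exact .map (by fun_prop) (by fun_prop) (((h 1).or (h 2)).or ((h 3).or (h 4)))

theorem ptItems_storeItems (B : List ℕ) : PTItems fun q : ℕ × ℕ => storeItems M q.1 q.2 B := by
  simp only [storeItems, map_cells, storeItem]
  refine PTItems.flatMap_const _ fun b _ => PTItems.flatMap_const _ fun k _ =>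
    PTItems.flatMap_const _ fun f _ => ?_
  exact .map (by fun_prop) (by fun_prop) (((PTExpr.var (by fun_prop)).and (.var (by fun_prop))).or
    ((PTExpr.var (by fun_prop)).not.and (.var (by fun_prop))))

theorem PTItems.comp {l : β → List Item} (hl : PTItems l) {f : α → β} (hf : PT f) :
    PTItems fun a => l (f a) :=
  PT.comp (g := fun b => (l b).flatMap Item.compile) hl hf

theorem ptItems_acceptItems : PTItems fun q : ℕ × ℕ => (accAddr, some BExpr.false') ::
    (List.range (3 * q.2 - 1)).map fun i =>
      ((accAddr, some (.or (.var accAddr) (acceptTerm M q.1 i))) : Item) := by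
  refine .cons (by fun_prop) (.const _) ?_
  refine .map (by fun_prop) (by fun_prop) ((PTExpr.const _).or ?_)
  exact ((PTExpr.var (by fun_prop)).and (.var (by fun_prop))).and
    ((PTExpr.var (by fun_prop)).and (PTExpr.var (by fun_prop)).not)

theorem PT.getBit : PT fun q : Str × ℕ => q.1.bits.getD q.2 false := by
  let F : Option (Bool × Str) → Option (Bool × Str) := fun o => o.elim none fun u => PT.strUncons u.2
  have hF : PT F := PT.optionElim (by fun_prop) (by fun_prop) (by fun_prop)
  have h : ∀ (l : List Bool) (i : ℕ), F^[i] (PT.strUncons ⟨l⟩) = PT.strUncons ⟨l.drop i⟩ := by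
    intro l i
    induction i with
    | zero => rfl
    | succ i ih =>
      rw [Function.iterate_succ_apply', ih]
      simp only [F, PT.strUncons]
      rcases hd : l.drop i with _ | ⟨b, l'⟩
      · have : l.drop (i + 1) = [] := by
          rw [List.drop_eq_nil_iff] at hd ⊢
          omega
        simp [this]
      · have : l.drop (i + 1) = l' := by
          rw [← List.tail_drop, hd]
          rfl
        simp [this]
  have := PT.natIterate (c := fun q : Str × ℕ => q.2) (s := fun q => PT.strUncons q.1)
    (f := fun _ => F) (by fun_prop) (by fun_prop) (hF.comp PT.snd') (Polynomial.X + 4) ?_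
  · have h2 := this.optionElim (f := fun _ => false) (g := fun _ u => u.1) (by fun_prop)
      (by fun_prop)
    convert h2 using 2 with q
    obtain ⟨⟨l⟩, i⟩ := q
    rw [h]
    simp only [PT.strUncons]
    rcases hd : l.drop i with _ | ⟨b, l'⟩
    · rw [List.drop_eq_nil_iff] at hd
      simp [List.getElem?_eq_none hd]
    · have : l[i]? = Option.some b := by
        rw [← List.head?_drop, hd]
        rfl
      simp [this]
  · rintro ⟨⟨l⟩, n⟩ i _
    rw [h]
    have h1 : (l.drop i).length ≤ l.length := by simp
    simp only [PT.strUncons]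
    rcases hd : l.drop i with _ | ⟨b, l'⟩
    · simp [size, enc]
    · have h2 : size (Option.some (b, Str.mk l')) = 1 + size (b, Str.mk l') := by
        simp [size, enc]
        omega
      have h3 := size_bool b
      rw [hd] at h1
      simp only [List.length_cons, h2, size_prod, size_str, Polynomial.eval_add, size_nat,
        Polynomial.eval_ofNat, Polynomial.eval_X] at h1 ⊢
      omega

-- The power `2 ^ f a` is supplied as a function `g` that is known to be in `PT`, since
-- exponentiation of unary numbers is not polynomial in general.
variable (M) in
theorem ptItems_initCells {f g : α → ℕ} {x : α → Str} (hf : PT f) (hg : PT g) (hx : PT x)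
    (h : ∀ a, g a = 2 ^ f a) :
    PTItems fun a => (initCells M (f a) (x a).bits).map fun b => (b, some .true') := by
  have key : PTItems fun q : (ℕ × ℕ) × Str =>
      (stA M.start :: ((tapes M).map (cellA 2 q.1.1 q.1.2) ++
      ((List.range q.2.bits.length).map (fun i => cellA 0 q.1.1 (q.1.2 + i) M.inp) ++
      ((List.range q.2.bits.length).filter fun i => q.2.bits.getD i false).map
        fun i => cellA 1 q.1.1 (q.1.2 + i) M.inp))).map fun b => ((b, some .true') : Item) := by
    simp only [List.map_append, List.map_cons, List.map_map, Function.comp_def]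
    have hlen : PT fun q : (ℕ × ℕ) × Str => q.2.bits.length :=
      PT.strLength (s := fun q : (ℕ × ℕ) × Str => q.2) (by fun_prop)
    refine .cons (by fun_prop) (.const _) (.append ?_ (.append ?_ ?_))
    · have : ∀ q : (ℕ × ℕ) × Str, ((tapes M).map fun k =>
          ((cellA 2 q.1.1 q.1.2 k, some .true') : Item)) =
          (tapes M).flatMap fun k => [(cellA 2 q.1.1 q.1.2 k, some .true')] :=
        fun q => List.map_eq_flatMap
      simp only [this]
      exact .flatMap_const _ fun k _ => .cons (by fun_prop) (.const _) .nil
    · exact .map hlen.range (by fun_prop) (.const _)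
    · refine .map (PT.filter hlen.range ?_) (by fun_prop) (.const _)
      exact PT.getBit.comp (f := fun q : ((ℕ × ℕ) × Str) × ℕ => (q.1.2, q.2)) (by fun_prop)
  have := key.comp ((hf.prodMk hg).prodMk hx)
  simp only [h] at this
  exact this

/-- The auxiliary items of the program at level `j + 1`. -/
theorem exists_polynomial_size_simItems (base : List Item) : ∃ p : Polynomial ℕ, ∀ j,
    size ((simItems M base j).flatMap Item.compile) ≤ p.eval (2 ^ j) := by
  obtain ⟨p₁, h₁⟩ := (ptItems_selItems (M := M)).bound
  obtain ⟨p₂, h₂⟩ := (ptItems_loadItems (M := M)).bound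
  obtain ⟨p₃, h₃⟩ := (ptItems_storeItems (M := M) [1, 2, 3, 4]).bound
  set q := p₁ + p₂ + p₃ with hq
  set s₀ := size (base.flatMap Item.compile)
  -- This solves the recurrence `s (j + 1) ≤ 2 * (s j + Q)`, where `Q` bounds what is needed for
  -- selecting, loading and storing.
  have key : ∀ j, size ((simItems M base j).flatMap Item.compile) ≤
      2 ^ j * (s₀ + j * q.eval (5 * 2 ^ j)) := by
    intro j
    induction j with
    | zero => simp [simItems, s₀]
    | succ j ih =>
      have hj : j < 2 ^ j := Nat.lt_two_pow_self
      have b₁ := (h₁ (j + 1, 2 ^ j)).trans (p₁.eval_mono_nat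
        (show _ ≤ 5 * 2 ^ (j + 1) by simp only [size_prod, size_nat, pow_succ]; omega))
      have b₂ := (h₂ (j, 2 ^ j)).trans (p₂.eval_mono_nat
        (show _ ≤ 5 * 2 ^ (j + 1) by simp only [size_prod, size_nat, pow_succ]; omega))
      have b₃ := (h₃ (j, 2 ^ j)).trans (p₃.eval_mono_nat
        (show _ ≤ 5 * 2 ^ (j + 1) by simp only [size_prod, size_nat, pow_succ]; omega))
      have hm : q.eval (5 * 2 ^ j) ≤ q.eval (5 * 2 ^ (j + 1)) :=
        q.eval_mono_nat (by rw [pow_succ]; omega)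
      have hqe : q.eval (5 * 2 ^ (j + 1)) = p₁.eval (5 * 2 ^ (j + 1)) +
        p₂.eval (5 * 2 ^ (j + 1)) + p₃.eval (5 * 2 ^ (j + 1)) := by simp [hq]
      simp only [simItems, List.flatMap_append, size_append] at ih ⊢
      generalize q.eval (5 * 2 ^ (j + 1)) = Q at *
      have h4 : j * q.eval (5 * 2 ^ j) ≤ j * Q := Nat.mul_le_mul_left _ hm
      have h5 : 2 ^ j * (s₀ + j * q.eval (5 * 2 ^ j)) ≤ 2 ^ j * (s₀ + j * Q) :=
        Nat.mul_le_mul_left _ (by omega)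
      have h6 : 2 ^ (j + 1) * (s₀ + (j + 1) * Q) = 2 * (2 ^ j * (s₀ + j * Q)) + 2 * (2 ^ j * Q) := by
        rw [pow_succ]; ring
      have h7 : Q ≤ 2 ^ j * Q := Nat.le_mul_of_pos_left _ (by positivity)
      rw [h6]
      dsimp only at b₁ b₂ b₃
      omega
  refine ⟨Polynomial.X * (Polynomial.C s₀ + Polynomial.X * q.comp (5 * Polynomial.X)), fun j => ?_⟩
  refine (key j).trans ?_
  simp only [Polynomial.eval_mul, Polynomial.eval_add, Polynomial.eval_comp, Polynomial.eval_X,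
    Polynomial.eval_C, Polynomial.eval_ofNat]
  gcongr
  exact Nat.lt_two_pow_self.le

/-- The program is built from the lowest level upwards, along with `j` and `2 ^ j`. By `hp` the
unary number `2 ^ j`, and hence the program, stays polynomial. -/
theorem pt_simItems (base : List Item) {K : α → ℕ} (hK : PT K) (p : Polynomial ℕ)
    (hp : ∀ a, 2 ^ K a ≤ p.eval (size a)) :
    PT (fun a => 2 ^ K a) ∧ PTItems fun a => simItems M base (K a) := by
  let F : ℕ × ℕ × List Instr → ℕ × ℕ × List Instr := fun q =>
    let W := (selItems M (q.1 + 1) q.2.1).flatMap Item.compile ++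
      (loadItems M q.1 q.2.1).flatMap Item.compile ++ q.2.2 ++
      (storeItems M q.1 q.2.1 [1, 2, 3, 4]).flatMap Item.compile
    (q.1 + 1, 2 * q.2.1, W ++ W)
  have hF : PT F := by
    have h1 := (ptItems_selItems (M := M)).comp
      (f := fun q : ℕ × ℕ × List Instr => (q.1 + 1, q.2.1)) (by fun_prop)
    have h2 := (ptItems_loadItems (M := M)).comp
      (f := fun q : ℕ × ℕ × List Instr => (q.1, q.2.1)) (by fun_prop)
    have h3 := (ptItems_storeItems (M := M) [1, 2, 3, 4]).comp
      (f := fun q : ℕ × ℕ × List Instr => (q.1, q.2.1)) (by fun_prop)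
    have hW := ((PT.append h1 h2).append (g := fun q : ℕ × ℕ × List Instr => q.2.2)
      (by fun_prop)).append h3
    exact PT.prodMk (by fun_prop) (PT.prodMk (by fun_prop) (hW.append hW))
  have hit : ∀ i, F^[i] (0, 1, base.flatMap Item.compile) =
      (i, 2 ^ i, (simItems M base i).flatMap Item.compile) := by
    intro i
    induction i with
    | zero => rfl
    | succ i ih =>
      rw [Function.iterate_succ_apply', ih]
      simp only [F, simItems, List.flatMap_append, pow_succ, mul_comm]
  obtain ⟨q, hq⟩ := exists_polynomial_size_simItems (M := M) base
  have := PT.natIterate (s := fun _ => (0, 1, base.flatMap Item.compile)) (f := fun _ => F) hK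
    (PT.const _) (hF.comp PT.snd') (4 * p + 2 + q.comp p) ?_
  · simp only [hit] at this
    exact ⟨this.snd.fst, this.snd.snd⟩
  · intro a i hi
    have h1 : 2 ^ i ≤ p.eval (size a) := (Nat.pow_le_pow_right (by norm_num) hi).trans (hp a)
    have h2 : i < 2 ^ i := Nat.lt_two_pow_self
    have h3 := (hq i).trans (q.eval_mono_nat h1)
    simp only [hit, size_prod, size_nat, Polynomial.eval_add, Polynomial.eval_mul,
      Polynomial.eval_ofNat, Polynomial.eval_comp]
    omega

theorem pt_acceptProgram (base : List Item) {K : α → ℕ} {x : α → Str} (hK : PT K) (hx : PT x)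
    (p : Polynomial ℕ) (hp : ∀ a, 2 ^ K a ≤ p.eval (size a)) :
    PT fun a => acceptProgram M base (K a) (x a).bits := by
  obtain ⟨h1, h2⟩ := pt_simItems (M := M) base hK p hp
  have h3 := ptItems_initCells M hK h1 hx fun _ => rfl
  have h4 := (ptItems_acceptItems (M := M)).comp (hK.prodMk h1)
  have h5 := (h3.append h2).append h4
  unfold acceptProgram acceptItems
  rw [PTItems] at h5
  exact PT.append h5 (PT.const _)

end

section

open ProbTM Filter

section Length

variable {M : ProbTM}

/-! ### The length of the program -/

theorem length_flatMap_compile {l : List Item} {b : ℕ} (h : ∀ x ∈ l, (Item.compile x).length ≤ b) :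
    (l.flatMap Item.compile).length ≤ b * l.length := by
  induction l with
  | nil => simp
  | cons x l ih =>
    have h1 := h x (by simp)
    have h2 := ih fun x hx => h x (by simp [hx])
    rw [List.flatMap_cons, List.length_append, List.length_cons, mul_add, mul_one]
    omega

theorem List.length_product_eq {α β : Type} (l : List α) (l' : List β) :
    (l.product l').length = l.length * l'.length := List.length_product l l'

theorem length_selItems (j w : ℕ) : ((selItems M j w).flatMap Item.compile).length ≤
    16 * (4 * (w + 1) * Fintype.card M.K) := by
  refine (length_flatMap_compile (b := 16) fun x hx => ?_).trans_eq ?_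
  · obtain ⟨⟨k, b⟩, -, hx⟩ := List.mem_flatMap.1 hx
    rcases List.mem_cons.1 hx with rfl | hx
    · simp [Item.compile, BExpr.compile]
    · obtain ⟨i, -, rfl⟩ := List.mem_map.1 hx
      simp [Item.compile, BExpr.compile]
  · simp [selItems, selItem, List.length_flatMap, tapes, List.length_product_eq]
    ring

theorem length_cells (w : ℕ) : (cells M w).length = 9 * w * Fintype.card M.K := by
  simp [cells, tapes, List.length_product_eq]
  ring

/-- The common bound `16` for one item is attained here, by eight variables, seven connectives and
the final assignment. -/
theorem length_loadItems (j w : ℕ) : ((loadItems M j w).flatMap Item.compile).length ≤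
    16 * (9 * w * Fintype.card M.K) := by
  refine (length_flatMap_compile (b := 16) fun x hx => ?_).trans_eq ?_
  · obtain ⟨y, -, rfl⟩ := List.mem_map.1 hx
    simp [Item.compile, BExpr.compile, loadItem, loadTerm]
  · rw [loadItems, List.length_map, length_cells]

theorem length_storeItems (j w : ℕ) (B : List ℕ) :
    ((storeItems M j w B).flatMap Item.compile).length ≤
      16 * (B.length * (9 * w * Fintype.card M.K)) := by
  refine (length_flatMap_compile (b := 16) fun x hx => ?_).trans_eq ?_
  · obtain ⟨b, -, hx⟩ := List.mem_flatMap.1 hx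
    obtain ⟨y, -, rfl⟩ := List.mem_map.1 hx
    simp [Item.compile, BExpr.compile, storeItem]
  · simp [storeItems, List.length_flatMap, length_cells]

/-- Per tape, with `w = 2 ^ j`, each half of the next level adds at most `8 * w` items for the
selectors, `9 * w` for loading and `36 * w` for storing, in all `53 * w`. As the lower level is used
twice, every level contributes the same multiple of `2 ^ j` to the total. -/
theorem length_simItems (base : List Item) (j : ℕ) :
    ((simItems M base j).flatMap Item.compile).length ≤
      2 ^ j * ((base.flatMap Item.compile).length + j * (16 * (53 * Fintype.card M.K))) := by
  induction j with
  | zero => simp [simItems]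
  | succ j ih =>
    have h1 := length_selItems (M := M) (j + 1) (2 ^ j)
    have h2 := length_loadItems (M := M) j (2 ^ j)
    have h3 := length_storeItems (M := M) j (2 ^ j) [1, 2, 3, 4]
    have h4 : 1 ≤ 2 ^ j := Nat.one_le_two_pow
    have h5 : Fintype.card M.K ≤ 2 ^ j * Fintype.card M.K := Nat.le_mul_of_pos_left _ h4
    simp only [simItems, List.flatMap_append, List.length_append, pow_succ] at ih ⊢
    simp only [List.length_cons, List.length_nil] at h3
    ring_nf at ih h1 h2 h3 h4 h5 ⊢
    omega

theorem exists_length_acceptProgram_le (base : List Item) : ∃ c : ℕ, ∀ (j : ℕ) (x : List Bool),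
    (acceptProgram M base j x).length ≤ c * ((j + 1) * 2 ^ j + x.length) := by
  refine ⟨(base.flatMap Item.compile).length + 16 * (53 * Fintype.card M.K) + 16 * 3 + 16 * 2 +
    16 * Fintype.card M.K + 18, fun j x => ?_⟩
  have h1 := length_simItems (M := M) base j
  have h2 : ((acceptItems M j).flatMap Item.compile).length ≤ 16 * (3 * 2 ^ j) := by
    have hp : 1 ≤ 2 ^ j := Nat.one_le_two_pow
    refine (length_flatMap_compile (b := 16) fun x hx => ?_).trans_eq ?_
    · rcases List.mem_cons.1 hx with rfl | hx
      · simp [Item.compile, BExpr.compile]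
      · obtain ⟨y, -, rfl⟩ := List.mem_map.1 hx
        simp [Item.compile, BExpr.compile, acceptTerm]
    · simp [acceptItems]
      omega
  have h3 : (((initCells M j x).map fun a => ((a, some .true') : Item)).flatMap
      Item.compile).length ≤ 16 * (1 + Fintype.card M.K + 2 * x.length) := by
    refine (length_flatMap_compile (b := 16) fun x hx => ?_).trans ?_
    · obtain ⟨y, -, rfl⟩ := List.mem_map.1 hx
      simp [Item.compile, BExpr.compile]
    · have := List.length_filter_le (fun i => x.getD i false) (List.range x.length)
      simp only [initCells, List.length_map, List.length_cons, List.length_append, List.length_range,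
        tapes, Finset.length_toList, Finset.card_univ] at this ⊢
      omega
  have hp : 1 ≤ 2 ^ j := Nat.one_le_two_pow
  have hK : Fintype.card M.K ≤ 2 ^ j * Fintype.card M.K := Nat.le_mul_of_pos_left _ hp
  rw [acceptProgram]
  simp only [List.flatMap_append, List.length_append, List.length_singleton]
  generalize 2 ^ j = w at *
  generalize Fintype.card M.K = κ at *
  generalize (base.flatMap Item.compile).length = b at *
  have e1 : w * (b + j * (16 * (53 * κ))) ≤ (b + 16 * (53 * κ)) * ((j + 1) * w) := by
    have : (b + 16 * (53 * κ)) * ((j + 1) * w) =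
      w * (b + j * (16 * (53 * κ))) + (b * j * w + 16 * 53 * κ * w) := by ring
    omega
  have e2 : w ≤ (j + 1) * w := Nat.le_mul_of_pos_left _ (by omega)
  have e3 : κ ≤ κ * ((j + 1) * w) := Nat.le_mul_of_pos_right _ (by positivity)
  generalize (j + 1) * w = W at *
  calc _ ≤ (b + 16 * (53 * κ)) * W + 16 * (3 * W) + 16 * 2 * x.length + 16 * (κ * W) + 18 * W := by
        omega
    _ ≤ _ := by
      ring_nf
      omega

end Length

/-! ### Logarithmic factors against the bound `n ^ (d + 1)` -/

section Asymptotics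

theorem Nat.size_mul_le (a b : ℕ) : (a * b).size ≤ a.size + b.size := by
  rw [Nat.size_le, pow_add]
  exact Nat.mul_lt_mul'' (Nat.lt_size_self a) (Nat.lt_size_self b)

theorem Nat.size_pow_le (a d : ℕ) : (a ^ d).size ≤ d * a.size + 1 := by
  rw [Nat.size_le, pow_succ, mul_comm d, pow_mul]
  have : a ^ d ≤ (2 ^ a.size) ^ d := Nat.pow_le_pow_left (Nat.lt_size_self a).le d
  have h : 0 < (2 ^ a.size) ^ d := by positivity
  omega

theorem Nat.two_pow_size_le {t : ℕ} (ht : 0 < t) : 2 ^ t.size ≤ 2 * t := by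
  have h1 : 0 < t.size := Nat.size_pos.2 ht
  have h2 : 2 ^ (t.size - 1) ≤ t := Nat.lt_size.1 (by omega)
  calc 2 ^ t.size = 2 ^ (t.size - 1 + 1) := by rw [Nat.sub_add_cancel h1]
    _ ≤ 2 * t := by rw [pow_succ]; omega

/-- In terms of `s = n.size` this is `s ^ 2 = o(2 ^ s)`. -/
theorem eventually_mul_size_sq_le (c : ℕ) : ∀ᶠ n : ℕ in atTop, c * n.size ^ 2 ≤ n := by
  have h := tendsto_pow_const_div_const_pow_of_one_lt 2 (r := (2 : ℝ)) (by norm_num)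
  have h1 : ∀ᶠ s : ℕ in atTop, (s : ℝ) ^ 2 / 2 ^ s < 1 / (2 * c + 1) :=
    h.eventually_lt_const (by positivity)
  obtain ⟨s₀, hs₀⟩ := eventually_atTop.1 h1
  filter_upwards [eventually_ge_atTop (2 ^ s₀)] with n hn
  have hn0 : 0 < n := lt_of_lt_of_le (by positivity) hn
  have h2 : s₀ ≤ n.size := (Nat.lt_size.2 hn).le
  have h3 := hs₀ _ h2
  rw [div_lt_div_iff₀ (by positivity) (by positivity), one_mul] at h3
  have h4 : n.size ^ 2 * (2 * c + 1) < 2 ^ n.size := by exact_mod_cast h3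
  have h5 := Nat.two_pow_size_le hn0
  nlinarith

/-- The level at which a machine that halts within `C * n ^ d + C` steps is simulated. -/
def simLevel (C d n : ℕ) : ℕ := (C * n ^ d + C + n + 1).size

theorem lt_two_pow_simLevel (C d n : ℕ) : C * n ^ d + C + n + 1 < 2 ^ simLevel C d n :=
  Nat.lt_size_self _

theorem one_le_simLevel (C d n : ℕ) : 1 ≤ simLevel C d n := Nat.size_pos.2 (by omega)

theorem two_pow_simLevel_le (C : ℕ) {d n : ℕ} (hd : 1 ≤ d) (hn : 1 ≤ n) :
    2 ^ simLevel C d n ≤ (4 * C + 4) * n ^ d := by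
  have h1 := Nat.two_pow_size_le (show 0 < C * n ^ d + C + n + 1 by omega)
  have h2 : n ≤ n ^ d := Nat.le_self_pow (by omega) n
  have h3 : C ≤ C * n ^ d := Nat.le_mul_of_pos_right _ (by positivity)
  rw [simLevel]
  calc _ ≤ _ := h1
    _ ≤ _ := by ring_nf at *; omega

theorem eventually_two_pow_simLevel_le (C : ℕ) {d : ℕ} (hd : 1 ≤ d) :
    ∀ᶠ n : ℕ in atTop, 2 ^ simLevel C d n ≤ n ^ (d + 1) := by
  filter_upwards [eventually_ge_atTop (4 * C + 4)] with n hn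
  refine (two_pow_simLevel_le C hd (by omega)).trans ?_
  rw [pow_succ, mul_comm]
  exact Nat.mul_le_mul_left _ hn

/-- There are `N = O(n ^ d * log n)` instructions, and a gate takes `O(log n)` bits. The additional
factor `n` absorbs both logarithms. -/
theorem eventually_gates_le (C c : ℕ) {d : ℕ} (hd : 1 ≤ d) : ∀ᶠ n : ℕ in atTop, ∀ N,
    N ≤ c * ((simLevel C d n + 1) * 2 ^ simLevel C d n + n) →
      N * (4 * N.size + 5) ≤ n ^ (d + 1) := by
  obtain ⟨a, ha⟩ : ∃ a, ∀ n ≥ 1, simLevel C d n + 1 ≤ a * n.size := by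
    refine ⟨(4 * C + 4).size + d + 2, fun n hn => ?_⟩
    have h1 : simLevel C d n ≤ ((4 * C + 4) * n ^ d).size := by
      refine Nat.size_le_size ?_
      have h2 : n ≤ n ^ d := Nat.le_self_pow (by omega) n
      have h3 : C ≤ C * n ^ d := Nat.le_mul_of_pos_right _ (by positivity)
      ring_nf at *
      omega
    have h2 := Nat.size_mul_le (4 * C + 4) (n ^ d)
    have h3 := Nat.size_pow_le n d
    have h4 : 1 ≤ n.size := Nat.size_pos.2 hn
    nlinarith [Nat.le_mul_of_pos_right ((4 * C + 4).size) h4]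
  set b := c * (a * (4 * C + 4) + 1) with hb
  filter_upwards [eventually_mul_size_sq_le (b * (4 * (b.size + (d + 2)) + 5)),
    eventually_ge_atTop 1] with n hn hn1 N hN
  have hs : 1 ≤ n.size := Nat.size_pos.2 hn1
  have hnd : n ≤ n ^ d := Nat.le_self_pow (by omega) n
  have h1 : N ≤ b * (n ^ d * n.size) := by
    refine hN.trans ?_
    rw [hb, mul_assoc]
    refine Nat.mul_le_mul_left _ ?_
    calc _ ≤ a * n.size * ((4 * C + 4) * n ^ d) + n ^ d * n.size :=
          add_le_add (Nat.mul_le_mul (ha n hn1) (two_pow_simLevel_le C hd hn1))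
            (hnd.trans (Nat.le_mul_of_pos_right _ hs))
      _ = _ := by ring
  have h2 : N.size ≤ (b.size + (d + 2)) * n.size := by
    have e1 := Nat.size_le_size h1
    have e2 := Nat.size_mul_le b (n ^ d * n.size)
    have e3 := Nat.size_mul_le (n ^ d) n.size
    have e4 := Nat.size_pow_le n d
    have e5 : n.size.size ≤ n.size := Nat.size_le.2 Nat.lt_two_pow_self
    nlinarith [Nat.le_mul_of_pos_right b.size hs]
  calc N * (4 * N.size + 5) ≤ b * (n ^ d * n.size) * (4 * ((b.size + (d + 2)) * n.size) +
        5 * n.size) := Nat.mul_le_mul h1 (by omega)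
    _ = n ^ d * (b * (4 * (b.size + (d + 2)) + 5) * n.size ^ 2) := by ring
    _ ≤ n ^ d * n := Nat.mul_le_mul_left _ hn
    _ = n ^ (d + 1) := (pow_succ _ _).symm

end Asymptotics

end

section

open ProbTM Filter

/-! ### Probabilities -/

section Prob

variable {α β : Type}

theorem prob_map (μ : PMF α) (f : α → β) (S : Set β) : prob (μ.map f) S = prob μ (f ⁻¹' S) := by
  rw [prob, prob, PMF.toOuterMeasure_map_apply]

theorem prob_congr {μ : PMF α} {S S' : Set α} (h : ∀ a ∈ μ.support, a ∈ S ↔ a ∈ S') :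
    prob μ S = prob μ S' := by
  rw [prob, prob, PMF.toOuterMeasure_apply_eq_of_inter_support_eq]
  ext a
  exact and_congr_left fun ha => h a ha

theorem prob_mono {μ : PMF α} {S S' : Set α} (h : ∀ a ∈ μ.support, a ∈ S → a ∈ S') :
    prob μ S ≤ prob μ S' := by
  have hfin : μ.toOuterMeasure S' ≠ ⊤ :=
    ((μ.toOuterMeasure_mono (Set.inter_subset_left.trans (Set.subset_univ S'))).trans_eq
      ((μ.toOuterMeasure_apply_eq_one_iff _).2 (Set.subset_univ _))).trans_lt ENNReal.one_lt_top |>.ne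
  exact ENNReal.toReal_mono hfin (μ.toOuterMeasure_mono fun a ha => h a ha.2 ha.1)

theorem prob_univ (μ : PMF α) : prob μ Set.univ = 1 := by
  rw [prob, (μ.toOuterMeasure_apply_eq_one_iff _).2 (Set.subset_univ _), ENNReal.toReal_one]

theorem prob_add_compl (μ : PMF α) (S : Set α) : prob μ S + prob μ Sᶜ = 1 := by
  let _ : MeasurableSpace α := ⊤
  have h : ∀ S, prob μ S = μ.toMeasure.real S := fun S => by
    rw [prob, MeasureTheory.measureReal_def, μ.toMeasure_apply_eq_toOuterMeasure_apply trivial]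
  rw [h, h]
  exact MeasureTheory.probReal_add_probReal_compl (s := S) trivial

/-- Two disjoint events. -/
theorem prob_add_le_one {μ : PMF α} {S S' : Set α} (h : ∀ a ∈ μ.support, a ∈ S → a ∉ S') :
    prob μ S + prob μ S' ≤ 1 := by
  rw [← prob_add_compl μ S']
  linarith [prob_mono (S := S) (S' := S'ᶜ) h]

theorem unifBits_zero : unifBits 0 = PMF.pure [] := by
  rw [unifBits, show (List.Vector.toList : List.Vector Bool 0 → List Bool) = Function.const _ [] by
    funext v; rw [v.eq_nil]; rfl, PMF.map_const]

theorem unifBits_apply (m : ℕ) (l : List Bool) :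
    unifBits m l = if l.length = m then ((2 : ENNReal) ^ m)⁻¹ else 0 := by
  rw [unifBits, PMF.map_apply]
  split_ifs with h
  · obtain ⟨v, rfl⟩ : ∃ v : List.Vector Bool m, v.toList = l := ⟨⟨l, h⟩, rfl⟩
    refine (tsum_eq_single v fun w hw => if_neg fun h' => ?_).trans ?_
    · exact hw (List.Vector.toList_injective h'.symm)
    · simp [PMF.uniformOfFintype_apply]
  · refine ENNReal.tsum_eq_zero.2 fun v => if_neg ?_
    rintro rfl
    exact h v.2

theorem unifBits_succ (m : ℕ) : unifBits (m + 1) =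
    (PMF.uniformOfFintype Bool).bind fun b => (unifBits m).map (List.cons b) := by
  have hcons : ∀ (b b' : Bool) (l : List Bool), (unifBits m).map (List.cons b) (b' :: l) =
      if b' = b then unifBits m l else 0 := by
    intro b b' l
    rw [PMF.map_apply, tsum_eq_single l]
    · simp
    · intro l' hl'
      rw [if_neg]
      simp [hl'.symm]
  ext l
  rw [PMF.bind_apply, tsum_fintype, Fintype.sum_bool, unifBits_apply]
  rcases l with _ | ⟨b, l⟩
  · simp [PMF.map_apply]
  · rw [hcons, hcons, unifBits_apply, PMF.uniformOfFintype_apply, PMF.uniformOfFintype_apply,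
      Fintype.card_bool]
    by_cases hl : l.length = m
    · cases b <;> simp [hl, pow_succ, ENNReal.mul_inv, mul_comm]
    · simp [hl]

theorem length_of_mem_support {m : ℕ} {y : List Bool} (h : y ∈ (unifBits m).support) :
    y.length = m := by
  rw [unifBits, PMF.support_map] at h
  obtain ⟨v, -, rfl⟩ := h
  exact v.2

theorem map_take_unifBits {t m : ℕ} (h : t ≤ m) : (unifBits m).map (List.take t) = unifBits t := by
  induction t generalizing m with
  | zero =>
    rw [unifBits_zero, show (List.take 0 : List Bool → List Bool) = Function.const _ [] by
      funext l; rfl, PMF.map_const]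
  | succ t ih =>
    obtain ⟨m, rfl⟩ : ∃ m', m = m' + 1 := ⟨m - 1, by omega⟩
    rw [unifBits_succ, unifBits_succ, PMF.map_bind]
    congr 1
    funext b
    rw [PMF.map_comp, ← ih (show t ≤ m by omega), PMF.map_comp]
    rfl

theorem map_drop_unifBits (s m : ℕ) : (unifBits m).map (List.drop s) = unifBits (m - s) := by
  induction s generalizing m with
  | zero => exact PMF.map_id _
  | succ s ih =>
    rcases m with _ | m
    · rw [unifBits_zero, PMF.pure_map, Nat.zero_sub, unifBits_zero]
      rfl
    · rw [unifBits_succ, PMF.map_bind, Nat.add_sub_add_right, ← ih m]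
      simp only [PMF.map_comp]
      exact PMF.bind_const (PMF.uniformOfFintype Bool) ((unifBits m).map (List.drop s))

theorem prob_take {t m : ℕ} (h : t ≤ m) (S : Set (List Bool)) :
    prob (unifBits m) {y | y.take t ∈ S} = prob (unifBits t) S := by
  rw [← map_take_unifBits h, prob_map]
  rfl

theorem prob_drop (s m : ℕ) (S : Set (List Bool)) :
    prob (unifBits m) {y | y.drop s ∈ S} = prob (unifBits (m - s)) S := by
  rw [← map_drop_unifBits s, prob_map]
  rfl

end Prob

/-! ### The circuit for a machine and an input -/

theorem coins_zero {y : List Bool} {n : ℕ} (h : n ≤ y.length) : coins y 0 n = y.take n := by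
  refine List.ext_getElem (by simp [h]) fun i h1 h2 => ?_
  simp only [length_coins] at h1
  simp [coins, List.getElem?_eq_getElem (show i < y.length by omega)]

variable (M : ProbTM)

/-- The description of a circuit of size `n ^ (d + 1)` for the acceptance of the input `x` of
length `n`. -/
noncomputable def circuitOf (base : List Item) (C d : ℕ) (x : List Bool) : List Bool :=
  padTo (x.length ^ (d + 1)) ((Instr.codes
    (acceptProgram M base (simLevel C d x.length) x).reverse).flatMap gateStr)

/-- Of its `n ^ (d + 1)` inputs the circuit uses the first `2 ^ simLevel C d n` as coin tosses. The
machine has halted after `C * n ^ d + C` steps, so the later tosses do not influence the result. -/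
theorem eventually_acceptProb_circuitOf {base : List Item} (hg : ∀ x ∈ base, x.Good)
    (hb : ∀ y, Simulates M y base 0 1 1 2 1) (C : ℕ) {d : ℕ} (hd : 1 ≤ d) :
    ∀ᶠ n : ℕ in atTop, ∀ x : List Bool, x.length = n → M.HaltsWithin x (C * n ^ d + C) →
      acceptProb (circuitOf M base C d x) (n ^ (d + 1)) =
        M.probAfter x (C * n ^ d + C) fun c => M.Outputs c [true] := by
  obtain ⟨c, hc⟩ := exists_length_acceptProgram_le (M := M) base
  filter_upwards [eventually_gates_le C c hd, eventually_two_pow_simLevel_le C hd] with n hn hn'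
  rintro x rfl hx
  have hlen := length_flatMap_gateStr_codes
    (acceptProgram M base (simLevel C d x.length) x).reverse
  rw [List.length_reverse] at hlen
  have hlt := lt_two_pow_simLevel C d x.length
  rw [acceptProb, circuitOf, decodeCircuit_padTo (hlen.trans (hn _ (hc _ _))), probAfter,
    ← prob_take (show C * x.length ^ d + C ≤ x.length ^ (d + 1) by omega)]
  refine prob_congr fun y hy => ?_
  have hy := length_of_mem_support hy
  simp only [Set.mem_ofPred_eq]
  rw [evalCircuit_acceptProgram hg hb (one_le_simLevel _ _ _),
    coins_zero (by omega)]
  rw [M.run_take (r := y.take (2 ^ simLevel C d x.length)) hx (by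
    rw [List.length_take]; omega), List.take_take, min_eq_left (by omega)]

theorem polyTime_circuitOf (base : List Item) (C d : ℕ) :
    PT fun x : Str => Str.mk (circuitOf M base C d x.bits) := by
  have hlen : PT fun x : Str => x.bits.length := PT.strLength PT.id
  have hK : PT fun x : Str => simLevel C d x.bits.length := by
    -- The level is a number of binary digits, that is, the length of a binary expansion.
    have := PT.strLength (PT.bits (f := fun x : Str => C * x.bits.length ^ d + C + x.bits.length + 1)
      (by fun_prop))
    simp only [Nat.size_eq_bits_len] at this
    exact this
  refine PT.padTo (hlen.pow _) (s := fun x : Str => Str.mk _) (PT.circuitStr (pt_acceptProgram base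
    hK PT.id (2 * (Polynomial.C C * Polynomial.X ^ d + Polynomial.C C + Polynomial.X + 1))
      fun x => ?_))
  refine (Nat.two_pow_size_le (by omega)).trans ?_
  simp

end

section

namespace Frag

/-! ### A linear-time test whether a string encodes an instance -/

/-- The registers: the rest of the input, the reversed part that has been read, four unary numbers,
the result, and a register that is not used. -/
def regs (x b : List Bool) (u v z q : ℕ) (f : List Bool) : Fin 8 → List Bool :=
  ![x, b, List.replicate u true, List.replicate v true, List.replicate z true,
    List.replicate q true, f, []]

abbrev skip : Frag (Fin 8) := pop fun _ => false

theorem run_skip (S : Fin 8 → List Bool) : skip.Run S S 1 :=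
  (run_pop _ S).congr (by simp) rfl

/-- Simultaneously decrease the numbers in the registers `2` and `4` and increase the number in the
register `3`. -/
def moveUnits : Frag (Fin 8) :=
  loop (fun h => (h 2).isSome && (h 4).isSome)
    (pushPop (fun _ _ => some true) (fun k => k == 3) fun k => k == 2 || k == 4)

theorem run_moveUnits (x b f : List Bool) (u v z q : ℕ) :
    moveUnits.Run (regs x b u v z q f) (regs x b (u - z) (v + min u z) (z - u) q f)
      (3 * min u z + 1) := by
  induction u generalizing v z with
  | zero =>
    refine (run_loop_exit (by simp [regs])).congr ?_ (by simp)
    simp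
  | succ u ih =>
    rcases z with _ | z
    · refine (run_loop_exit (by simp [regs])).congr ?_ (by simp)
      simp
    · refine (Run.loop (by simp [regs, List.replicate_succ]) ((run_pushPop _ _ _ _ (fun _ => true)
        (by simp)).congr (S'' := regs x b u (v + 1) z q f) ?_ rfl) (ih (v + 1) z)).congr ?_ ?_
      · funext k
        fin_cases k <;> simp [regs, List.replicate_succ]
      · congr 1 <;> omega
      · omega

/-- Divide the number in the register `4` by the number in the register `2`; if there is a remainder,
then the register `3` is not empty at the end. -/
noncomputable def divide : Frag (Fin 8) :=
  loop (fun h => (h 4).isSome)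
    (seq moveUnits (ite (fun h => (h 2).isSome) skip
      (seq (pour 3 fun k => k == 2) (pushPop (fun _ _ => some true) (fun k => k == 5) fun _ => false))))

/-- A complete round takes `n` away from `z`, increases the quotient and pours the units collected
in register `3` back to register `2`, which restores the divisor. It costs `6 * n + 6 ≤ 12 * n`
steps, so the total is linear in `z`. An incomplete last round leaves the remainder in register `3`.
-/
theorem run_divide (b f : List Bool) {n : ℕ} (hn : 1 ≤ n) (z q : ℕ) :
    ∃ u v q' t, divide.Run (regs [] b n 0 z q f) (regs [] b u v 0 q' f) t ∧ t ≤ 12 * z + 1 ∧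
      (v = 0 ↔ n ∣ z) ∧ (v = 0 → u = n ∧ q' = q + z / n) := by
  induction z using Nat.strong_induction_on generalizing q with
  | _ z ih =>
    rcases Nat.eq_zero_or_pos z with rfl | hz
    · exact ⟨n, 0, q, 1, run_loop_exit (by simp [regs]), by omega, by simp, by simp⟩
    · have hc : (regs [] b n 0 z q f 4).head?.isSome = true := by
        obtain ⟨z, rfl⟩ : ∃ z', z = z' + 1 := ⟨z - 1, by omega⟩
        simp [regs, List.replicate_succ]
      have hm := run_moveUnits [] b f n 0 z q
      rcases lt_or_ge z n with hzn | hzn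
      · refine ⟨n - z, 0 + min n z, q, _, Run.loop hc (hm.seq (Run.ite_true ?_ (run_skip _)))
          ((run_loop_exit ?_).congr (S'' := regs [] b (n - z) (0 + min n z) 0 q f) ?_ rfl),
          by omega, ?_, by omega⟩
        · obtain ⟨m, hm⟩ : ∃ m, n - z = m + 1 := ⟨n - z - 1, by omega⟩
          simp [regs, hm, List.replicate_succ]
        · simp [regs, show z - n = 0 by omega]
        · rw [show z - n = 0 by omega]
        · refine ⟨by omega, fun h => ?_⟩
          have := Nat.le_of_dvd hz h
          omega
      · obtain ⟨u, v, q', t, h1, h2, h3, h4⟩ := ih (z - n) (by omega) (q + 1)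
        have hb : (seq (pour 3 fun k => k == 2)
            (pushPop (fun _ _ => some true) (fun k => k == 5) fun _ => false)).Run
            (regs [] b (n - z) (0 + min n z) (z - n) q f) (regs [] b n 0 (z - n) (q + 1) f)
            (3 * n + 1 + 2) := by
          rw [show n - z = 0 by omega, show 0 + min n z = n by omega]
          refine Run.seq (S₁ := regs [] b n 0 (z - n) q f) ((run_pour 3 _ (by simp) _).congr ?_ ?_)
            ((run_pushPop _ _ _ _ (fun _ => true) (by simp)).congr ?_ rfl)
          · funext k
            fin_cases k <;> simp [regs]
          · simp [regs]
          · funext k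
            fin_cases k <;> simp [regs, List.replicate_succ]
        refine ⟨u, v, q', _, Run.loop hc (hm.seq (Run.ite_false ?_ hb)) h1, by omega, ?_, ?_⟩
        · simp [regs, show n - z = 0 by omega]
        · rw [h3]
          conv_rhs => rw [← Nat.sub_add_cancel hzn]
          exact Nat.dvd_add_self_right.symm
        · intro hv
          obtain ⟨h5, h6⟩ := h4 hv
          refine ⟨h5, ?_⟩
          rw [h6, Nat.div_eq_sub_div (by omega) hzn]
          ring

/-- Test whether the number in the register `4` is the `e`-th power of the number in the
register `2`. -/
noncomputable def isPower : ℕ → Frag (Fin 8)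
  | 0 => ite (fun h => (h 4).isSome) (seq (pop fun k => k == 4)
      (ite (fun h => (h 4).isSome) skip
        (pushPop (fun _ _ => some true) (fun k => k == 6) fun _ => false))) skip
  | e + 1 => seq divide (ite (fun h => (h 3).isSome) skip
      (seq (pour 5 fun k => k == 4) (isPower e)))

/-- A number `z` is `n ^ (e + 1)` exactly if `n` divides it and `z / n` is `n ^ e`. For fixed `e`,
these are boundedly many divisions of numbers that are at most `z`. -/
theorem run_isPower (b : List Bool) {n : ℕ} (hn : 1 ≤ n) (e z : ℕ) :
    ∃ S' t, (isPower e).Run (regs [] b n 0 z 0 []) S' t ∧ t ≤ 20 * (e + 1) * (z + 1) ∧ S' 1 = b ∧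
      S' 6 = (if z = n ^ e then [true] else []) ∧ S' 7 = [] := by
  induction e generalizing z with
  | zero =>
    rcases z with _ | _ | z
    · exact ⟨_, _, Run.ite_false (by simp [regs]) (run_skip _), by omega, by simp [regs],
        by simp [regs], by simp [regs]⟩
    · refine ⟨regs [] b n 0 0 0 [true], _, Run.ite_true (by simp [regs])
        (((run_pop _ _).congr (S'' := regs [] b n 0 0 0 []) ?_ rfl).seq
          (Run.ite_false (by simp [regs]) ((run_pushPop _ _ _ _ (fun _ => true)
            (by simp)).congr ?_ rfl))), by omega, by simp [regs], by simp [regs], by simp [regs]⟩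
      · funext k
        fin_cases k <;> simp [regs]
      · funext k
        fin_cases k <;> simp [regs]
    · refine ⟨regs [] b n 0 (z + 1) 0 [], _, Run.ite_true (by simp [regs, List.replicate_succ])
        (((run_pop _ _).congr (S'' := regs [] b n 0 (z + 1) 0 []) ?_ rfl).seq
          (Run.ite_true (by simp [regs, List.replicate_succ]) (run_skip _))), by omega,
          by simp [regs], by simp [regs], by simp [regs]⟩
      funext k
      fin_cases k <;> simp [regs, List.replicate_succ]
  | succ e ih =>
    obtain ⟨u, v, q, t, h1, h2, h3, h4⟩ := run_divide b [] hn z 0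
    have hexp : 20 * (e + 1 + 1) * (z + 1) = 20 * (e + 1) * (z + 1) + 20 * z + 20 := by ring
    have hpos : 0 ≤ 20 * (e + 1) * (z + 1) := Nat.zero_le _
    rcases Nat.eq_zero_or_pos v with rfl | hv
    · obtain ⟨rfl, rfl⟩ := h4 rfl
      have hd : u ∣ z := h3.1 rfl
      rw [Nat.zero_add] at h1
      obtain ⟨S', t', k1, k2, k3, k4, k5⟩ := ih (z / u)
      have hq : z / u ≤ z := Nat.div_le_self _ _
      have hpour : (pour 5 fun k => k == 4).Run (regs [] b u 0 0 (z / u) [])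
          (regs [] b u 0 (z / u) 0 []) (3 * (z / u) + 1) := by
        refine (run_pour 5 _ (by simp) _).congr ?_ (by simp [regs])
        funext k
        fin_cases k <;> simp [regs]
      have hmul : 20 * (e + 1) * (z / u + 1) ≤ 20 * (e + 1) * (z + 1) :=
        Nat.mul_le_mul_left _ (by omega)
      refine ⟨S', _, h1.seq (Run.ite_false (by simp [regs]) (hpour.seq k1)), by omega, k3, ?_, k5⟩
      rw [k4]
      congr 1
      rw [pow_succ, eq_iff_iff, Nat.div_eq_iff_eq_mul_left hn hd]
    · have hnd : ¬ n ∣ z := fun h => by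
        have := h3.2 h
        omega
      refine ⟨_, _, h1.seq (Run.ite_true ?_ (run_skip _)), by omega, by simp [regs], ?_,
        by simp [regs]⟩
      · obtain ⟨v, rfl⟩ : ∃ v', v = v' + 1 := ⟨v - 1, by omega⟩
        simp [regs, List.replicate_succ]
      · rw [if_neg]
        · simp [regs]
        · rintro rfl
          exact hnd (Dvd.intro_left _ (pow_succ n e).symm)

/-- Read the ones at the front of the input. -/
def readOnes : Frag (Fin 8) :=
  loop (fun h => h 0 == some true)
    (pushPop (fun _ _ => some true) (fun k => k == 1 || k == 2) fun k => k == 0)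

theorem run_readOnes (x b : List Bool) (hx : x.head? ≠ some true) (n u : ℕ) :
    readOnes.Run (regs (List.replicate n true ++ x) b u 0 0 0 [])
      (regs x (List.replicate n true ++ b) (u + n) 0 0 0 []) (3 * n + 1) := by
  induction n generalizing b u with
  | zero => exact run_loop_exit (by simpa [regs] using hx)
  | succ n ih =>
    refine (Run.loop (by simp [regs, List.replicate_succ]) ((run_pushPop _ _ _ _ (fun _ => true)
      (by simp)).congr (S'' := regs (List.replicate n true ++ x) (true :: b) (u + 1) 0 0 0 []) ?_
        rfl) (ih (true :: b) (u + 1))).congr ?_ ?_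
    · funext k
      fin_cases k <;> simp [regs, List.replicate_succ]
    · rw [List.append_cons, ← List.replicate_succ', show u + 1 + n = u + (n + 1) by ring]
    · ring

/-- Read the rest of the input. -/
def readRest : Frag (Fin 8) :=
  loop (fun h => (h 0).isSome)
    (pushPop (fun h k => if k = 1 then h 0 else some true) (fun k => k == 1 || k == 4)
      fun k => k == 0)

theorem run_readRest (x b : List Bool) (n z : ℕ) :
    readRest.Run (regs x b n 0 z 0 []) (regs [] (x.reverse ++ b) n 0 (z + x.length) 0 [])
      (3 * x.length + 1) := by
  induction x generalizing b z with
  | nil => exact run_loop_exit (by simp [regs])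
  | cons a x ih =>
    refine (Run.loop (by simp [regs]) ((run_pushPop _ _ _ _ (fun k => if k = 1 then a else true)
      ?_).congr (S'' := regs x (a :: b) n 0 (z + 1) 0 []) ?_
        rfl) (ih (a :: b) (z + 1))).congr ?_ ?_
    · intro k
      fin_cases k <;> simp [regs]
    · funext k
      fin_cases k <;> simp [regs, List.replicate_succ]
    · rw [List.reverse_cons, List.append_assoc, List.length_cons,
        show z + 1 + x.length = z + (x.length + 1) by ring]
      rfl
    · simp only [List.length_cons]
      ring

/-- Test whether the input encodes a pair `(1^n, C)` with `n ≥ 1` and `C ∈ {0,1}^(n^e)`. -/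
noncomputable def isInstance (e : ℕ) : Frag (Fin 8) :=
  seq readOnes (ite (fun h => h 0 == some false && (h 2).isSome)
    (seq (pushPop (fun _ _ => some false) (fun k => k == 1) fun k => k == 0)
      (seq readRest (isPower e))) skip)

theorem exists_eq_replicate_append (x : List Bool) :
    ∃ n x', x = List.replicate n true ++ x' ∧ x'.head? ≠ some true := by
  induction x with
  | nil => exact ⟨0, [], rfl, by simp⟩
  | cons b x ih =>
    cases b
    · exact ⟨0, _, rfl, by simp⟩
    · obtain ⟨n, x', rfl, h⟩ := ih
      exact ⟨n + 1, x', rfl, h⟩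

theorem unaryPair_inj {n n' : ℕ} {C C' : List Bool} (h : unaryPair n C = unaryPair n' C') :
    n = n' ∧ C = C' := by
  induction n generalizing n' with
  | zero => rcases n' with _ | n' <;> simp_all [unaryPair, List.replicate_succ]
  | succ n ih =>
    rcases n' with _ | n'
    · simp [unaryPair, List.replicate_succ] at h
    · simp only [unaryPair, List.replicate_succ, List.cons_append, List.cons.injEq, true_and] at h
      have := ih h
      exact ⟨by rw [this.1], this.2⟩

-- The format has to be tested because `A` is only known to halt in time on instances. Register `1`
-- keeps the reversed input, which is later handed to `A`, and register `7` stays empty for the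
-- answer.
open Classical in
theorem run_isInstance (e : ℕ) (x : List Bool) :
    ∃ S' t, (isInstance e).Run (regs x [] 0 0 0 0 []) S' t ∧ t ≤ (20 * (e + 1) + 20) * (x.length + 1) ∧
      S' 6 = (if ∃ n C, 1 ≤ n ∧ C.length = n ^ e ∧ x = unaryPair n C then [true] else []) ∧
      S' 7 = [] ∧ (S' 6 = [true] → S' 1 = x.reverse) := by
  obtain ⟨n, x', rfl, hx'⟩ := exists_eq_replicate_append x
  have h1 := run_readOnes x' [] hx' n 0
  rw [List.append_nil, Nat.zero_add] at h1
  have hexp : (20 * (e + 1) + 20) * (n + x'.length + 1) =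
    20 * (e + 1) * (n + x'.length + 1) + 20 * (n + x'.length + 1) := by ring
  have hgood : (∃ C, x' = false :: C) ∧ 1 ≤ n ∨ ¬ ∃ n' C, 1 ≤ n' ∧ C.length = n' ^ e ∧
      List.replicate n true ++ x' = unaryPair n' C := by
    rcases x' with _ | ⟨_ | _, C⟩
    · right
      rintro ⟨n', C, -, -, h⟩
      have : false ∈ unaryPair n' C := by simp [unaryPair]
      rw [← h] at this
      simp at this
    · rcases Nat.eq_zero_or_pos n with rfl | hn
      · right
        rintro ⟨n', C', hn', -, h⟩
        have := (unaryPair_inj (n := 0) h).1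
        omega
      · exact Or.inl ⟨⟨C, rfl⟩, hn⟩
    · simp at hx'
  by_cases hg : (∃ C, x' = false :: C) ∧ 1 ≤ n
  · obtain ⟨⟨C, rfl⟩, hn⟩ := hg
    have h2 := run_readRest C (false :: List.replicate n true) n 0
    rw [Nat.zero_add] at h2
    obtain ⟨S', t, k1, k2, k3, k4, k5⟩ := run_isPower (C.reverse ++ false :: List.replicate n true)
      hn e C.length
    have h3 : (pushPop (fun _ _ => some false) (fun k => k == 1) fun k => k == 0).Run
        (regs (false :: C) (List.replicate n true) n 0 0 0 [])
        (regs C (false :: List.replicate n true) n 0 0 0 []) 2 := by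
      refine (run_pushPop _ _ _ _ (fun _ => false) (by simp)).congr ?_ rfl
      funext k
      fin_cases k <;> simp [regs]
    refine ⟨S', _, h1.seq (Run.ite_true ?_ (h3.seq (h2.seq k1))), ?_, ?_, k5, ?_⟩
    · obtain ⟨n, rfl⟩ : ∃ n', n = n' + 1 := ⟨n - 1, by omega⟩
      simp [regs, List.replicate_succ]
    · have : 20 * (e + 1) * (C.length + 1) ≤ 20 * (e + 1) * (n + (C.length + 1) + 1) :=
        Nat.mul_le_mul_left _ (by omega)
      simp only [List.length_append, List.length_replicate, List.length_cons] at hexp ⊢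
      omega
    · rw [k4]
      congr 1
      rw [eq_iff_iff]
      constructor
      · exact fun h => ⟨n, C, hn, h, rfl⟩
      · rintro ⟨n', C', -, h, h'⟩
        obtain ⟨rfl, rfl⟩ := unaryPair_inj (n := n) (C := C) h'
        exact h
    · intro _
      rw [k3]
      simp
  · have hno := hgood.resolve_left hg
    refine ⟨_, _, h1.seq (Run.ite_false ?_ (run_skip _)), ?_, ?_, rfl, ?_⟩
    · rw [Bool.eq_false_iff]
      intro h
      refine hg ?_
      rcases x' with _ | ⟨a, C⟩
      · simp [regs] at h
      · rcases n with _ | n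
        · simp [regs] at h
        · simp [regs] at h
          exact ⟨⟨C, by rw [h]⟩, by omega⟩
    · simp only [List.length_append, List.length_replicate]
      omega
    · rw [if_neg hno]
      rfl
    · simp [regs]

end Frag

end

/-! ### Running `A` and comparing its output with `1/2` -/

section

open Turing (Tape Dir)
open Frag

/-- The string `y` with `binaryValue y ≥ 1/2` is written on the output tape, as far as the first two
cells are concerned. -/
def ProbTM.OutputsHalf (M : ProbTM) (c : M.Cfg) : Prop :=
  (c.tape M.out).nth 0 = some true ∨
    (c.tape M.out).nth 0 = some false ∧ (c.tape M.out).nth 1 = some true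

theorem binaryValue_nonneg (y : List Bool) : 0 ≤ binaryValue y := by
  induction y with
  | nil => exact le_rfl
  | cons b y ih =>
    rw [binaryValue]
    split_ifs <;> linarith

theorem binaryValue_lt_two (y : List Bool) : binaryValue y < 2 := by
  induction y with
  | nil => norm_num [binaryValue]
  | cons b y ih =>
    rw [binaryValue]
    split_ifs <;> linarith

/-- If the first two digits are `0`, the remaining ones contribute less than `2 / 4`; a `1` among
the first two contributes at least `1/2`. -/
theorem ProbTM.Outputs.half_le_iff {M : ProbTM} {c : M.Cfg} {y : List Bool} (h : M.Outputs c y) :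
    1 / 2 ≤ binaryValue y ↔ M.OutputsHalf c := by
  have h0 := h 0 (Nat.zero_le _)
  rw [Nat.cast_zero] at h0
  rw [OutputsHalf, h0]
  rcases y with _ | ⟨b, y⟩
  · refine iff_of_false (by norm_num [binaryValue]) ?_
    rintro (h | ⟨h, -⟩) <;> cases h
  · have h1 := h 1 (by simp)
    rw [Nat.cast_one] at h1
    rw [h1]
    have hy := binaryValue_nonneg y
    cases b
    · rcases y with _ | ⟨b, y⟩
      · refine iff_of_false (by norm_num [binaryValue]) ?_
        rintro (h | ⟨-, h⟩) <;> cases h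
      · have hy := binaryValue_nonneg y
        have hy' := binaryValue_lt_two y
        cases b
        · simp [binaryValue]
          linarith
        · simp [binaryValue]
          linarith
    · simp [binaryValue]
      linarith

namespace Frag

variable (A : ProbTM)

/-- Copy the scanned output symbol to the tape with number `7`, and move on. -/
def readFirst (h : A.K ⊕ Fin 8 → Option Bool) (k : A.K ⊕ Fin 8) : Option Bool × Option Dir :=
  (if k = .inr 7 then h (.inl A.out) else h k, if k = .inl A.out then some Dir.right else none)

/-- Write `1` on the tape with number `7` if the output is at least `1/2`. -/
def readSecond (h : A.K ⊕ Fin 8 → Option Bool) (k : A.K ⊕ Fin 8) : Option Bool × Option Dir :=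
  (if k = .inr 7 then
    if h (.inr 7) = some true ∨ h (.inr 7) = some false ∧ h (.inl A.out) = some true then some true
    else none else h k, none)

-- The first digit is kept on tape `7` while the output head moves on to the second one.
open Classical in
theorem path_readHalf (T : A.K ⊕ Fin 8 → Tape (Option Bool)) (h7 : T (.inr 7) = stackTape [])
    (c : A.Cfg) (hc : c.tape = T ∘ .inl) :
    ∃ T', T' (.inr 7) = stackTape (if A.OutputsHalf c then [true] else []) ∧
      ∀ r : List Bool, r.length = 2 → 
      (seq (act (readFirst A)) (act (readSecond A))).Path (.inl ()) T r T' := by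
  have hw : ∀ b : Bool, (stackTape []).write (some b) = stackTape [b] := fun b => rfl
  have hw' : (stackTape []).write none = stackTape [] := rfl
  have hww : ∀ (t : Tape (Option Bool)) a b, (t.write a).write b = t.write b := fun t a b => rfl
  let T₁ := acts (readFirst A (heads T)) T
  refine ⟨acts (readSecond A (heads T₁)) T₁, ?_, fun r hr => ?_⟩
  rotate_left
  · obtain ⟨b, b', rfl⟩ := List.length_eq_two.1 hr
    exact Path.seq (r := [b]) (.exit rfl rfl) (.exit rfl rfl)
  · have hout : T (.inl A.out) = c.tape A.out := by rw [hc]; rfl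
    simp only [T₁, readFirst, readSecond, acts, heads, ProbTM.act, if_true, reduceCtorEq, if_false, h7, hout]
    rw [Tape.write_self]
    simp only [hww]
    have e1 : ((stackTape []).write (c.tape A.out).head).head = (c.tape A.out).nth 0 := rfl
    have e2 : (Tape.move Dir.right (c.tape A.out)).head = (c.tape A.out).nth 1 := by
      rw [← Tape.nth_zero, Tape.move_right_nth]
      rfl
    rw [e1, e2]
    by_cases h : A.OutputsHalf c
    · rw [if_pos h]
      simp only [ProbTM.OutputsHalf] at h
      rw [if_pos h]
      rfl
    · rw [if_neg h]
      simp only [ProbTM.OutputsHalf] at h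
      rw [if_neg h]
      rfl

/-- Decide whether the input is an instance for which the output of `A` is at least `1/2`. -/
noncomputable def halfDecider (e : ℕ) : Frag (A.K ⊕ Fin 8) :=
  seq (lift .inr (isInstance e)) (ite (fun h => (h (.inr 6)).isSome)
    (seq (pour (.inr 1) fun k => decide (k = .inl A.inp))
      (seq (lift .inl (ofTM A)) (seq (act (readFirst A)) (act (readSecond A)))))
    (pop fun _ => false))

theorem path_halfDecider_of_not {e : ℕ} {x : List Bool}
    (hx : ¬ ∃ n C, 1 ≤ n ∧ C.length = n ^ e ∧ x = unaryPair n C) :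
    ∃ T' s, T' (.inr 7) = stackTape [] ∧ s ≤ (20 * (e + 1) + 25) * (x.length + 1) ∧
      ∀ r : List Bool, r.length = s → (halfDecider A e).Path (halfDecider A e).start
        (stk fun k : A.K ⊕ Fin 8 => if k = .inr 0 then x else []) r T' := by
  obtain ⟨S', t, h1, h2, h3, h4, -⟩ := run_isInstance e x
  rw [if_neg hx] at h3
  have hr : (lift .inr (isInstance e) : Frag (A.K ⊕ Fin 8)).Run
      (fun k => if k = .inr 0 then x else []) (Sum.elim (fun _ => []) S') t := by
    refine Run.lift Sum.inr_injective ?_ ?_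
    · have h0 : (fun k : A.K ⊕ Fin 8 => if k = .inr 0 then x else []) ∘ .inr =
          regs x [] 0 0 0 0 [] := by
        funext k
        fin_cases k <;> simp [regs]
      rw [h0, Sum.elim_comp_inr]
      exact h1
    · rintro (k | k) hk
      · simp
      · exact absurd rfl (hk k)
  have hp : (pop fun _ => false : Frag (A.K ⊕ Fin 8)).Run (Sum.elim (fun _ => []) S')
    (Sum.elim (fun _ => []) S') 1 := (run_pop _ _).congr (by simp) rfl
  refine ⟨_, _, ?_, ?_, hr.seq (Run.ite_false ?_ hp)⟩
  · simp [stk, h4]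
  · have : (20 * (e + 1) + 25) * (x.length + 1) =
      (20 * (e + 1) + 20) * (x.length + 1) + 5 * (x.length + 1) := by ring
    omega
  · simp [h3]

-- The number `s` of steps before `A` starts does not depend on the coins. Therefore `A` uses a
-- fixed slice of the tosses, which is again uniformly distributed.
open Classical in
theorem path_halfDecider_of_exists {e : ℕ} {x : List Bool}
    (hx : ∃ n C, 1 ≤ n ∧ C.length = n ^ e ∧ x = unaryPair n C) :
    ∃ s ≤ (20 * (e + 1) + 25) * (x.length + 1), ∀ t, A.HaltsWithin x t → ∀ r : List Bool,
      (20 * (e + 1) + 30) * (x.length + 1) + t ≤ r.length →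
      ∃ T' s', T' (.inr 7) =
          stackTape (if A.OutputsHalf (A.run x ((r.drop s).take t)) then [true] else []) ∧
        (halfDecider A e).Path (halfDecider A e).start
          (stk fun k : A.K ⊕ Fin 8 => if k = .inr 0 then x else []) (r.take s') T' := by
  obtain ⟨S', t₀, h1, h2, h3, h4, h5⟩ := run_isInstance e x
  rw [if_pos hx] at h3
  have h5 := h5 h3
  have hr : (lift .inr (isInstance e) : Frag (A.K ⊕ Fin 8)).Run
      (fun k => if k = .inr 0 then x else []) (Sum.elim (fun _ => []) S') t₀ := by
    refine Run.lift Sum.inr_injective ?_ ?_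
    · have h0 : (fun k : A.K ⊕ Fin 8 => if k = .inr 0 then x else []) ∘ .inr =
          regs x [] 0 0 0 0 [] := by
        funext k
        fin_cases k <;> simp [regs]
      rw [h0, Sum.elim_comp_inr]
      exact h1
    · rintro (k | k) hk
      · simp
      · exact absurd rfl (hk k)
  have hp : (pour (.inr 1) fun k => decide (k = .inl A.inp) : Frag (A.K ⊕ Fin 8)).Run
      (Sum.elim (fun _ => []) S') (Sum.elim (fun k => if k = A.inp then x else [])
        fun i => if i = 1 then [] else S' i) (3 * x.length + 1) := by
    refine (run_pour _ _ (by simp) _).congr ?_ (by simp [h5])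
    funext k
    rcases k with k | k
    · by_cases hk : k = A.inp <;> simp [hk, h5]
    · simp
  have e1 : (20 * (e + 1) + 25) * (x.length + 1) =
      (20 * (e + 1) + 20) * (x.length + 1) + 5 * (x.length + 1) := by ring
  have e2 : (20 * (e + 1) + 30) * (x.length + 1) =
      (20 * (e + 1) + 25) * (x.length + 1) + 5 * (x.length + 1) := by ring
  refine ⟨t₀ + (1 + (3 * x.length + 1)), by omega, fun t ht r hrl => ?_⟩
  obtain ⟨b, r', hr'⟩ : ∃ b r', r.drop t₀ = b :: r' := by
    cases hd : r.drop t₀ with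
    | nil =>
      rw [List.drop_eq_nil_iff] at hd
      omega
    | cons b r' => exact ⟨b, r', rfl⟩
  have hr'l : r'.length + 1 = r.length - t₀ := by
    rw [← List.length_drop, hr', List.length_cons]
  set ρ := r'.drop (3 * x.length + 1) with hρ
  have hρr : r.drop (t₀ + (1 + (3 * x.length + 1))) = ρ := by
    rw [← List.drop_drop, hr', add_comm 1, List.drop_succ_cons]
  have hρl : t + 3 ≤ ρ.length := by
    rw [hρ, List.length_drop]
    omega
  rw [hρr]
  obtain ⟨s, hs, hA⟩ := path_ofTM A t (A.init x) (ρ.take (t + 1)) (by simp; omega) (by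
    rw [List.take_take, min_eq_left (by omega)]
    exact ht _ (by simp; omega))
  rw [List.take_take, List.take_take, min_eq_left (by omega), min_eq_left (by omega)] at hA
  obtain ⟨T', hT', hread⟩ := path_readHalf A (Sum.elim (A.run x (ρ.take t)).tape
    fun i => stackTape (if i = 1 then [] else S' i)) (by simp [h4]) (A.run x (ρ.take t)) rfl
  refine ⟨T', t₀ + ((3 * x.length + 1 + (s + 2)) + 1), hT', ?_⟩
  rw [List.take_add, hr', List.take_succ_cons,
    List.take_add (i := 3 * x.length + 1), ← hρ, List.take_add (i := s)]
  refine Path.seq (hr _ (by simp; omega)) (Path.ite_true b ?_ (Path.seq (hp _ (by simp; omega))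
    (Path.seq (Path.lift Sum.inl_injective hA ?_ rfl ?_) (hread _ (by simp; omega)))))
  · simp [heads, h3]
  · funext k
    by_cases hk : k = A.inp <;> simp [ProbTM.init, hk, stackTape]
  · rintro (k | k) hk
    · exact absurd rfl (hk k)
    · rfl

end Frag

end

section

open Frag

/-! ### The language of the instances with large canonical output -/

theorem IsCanonicalOutput.two_thirds_le {A : ProbTM} {t n : ℕ} {C : List Bool} {μ : ℝ}
    (h : IsCanonicalOutput A t n C μ) (hμ : 1 / 2 ≤ μ) :
    2 / 3 ≤ A.probAfter (unaryPair n C) t A.OutputsHalf := by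
  refine h.trans (prob_mono fun r _ hr => ?_)
  obtain ⟨y, hy, rfl⟩ := hr
  exact hy.half_le_iff.1 hμ

/-- An output of value at least `1/2` excludes an output of value `μ`, and the latter event has
probability at least `2/3`. -/
theorem IsCanonicalOutput.le_one_third {A : ProbTM} {t n : ℕ} {C : List Bool} {μ : ℝ}
    (h : IsCanonicalOutput A t n C μ) (hμ : ¬ 1 / 2 ≤ μ) :
    A.probAfter (unaryPair n C) t A.OutputsHalf ≤ 1 / 3 := by
  have h1 : A.probAfter (unaryPair n C) t A.OutputsHalf + A.probAfter (unaryPair n C) t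
      (fun c => ∃ y, A.Outputs c y ∧ binaryValue y = μ) ≤ 1 := by
    refine prob_add_le_one fun r _ hr hr' => ?_
    obtain ⟨y, hy, rfl⟩ := hr'
    exact hμ (hy.half_le_iff.2 hr)
  rw [IsCanonicalOutput] at h
  linarith

/-- The instances, for exponent `e`, with a canonical output that is at least `1/2`. -/
def halfLanguage (A : ProbTM) (e : ℕ) (T : ℕ → ℕ) (a : ℕ) : Language Bool :=
  {x | ∃ n C, 1 ≤ n ∧ C.length = n ^ e ∧ x = unaryPair n C ∧
    ∃ μ, IsCanonicalOutput A (a * T n + a) n C μ ∧ 1 / 2 ≤ μ}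

/-- Membership does not depend on the choice of `μ`: canonical outputs on different sides of `1/2`
would make the same probability both at least `2/3` and at most `1/3`. -/
theorem unaryPair_mem_halfLanguage {A : ProbTM} {e : ℕ} {T : ℕ → ℕ} {a n : ℕ} {C : List Bool}
    (hn : 1 ≤ n) (hC : C.length = n ^ e) {μ : ℝ} (hμ : IsCanonicalOutput A (a * T n + a) n C μ) :
    unaryPair n C ∈ halfLanguage A e T a ↔ 1 / 2 ≤ μ := by
  constructor
  · rintro ⟨n', C', -, -, h, μ', hμ', hle⟩
    obtain ⟨rfl, rfl⟩ := unaryPair_inj h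
    by_contra hlt
    linarith [hμ'.two_thirds_le hle, hμ.le_one_third hlt]
  · exact fun h => ⟨n, C, hn, hC, rfl, μ, hμ, h⟩

theorem run_toTM_of_path {K : Type} [Finite K] [DecidableEq K] {F : Frag K} {inp out : K}
    {x r : List Bool} {s : ℕ} {T' : K → Turing.Tape (Option Bool)}
    (h : F.Path F.start (stk fun k : K => if k = inp then x else []) (r.take s) T') :
    (toTM F inp out).run x r = ⟨none, T'⟩ := by
  have := h.toTM inp out (r.drop s)
  rw [List.take_append_drop] at this
  rw [ProbTM.run, init_toTM]
  exact this

theorem outputs_true_iff_of_tape {M : ProbTM} {c : M.Cfg} {p : Prop} [Decidable p]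
    (h : c.tape M.out = stackTape (if p then [true] else [])) : M.Outputs c [true] ↔ p := by
  have h1 := outputs_stackTape M c _ h
  by_cases hp : p
  · rw [if_pos hp] at h1
    exact iff_of_true h1 hp
  · rw [if_neg hp] at h1
    refine iff_of_false (fun h2 => ?_) hp
    simpa using h1.unique h2

-- The linear-time test of the format is absorbed by `hlin`. The time bound for `A` involves `T n`,
-- where `n` is at most the length of the whole input, so monotonicity gives a bound in terms of
-- that length.
open Classical in
theorem halfLanguage_mem_BPTIME {A : ProbTM} {e : ℕ} {T : ℕ → ℕ} {a : ℕ}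
    (hA : IsPseudodeterministic A e T a) (hT : Monotone T)
    (hlin : ∃ B, ∀ n, n ≤ B * T n + B) : halfLanguage A e T a ∈ BPTIME T := by
  obtain ⟨B, hB⟩ := hlin
  set b := 20 * (e + 1) + 30 with hb
  refine ⟨toTM (halfDecider A e) (.inr 0) (.inr 7), b * (B + 1) + a, fun x => ?_⟩
  set t := (b * (B + 1) + a) * T x.length + (b * (B + 1) + a) with ht
  have ht' : b * (x.length + 1) + (a * T x.length + a) ≤ t := by
    calc _ ≤ b * (B * T x.length + B + 1) + (a * T x.length + a) :=
          Nat.add_le_add_right (Nat.mul_le_mul_left _ (Nat.add_le_add_right (hB _) 1)) _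
      _ ≤ b * (B * T x.length + B + 1) + (a * T x.length + a) + b * T x.length :=
          Nat.le_add_right _ _
      _ = t := by rw [ht]; ring
  have hb' : (20 * (e + 1) + 25) * (x.length + 1) ≤ b * (x.length + 1) :=
    Nat.mul_le_mul_right _ (by omega)
  by_cases hx : ∃ n C, 1 ≤ n ∧ C.length = n ^ e ∧ x = unaryPair n C
  · obtain ⟨s, hs, h⟩ := path_halfDecider_of_exists A hx
    obtain ⟨n, C, hn, hC, rfl⟩ := hx
    obtain ⟨hhalt, μ, hμ⟩ := hA n C hC
    have hnl : n ≤ (unaryPair n C).length := by simp [unaryPair]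
    have hTn : a * T n + a ≤ a * T (unaryPair n C).length + a :=
      Nat.add_le_add_right (Nat.mul_le_mul_left _ (hT hnl)) _
    have key : ∀ r : List Bool, r.length = t →
        ((toTM (halfDecider A e) (.inr 0) (.inr 7)).run (unaryPair n C) r).state = none ∧
        ((toTM (halfDecider A e) (.inr 0) (.inr 7)).Outputs
          ((toTM (halfDecider A e) (.inr 0) (.inr 7)).run (unaryPair n C) r) [true] ↔
        A.OutputsHalf (A.run (unaryPair n C) ((r.drop s).take (a * T n + a)))) := by
      intro r hr
      obtain ⟨T', s', h7, hp⟩ := h _ hhalt r (by rw [← hb]; omega)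
      rw [run_toTM_of_path hp]
      exact ⟨rfl, outputs_true_iff_of_tape h7⟩
    have hprob : (toTM (halfDecider A e) (.inr 0) (.inr 7)).probAfter (unaryPair n C) t
        (fun c => (toTM (halfDecider A e) (.inr 0) (.inr 7)).Outputs c [true]) =
        A.probAfter (unaryPair n C) (a * T n + a) A.OutputsHalf := by
      -- The slice of tosses used by `A` arises by dropping the first `s` and taking `a * T n + a`
      -- of the rest.
      rw [ProbTM.probAfter, ProbTM.probAfter, ← prob_take (show a * T n + a ≤ t - s by omega),
        ← prob_drop s t]
      exact prob_congr fun r hr => (key r (length_of_mem_support hr)).2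
    refine ⟨fun r hr => ?_, fun hL => ?_, fun hL => ?_⟩
    · rw [(key r hr).1]
      rfl
    · rw [hprob]
      exact hμ.two_thirds_le ((unaryPair_mem_halfLanguage hn hC hμ).1 hL)
    · rw [hprob]
      exact hμ.le_one_third fun h => hL ((unaryPair_mem_halfLanguage hn hC hμ).2 h)
  · obtain ⟨T', s, h7, hs, h⟩ := path_halfDecider_of_not A hx
    have key : ∀ r : List Bool, r.length = t →
        (toTM (halfDecider A e) (.inr 0) (.inr 7)).run x r = ⟨none, T'⟩ := fun r hr =>
      run_toTM_of_path (s := s) (h _ (by simp; omega))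
    refine ⟨fun r hr => ?_, fun hL => ?_, fun hL => ?_⟩
    · rw [key r hr]
      rfl
    · obtain ⟨n, C, hn, hC, hxC, -⟩ := hL
      exact absurd ⟨n, C, hn, hC, hxC⟩ hx
    · have h0 : (toTM (halfDecider A e) (.inr 0) (.inr 7)).probAfter x t
          (fun c => (toTM (halfDecider A e) (.inr 0) (.inr 7)).Outputs c [true]) =
          prob (unifBits t) ∅ := by
        refine prob_congr fun r hr => iff_of_false (fun h2 => ?_) (Set.notMem_empty r)
        have h3 : (toTM (halfDecider A e) (.inr 0) (.inr 7)).Outputs _ [true] := h2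
        rw [key r (length_of_mem_support hr)] at h3
        exact (outputs_true_iff_of_tape (p := False) (by rw [if_neg not_false]; exact h7)).1 h3
      rw [h0]
      simp [prob]

end

section

open ProbTM Filter

/-! ### Running times that are time-constructible and monotone are linear or eventually constant -/

theorem Nat.bits_injective' {m n : ℕ} (h : m.bits = n.bits) : m = n := by
  rw [← Nat.ofDigits_digits 2 m, ← Nat.ofDigits_digits 2 n, Nat.digits_two_eq_bits,
    Nat.digits_two_eq_bits, h]

theorem Nat.length_bits_le (n : ℕ) : n.bits.length ≤ n := by
  rw [Nat.size_eq_bits_len, Nat.size_le]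
  exact Nat.lt_two_pow_self

/-- If the time bound at some `m` is too small to reach the end of `1^m`, the machine behaves in the
same way on all longer inputs. Monotonicity ensures that the time allowed on these is not smaller.
-/
theorem TimeConstructible.linear_or_eventually_const {T : ℕ → ℕ} (hT : TimeConstructible T)
    (hmono : Monotone T) : (∃ B, ∀ n, n ≤ B * T n + B) ∨ ∃ m, ∀ n, m ≤ n → T n = T m := by
  obtain ⟨M, -, C, hM⟩ := hT
  by_cases hlin : ∀ n, n ≤ (C + 1) * T n + (C + 1)
  · exact .inl ⟨C + 1, hlin⟩
  push Not at hlin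
  obtain ⟨m, hm⟩ := hlin
  refine .inr ⟨m, fun n hn => ?_⟩
  set t := C * T m + C with ht
  -- The constant `C + 1` leaves room for the at most `T m` output bits too: they must lie where
  -- both tapes agree.
  have htm : t + T m + 1 < m := by
    calc t + T m + 1 = (C + 1) * T m + (C + 1) := by rw [ht]; ring
      _ < m := hm
  set r := List.replicate t false with hr
  have hrt : r.length = t := List.length_replicate
  obtain ⟨h1, h2⟩ := M.run_congr (m := m) (x := List.replicate m true)
    (x' := List.replicate n true)
    (fun i hi => by simp [hi, hi.trans_le hn]) r (by omega)
  have hhalt : M.halts (M.run (List.replicate n true) r).state = true := h1 ▸ (hM m).1 r hrt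
  have htn : t ≤ C * T n + C := Nat.add_le_add_right (Nat.mul_le_mul_left _ (hmono hn)) _
  have hout := (hM n).2 (r ++ List.replicate (C * T n + C - t) false) (by simp [hrt]; omega)
  rw [M.run_of_halted hhalt] at hout
  have hout' : M.Outputs (M.run (List.replicate n true) r) (T m).bits := fun i hi => by
    have := Nat.length_bits_le (T m)
    rw [← h2 _ _ (by omega)]
    exact (hM m).2 r hrt i hi
  exact Nat.bits_injective' (hout.unique hout')

/-! ### Algorithms that only read the first bits of their input -/

/-- The second digit of the output is one cell to the right of the head, hence `t + 1`. -/
theorem ProbTM.probAfter_outputsHalf_congr (M : ProbTM) {m t : ℕ} {x x' : List Bool}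
    (h : ∀ i < m, x[i]? = x'[i]?) (ht : t + 1 < m) :
    M.probAfter x t M.OutputsHalf = M.probAfter x' t M.OutputsHalf := by
  refine prob_congr fun r hr => ?_
  have hr := length_of_mem_support hr
  have h2 := (M.run_congr h r (by omega)).2 M.out
  simp only [OutputsHalf, Set.mem_ofPred_eq]
  rw [h2 0 (by omega), h2 1 (by omega)]

/-- The description of a circuit of size `N` that is constantly `b`. -/
def constCircuit (N : ℕ) (b : Bool) : List Bool :=
  padTo N (cond b [true, false, true, false] [])

/-- The circuit for `1` negates gate `0`, which is not an earlier gate and so has the value `0`; its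
description takes four bits. The circuit for `0` has no gates. -/
theorem acceptProb_constCircuit {N : ℕ} (hN : 4 ≤ N) (b : Bool) (m : ℕ) :
    acceptProb (constCircuit N b) m = cond b 1 0 := by
  cases b
  · rw [acceptProb, constCircuit, cond_false,
      show ([] : List Bool) = ([] : List (ℕ × ℕ × ℕ)).flatMap gateStr from rfl,
      decodeCircuit_padTo (Nat.zero_le _)]
    simp [evalCircuit, prob]
  · rw [acceptProb, constCircuit, cond_true,
      show [true, false, true, false] = [((1 : ℕ), (0 : ℕ), (0 : ℕ))].flatMap gateStr by
        simp [gateStr, natStr, dbl], decodeCircuit_padTo (by simpa [gateStr, natStr, dbl] using hN)]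
    simpa [evalCircuit, Instr.toGate, Gate.eval] using prob_univ (unifBits m)

theorem polySamplable_constCircuit (e : ℕ) : PolySamplable fun n =>
    (unifBits 1).map fun z => constCircuit (n ^ e) (z.getD 0 false) := by
  have hlen : PT fun x : Str => x.bits.length := PT.strLength PT.id
  have hbit : PT fun x : Str => x.bits.getD (x.bits.length - 1) false :=
    PT.getBit.comp (PT.id.prodMk (hlen.sub (PT.const 1)))
  have hstr : PT fun x : Str =>
      Str.mk (cond (x.bits.getD (x.bits.length - 1) false) [true, false, true, false] []) := by
    convert hbit.cond (PT.const (Str.mk [true, false, true, false])) (PT.const (Str.mk [])) using 2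
      with x
    cases x.bits.getD (x.bits.length - 1) false <;> rfl
  -- The input `1^n 0 b` has length `n + 2`, and its last symbol is `b`.
  refine ⟨_, (PT.padTo ((hlen.sub (PT.const 2)).pow e) hstr).polyTime, 1, fun n => ?_⟩
  rw [Polynomial.eval_one]
  refine PMF.ext fun l => ?_
  rw [PMF.map_apply, PMF.map_apply]
  refine tsum_congr fun z => ?_
  by_cases hz : z.length = 1
  · obtain ⟨b, rfl⟩ := List.length_eq_one_iff.1 hz
    have h1 : (unaryPair n [b]).length = n + 2 := by simp [unaryPair]
    have h2 : (unaryPair n [b]).getD (n + 1) false = b := by simp [unaryPair]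
    rw [h1, show n + 2 - 1 = n + 1 from rfl, h2]
    rfl
  · rw [unifBits_apply, if_neg hz, ite_self, ite_self]

/-- Within `t` steps only a part of `1^n` is seen, so an output of at least `1/2` has the same
probability for both circuits. Correctness on both would make it at most `1/3` and at least `2/3`.
-/
theorem not_correct_on_constCircuit {A : ProbTM} {e t n : ℕ} (ht : t + 1 < n) (hn : 4 ≤ n)
    (he : 1 ≤ e) : ∃ b, ¬ ∃ μ, IsCanonicalOutput A t n (constCircuit (n ^ e) b) μ ∧
      IsCAPPSolution e n (constCircuit (n ^ e) b) μ := by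
  by_contra! h
  obtain ⟨μ, hμ, -, -, hc⟩ := h false
  obtain ⟨ν, hν, -, -, hc'⟩ := h true
  have hN : 4 ≤ n ^ e := hn.trans (Nat.le_self_pow (by omega) n)
  rw [acceptProb_constCircuit hN] at hc hc'
  simp only [cond_false, cond_true] at hc hc'
  have h1 := hμ.le_one_third (by rw [abs_le] at hc; linarith)
  have h2 := hν.two_thirds_le (by rw [abs_le] at hc'; linarith)
  rw [A.probAfter_outputsHalf_congr (m := n)
    (x' := unaryPair n (constCircuit (n ^ e) true)) (fun i hi => ?_) ht] at h1
  · linarith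
  · rw [unaryPair, unaryPair, List.getElem?_append_left (by simpa),
      List.getElem?_append_left (by simpa)]

theorem prob_unifBits_one_le {S : Set (List Bool)} {b : Bool} (h : [b] ∉ S) :
    prob (unifBits 1) S ≤ 1 / 2 := by
  have h1 : prob (unifBits 1) {[b]} = 1 / 2 := by
    rw [prob, PMF.toOuterMeasure_apply_singleton, unifBits_apply, if_pos List.length_singleton]
    simp
  have h2 := prob_add_le_one (μ := unifBits 1) (S := S) (S' := {[b]})
    fun l _ hl hlb => h (Set.mem_singleton_iff.1 hlb ▸ hl)
  linarith

theorem half_lt_one_sub_one_div_rpow {c : ℝ} (hc : 1 ≤ c) {n : ℕ} (hn : 4 ≤ n) :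
    1 / 2 < 1 - 1 / (n : ℝ) ^ c := by
  have hn' : (4 : ℝ) ≤ n := by exact_mod_cast hn
  have h1 : (4 : ℝ) ≤ (n : ℝ) ^ c :=
    hn'.trans (Real.self_le_rpow_of_one_le (by linarith) hc)
  have h2 : 1 / (n : ℝ) ^ c ≤ 1 / 4 := one_div_le_one_div_of_le (by norm_num) h1
  linarith

/-- A running time in which the circuit acceptance probability problem can be solved on average is
at least linear. -/
theorem exists_linear_le {c : ℝ} (hc : 1 ≤ c) {e : ℕ} (he : 1 ≤ e) {T : ℕ → ℕ} (hmono : Monotone T)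
    (hT : TimeConstructible T) {A : ProbTM} {a : ℕ}
    (hA : ∀ D : ℕ → PMF (List Bool), PolySamplable D →
      (∀ n, ∀ C ∈ (D n).support, C.length = n ^ e) →
      ∃ᶠ n : ℕ in atTop, 1 - 1 / (n : ℝ) ^ c ≤ prob (D n) (cappSuccess A e T a n)) :
    ∃ B, ∀ n, n ≤ B * T n + B := by
  refine (hT.linear_or_eventually_const hmono).resolve_right ?_
  rintro ⟨m, hm⟩
  refine hA _ (polySamplable_constCircuit e) (fun n C hC => ?_) ?_
  · rw [PMF.support_map] at hC
    obtain ⟨z, -, rfl⟩ := hC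
    exact length_padTo _ _
  -- The time bound for `A` is constant from `m` on, hence below `n - 1` for these `n`.
  · filter_upwards [eventually_ge_atTop (m + (a * T m + a) + 4)] with n hn
    obtain ⟨b, hb⟩ := not_correct_on_constCircuit (A := A) (t := a * T n + a) (n := n)
      (by rw [hm n (by omega)]; omega) (by omega) he
    rw [not_le, prob_map]
    exact (prob_unifBits_one_le hb).trans_lt (half_lt_one_sub_one_div_rpow hc (by omega))

end

section

open ProbTM Filter

/-! ### The reduction -/

theorem PT.unaryPair {α : Type} [Enc α] {f : α → ℕ} {s : α → Str} (hf : PT f) (hs : PT s) :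
    PT fun a => Str.mk (_root_.unaryPair (f a) (s a).bits) := by
  have h : PT fun a => Str.mk (List.replicate (f a) true) := PT.of_enc_eq hf fun _ => rfl
  exact h.strAppend (hs.strCons false)

theorem PT.polyTime_unaryPair {G : List Bool → List Bool}
    (hG : PT fun x : Str => Str.mk (G x.bits)) :
    PolyTime fun x => _root_.unaryPair x.length (G x) :=
  ((PT.strLength PT.id).unaryPair hG).polyTime

theorem PolySamplable.map {I : ℕ → PMF (List Bool)} (hI : PolySamplable I)
    {G : List Bool → List Bool} (hG : PT fun x : Str => Str.mk (G x.bits)) :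
    PolySamplable fun n => (I n).map G := by
  obtain ⟨f, hf, p, hfp⟩ := hI
  refine ⟨_, PT.polyTime_comp hf hG, p, fun n => ?_⟩
  simp only [hfp, PMF.map_comp]
  rfl

end

open ProbTM Filter in
theorem theorem4p3 (c : ℝ) (hc : 1 ≤ c) (d : ℕ) (hd : 1 ≤ d)
    (T : ℕ → ℕ) (hTmono : Monotone T) (hTconstr : TimeConstructible T)
    (hCAPP : ∃ (A : ProbTM) (a : ℕ), IsPseudodeterministic A (d + 1) T a ∧
      ∀ D : ℕ → PMF (List Bool), PolySamplable D →
        (∀ n, ∀ C ∈ (D n).support, C.length = n ^ (d + 1)) →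
        ∃ᶠ n : ℕ in Filter.atTop,
          1 - 1 / (n : ℝ) ^ c ≤ prob (D n) (cappSuccess A (d + 1) T a n)) :
    ∃ L ∈ BPTIME T, ∀ L₀ ∈ BPTIME (fun n => n ^ d),
      ∃ R : List Bool → List Bool, PolyTime R ∧
        ∀ I : ℕ → PMF (List Bool), PolySamplable I →
          (∀ n, ∀ x ∈ (I n).support, x.length = n) →
          ∃ᶠ n : ℕ in Filter.atTop,
            1 - 1 / (n : ℝ) ^ c ≤ prob (I n) {x | x ∈ L₀ ↔ R x ∈ L} := by
  obtain ⟨A, a, hA, hsucc⟩ := hCAPP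
  refine ⟨halfLanguage A (d + 1) T a, halfLanguage_mem_BPTIME hA hTmono
    (exists_linear_le hc (by omega) hTmono hTconstr hsucc), ?_⟩
  rintro L₀ ⟨M, C, hM⟩
  obtain ⟨base, hg, hb⟩ := exists_step_program M
  have hG := polyTime_circuitOf M base C d
  refine ⟨fun x => unaryPair x.length (circuitOf M base C d x), hG.polyTime_unaryPair,
    fun I hI hsupp => ?_⟩
  have hlen : ∀ n, ∀ x ∈ (I n).support, (circuitOf M base C d x).length = n ^ (d + 1) :=
    fun n x hx => by rw [circuitOf, length_padTo, hsupp n x hx]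
  -- The average-case hypothesis is applied to the distribution of the circuit of a random input.
  have hD := hsucc (fun n => (I n).map (circuitOf M base C d))
    (hI.map hG)
    (fun n y hy => by
      rw [PMF.support_map] at hy
      obtain ⟨x, hx, rfl⟩ := hy
      exact hlen n x hx)
  refine (hD.and_eventually ((eventually_acceptProb_circuitOf M hg hb C hd).and
    (eventually_ge_atTop 1))).mono ?_
  rintro n ⟨hn, hacc, hn1⟩
  refine hn.trans ?_
  rw [prob_map]
  refine prob_mono fun x hx => ?_
  rintro ⟨μ, hμ, -, -, hcorrect⟩
  obtain rfl := hsupp n x hx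
  obtain ⟨hhalt, hyes, hno⟩ := hM x
  rw [hacc x rfl hhalt, abs_le] at hcorrect
  refine Iff.trans ?_ (unaryPair_mem_halfLanguage hn1 (hlen _ x hx) hμ).symm
  -- The answer is at least `2/3 - 1/10 > 1/2` in the first case and at most `1/3 + 1/10 < 1/2` in
  -- the second.
  by_cases hx0 : x ∈ L₀
  · exact iff_of_true hx0 (by linarith [hyes hx0])
  · exact iff_of_false hx0 (by linarith [hno hx0])
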